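/- Let $c>0$, $T=\log\sqrt3$, and let the pseudo $Y$-catenoid $M=Y_{\pi/3}=(\Sigma_1,\Sigma_2,\Sigma_3;\Gamma)$ be the triple junction surface in $\mathbb{R}^3$ whose faces are parametrized for $t\ge 0$, $\theta\in\mathbb{R}/2\pi\mathbb{Z}$ by $$X_{1},X_{3}(t,\theta)=c\,(\cosh(t-T)\cos\theta,\ \cosh(t-T)\sin\theta,\ \pm t),\qquad X_2(t,\theta)=c\,\big((t+\tfrac{2}{\sqrt3})\cos\theta,\ (t+\tfrac{2}{\sqrt3})\sin\theta,\ 0\big),$$ with common boundary the circle $\Gamma=\{t=0\}$ of radius $2c/\sqrt3$. (So $\Sigma_2$ is the horizontal plane minus a disk, and $\Sigma_1,\Sigma_3$ are two symmetric non-graphical catenoidal ends meeting the plane at $60^\circ$.) For functions $u=(u_1,u_2,u_3)$, $v=(v_1,v_2,v_3)$ on the faces put $$Q(u,v)=\sum_{i=1}^3\Big(\int_{\Sigma_i}\langle\nabla u_i,\nabla v_i\rangle-|A_{\Sigma_i}|^2u_iv_i-\int_\Gamma (H_\Gamma\cdot\nu_i)\,u_iv_i\Big),$$ where $A_{\Sigma_i}$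 is the second fundamental form, $H_\Gamma$ the curvature vector of $\Gamma$ and $\nu_i$ the outward unit conormal of $\Sigma_i$ along $\Gamma$. Call $u$ compatible if the traces satisfy $u_1+u_2+u_3=0$ on $\Gamma$. Let $W_{\Delta,c}$ be the space of compatible compactly supported $W^{1,2}$ functions (the support may meet $\Gamma$), and let $W_{\Delta,*}$ be the space of compatible weakly differentiable functions with $\int|\nabla u|^2<\infty$, trace in $L^2(\Gamma)$, and $\int u^2(1+|x|^2)^{-1}(\log(2+|x|))^{-2}<\infty$. The index of $Q$ on a space is the maximal dimension of a linear subspace on which $Q$ is negative definite; the null space of $Q$ on $W_{\Delta,*}$ is $\{u\in W_{\Delta,*}: Q(u,v)=0\ \ \forall v\in W_{\Delta,*}\}$, and the nullity is its dimension. **Theorem.** The Morse index of $M$ (the index of $Q$ on $W_{\Delta,c}$) is $2$; the index of $Q$ on $W_{\Delta,*}$ is also $2$. The fixed-interface (Dirichlet) indices of the faces $\Sigma_1,\Sigma_2,\Sigma_3$, that is, the indices of $\int_{\Sigma_i}|\nabla u|^2-|A_{\Sigma_i}|^2u^2$ on compactly supported $W^{1,2}$ functions on $\Sigma_i$ vanishing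 on $\Gamma$, are $1,0,1$. The nullity of $M$ is $5$; the null space is the direct sum of a one-dimensional space of functions depending, on each face, only on $t$, and a four-dimensional space of functions of the form $f_i(t)\cos\theta+h_i(t)\sin\theta$ on each face. -/

import Mathlib

open Real Set MeasureTheory
open scoped ContDiff

noncomputable section

namespace TripleJunction

/-- Euclidean three-space. -/
abbrev E3 : Type := EuclideanSpace ℝ (Fin 3)

/-! ## Parametrized faces

A face is the half cylinder `[0, ∞) × 𝕊¹`, mapped to `ℝ³` by a map `X (t, θ)` which is
`2π`-periodic in `θ`; its boundary circle is `t = 0`. The map is given by a formula on `ℝ × ℝ`, and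
integrals are taken over the fundamental domain `0 < t`, `0 < θ ≤ 2π`. -/

/-- The coordinate measure `dt dθ` on the half cylinder. -/
def stripMeasure : Measure (ℝ × ℝ) :=
  (volume : Measure (ℝ × ℝ)).restrict (Ioi 0 ×ˢ Ioc 0 (2 * π))

/-- The coordinate measure `dθ` on the boundary circle. -/
def circleMeasure : Measure ℝ := (volume : Measure ℝ).restrict (Ioc 0 (2 * π))

/-! ### Geometry of a face -/

/-- `∂X/∂t`. -/
def dT (X : ℝ × ℝ → E3) (z : ℝ × ℝ) : E3 := fderiv ℝ X z (1, 0)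

/-- `∂X/∂θ`. -/
def dTheta (X : ℝ × ℝ → E3) (z : ℝ × ℝ) : E3 := fderiv ℝ X z (0, 1)

/-- The first fundamental form in the coordinates `(t, θ)`. -/
def firstForm (X : ℝ × ℝ → E3) (z : ℝ × ℝ) : Matrix (Fin 2) (Fin 2) ℝ :=
  !![inner ℝ (dT X z) (dT X z), inner ℝ (dT X z) (dTheta X z);
     inner ℝ (dTheta X z) (dT X z), inner ℝ (dTheta X z) (dTheta X z)]

/-- The unit normal `X_t × X_θ / |X_t × X_θ|`. -/
def unitNormal (X : ℝ × ℝ → E3) (z : ℝ × ℝ) : E3 :=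
  let m : E3 := WithLp.toLp 2 (crossProduct (WithLp.ofLp (dT X z)) (WithLp.ofLp (dTheta X z)))
  ‖m‖⁻¹ • m

/-- The second fundamental form in the coordinates `(t, θ)`. -/
def secondForm (X : ℝ × ℝ → E3) (z : ℝ × ℝ) : Matrix (Fin 2) (Fin 2) ℝ :=
  !![inner ℝ (dT (dT X) z) (unitNormal X z), inner ℝ (dT (dTheta X) z) (unitNormal X z);
     inner ℝ (dTheta (dT X) z) (unitNormal X z), inner ℝ (dTheta (dTheta X) z) (unitNormal X z)]

/-- `|A|²`, the squared norm of the second fundamental form: the trace of the square of the shape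
operator. -/
def normSqA (X : ℝ × ℝ → E3) (z : ℝ × ℝ) : ℝ :=
  (((firstForm X z)⁻¹ * secondForm X z) * ((firstForm X z)⁻¹ * secondForm X z)).trace

/-- The area measure of the face, `√(det g) dt dθ`. -/
def areaMeasure (X : ℝ × ℝ → E3) : Measure (ℝ × ℝ) :=
  stripMeasure.withDensity fun z => ENNReal.ofReal √(firstForm X z).det

/-- The measure `(1 + |x|²)⁻¹ (log (2 + |x|))⁻² dA`, whose `L²` space is the weighted space `L²_*`
of the face. -/
def starMeasure (X : ℝ × ℝ → E3) : Measure (ℝ × ℝ) :=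
  (areaMeasure X).withDensity fun z =>
    ENNReal.ofReal ((1 + ‖X z‖ ^ 2)⁻¹ * (log (2 + ‖X z‖) ^ 2)⁻¹)

/-- The tangential gradient, as a vector in `ℝ³`, of a function on the face whose partial
derivatives in `t` and `θ` at `z` are `p` and `q`. -/
def gradVec (X : ℝ × ℝ → E3) (z : ℝ × ℝ) (p q : ℝ) : E3 :=
  ((firstForm X z)⁻¹.mulVec ![p, q]) 0 • dT X z + ((firstForm X z)⁻¹.mulVec ![p, q]) 1 • dTheta X z

/-- The boundary curve of the face. -/
def boundaryCurve (X : ℝ × ℝ → E3) (θ : ℝ) : E3 := X (0, θ)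

/-- The length measure of the boundary curve. -/
def lengthMeasure (X : ℝ × ℝ → E3) : Measure ℝ :=
  circleMeasure.withDensity fun θ => ENNReal.ofReal ‖deriv (boundaryCurve X) θ‖

/-- The curvature vector `H` of the boundary curve: its second derivative in arc length. -/
def curvatureVec (X : ℝ × ℝ → E3) (θ : ℝ) : E3 :=
  let v := deriv (boundaryCurve X) θ
  let a := deriv (deriv (boundaryCurve X)) θ
  (‖v‖ ^ 2)⁻¹ • (a - (inner ℝ a v / ‖v‖ ^ 2) • v)

/-- The outward unit conormal `ν` of the face along its boundary: the unit tangent vector of the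
face which is orthogonal to the boundary curve and points towards decreasing `t`. -/
def conormal (X : ℝ × ℝ → E3) (θ : ℝ) : E3 :=
  let x := dT X (0, θ)
  let y := dTheta X (0, θ)
  let w := (inner ℝ x y / ‖y‖ ^ 2) • y - x
  ‖w‖⁻¹ • w

/-! ### Sobolev functions on a face -/

/-- Functions on a face modulo equality almost everywhere. -/
abbrev FaceFun : Type := (ℝ × ℝ) →ₘ[stripMeasure] ℝ

/-- Functions on the boundary circle modulo equality almost everywhere. -/
abbrev CircleFun : Type := ℝ →ₘ[circleMeasure] ℝ

/-- A quadruple `(u, u_t, u_θ, u|_Γ)`. A Sobolev function `u` is recorded together with its weak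
partial derivatives and its boundary trace, all three of which are determined by `u` through
`HasWeakGradTrace`. -/
abbrev Jet : Type := FaceFun × FaceFun × FaceFun × CircleFun

namespace Jet

/-- The function `u` itself. -/
def val (φ : Jet) : FaceFun := φ.1

/-- The weak derivative `u_t`. -/
def pt (φ : Jet) : FaceFun := φ.2.1

/-- The weak derivative `u_θ`. -/
def pθ (φ : Jet) : FaceFun := φ.2.2.1

/-- The trace on `t = 0`. -/
def trace (φ : Jet) : CircleFun := φ.2.2.2

end Jet

/-- Test functions: smooth on the half cylinder (up to and including the boundary `t = 0`, where
they need not vanish), and zero for large `t`. -/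
def IsTest (η : ℝ × ℝ → ℝ) : Prop :=
  ContDiff ℝ ∞ η ∧ (∀ t θ, η (t, θ + 2 * π) = η (t, θ)) ∧ ∃ b : ℝ, ∀ t θ, b ≤ t → η (t, θ) = 0

/-- Local integrability on the half cylinder, up to the boundary. -/
def LocInt (f : FaceFun) : Prop :=
  ∀ b : ℝ, IntegrableOn f (Iio b ×ˢ univ) stripMeasure

/-- `pt` and `pθ` are the weak partial derivatives of `val`, and `trace` is its trace on `t = 0`:
integration by parts holds against all test functions. -/
def HasWeakGradTrace (φ : Jet) : Prop :=
  LocInt φ.val ∧ LocInt φ.pt ∧ LocInt φ.pθ ∧ Integrable φ.trace circleMeasure ∧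
  ∀ η : ℝ × ℝ → ℝ, IsTest η →
    (∫ z, φ.val z * fderiv ℝ η z (1, 0) ∂stripMeasure
      = -(∫ z, φ.pt z * η z ∂stripMeasure) - ∫ θ, φ.trace θ * η (0, θ) ∂circleMeasure) ∧
    (∫ z, φ.val z * fderiv ℝ η z (0, 1) ∂stripMeasure
      = -∫ z, φ.pθ z * η z ∂stripMeasure)

/-- The tangential gradient of a Sobolev function. -/
def grad (X : ℝ × ℝ → E3) (φ : Jet) (z : ℝ × ℝ) : E3 := gradVec X z (φ.pt z) (φ.pθ z)

/-- Weakly differentiable functions with square integrable gradient and trace. -/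
def FiniteEnergy (X : ℝ × ℝ → E3) (φ : Jet) : Prop :=
  HasWeakGradTrace φ ∧ MemLp (grad X φ) 2 (areaMeasure X) ∧ MemLp φ.trace 2 (lengthMeasure X)

/-- `W^{1,2}` functions on the face with compact support (which may meet the boundary `t = 0`). -/
def MemWc (X : ℝ × ℝ → E3) (φ : Jet) : Prop :=
  FiniteEnergy X φ ∧ MemLp φ.val 2 (areaMeasure X) ∧
    ∃ b : ℝ, ∀ᵐ z ∂stripMeasure, b < z.1 → φ.val z = 0

/-- Functions on the face that lie in `L²_*` and have a square integrable gradient. -/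
def MemWStar (X : ℝ × ℝ → E3) (φ : Jet) : Prop :=
  FiniteEnergy X φ ∧ MemLp φ.val 2 (starMeasure X)

/-- `∫ ⟨∇u, ∇v⟩ - |A|² u v` over the face. -/
def faceForm (X : ℝ × ℝ → E3) (φ ψ : Jet) : ℝ :=
  ∫ z, (inner ℝ (grad X φ z) (grad X ψ z) - normSqA X z * (φ.val z * ψ.val z)) ∂(areaMeasure X)

/-- `∫ (H · ν) u v` over the boundary curve. -/
def boundaryForm (X : ℝ × ℝ → E3) (φ ψ : Jet) : ℝ :=
  ∫ θ, inner ℝ (curvatureVec X θ) (conormal X θ) * (φ.trace θ * ψ.trace θ) ∂(lengthMeasure X)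

/-! ### Triple junctions

Three faces `M i` glued along `t = 0`, where the three maps `θ ↦ M i (0, θ)` agree. -/

/-- Functions on the three faces. -/
abbrev JFun : Type := Fin 3 → Jet

/-- The index form (second variation of area). -/
def indexForm (M : Fin 3 → ℝ × ℝ → E3) (φ ψ : JFun) : ℝ :=
  ∑ i, (faceForm (M i) (φ i) (ψ i) - boundaryForm (M i) (φ i) (ψ i))

/-- The compatibility condition along the junction: the three traces add up to zero. -/
def Compatible (φ : JFun) : Prop := (φ 0).trace + (φ 1).trace + (φ 2).trace = 0

/-- `W^{1,2}_{Δ,c}`: compatible compactly supported Sobolev functions. -/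
def WDeltaC (M : Fin 3 → ℝ × ℝ → E3) : Set JFun :=
  {φ | (∀ i, MemWc (M i) (φ i)) ∧ Compatible φ}

/-- Compatible functions in `L²_*` with square integrable gradient. -/
def WDeltaStar (M : Fin 3 → ℝ × ℝ → E3) : Set JFun :=
  {φ | (∀ i, MemWStar (M i) (φ i)) ∧ Compatible φ}

/-- Compactly supported Sobolev functions on one face that vanish on its boundary. -/
def WDirichlet (X : ℝ × ℝ → E3) : Set Jet :=
  {φ | MemWc X φ ∧ φ.trace = 0}

/-- `n` is the largest dimension of a linear subspace contained in `D` on which `B` is negative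
definite. -/
def HasIndex {V : Type*} [AddCommGroup V] [Module ℝ V] (D : Set V) (B : V → V → ℝ) (n : ℕ) :
    Prop :=
  IsGreatest {k : ℕ | ∃ S : Submodule ℝ V, (S : Set V) ⊆ D ∧ FiniteDimensional ℝ S ∧
    Module.finrank ℝ S = k ∧ ∀ φ ∈ S, φ ≠ 0 → B φ φ < 0} n

/-- The null space of `B` on `D`. -/
def nullSet {V : Type*} (D : Set V) (B : V → V → ℝ) : Set V :=
  {φ | φ ∈ D ∧ ∀ ψ ∈ D, B φ ψ = 0}

/-- On each face the function depends on `t` only. -/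
def IsRadial (φ : JFun) : Prop :=
  ∃ f : Fin 3 → ℝ → ℝ, ∀ i, ∀ᵐ z ∂stripMeasure, (φ i).val z = f i z.1

/-- On each face the function has the form `f(t) cos θ + h(t) sin θ`. -/
def IsFirstMode (φ : JFun) : Prop :=
  ∃ f h : Fin 3 → ℝ → ℝ, ∀ i, ∀ᵐ z ∂stripMeasure,
    (φ i).val z = f i z.1 * cos z.2 + h i z.1 * sin z.2

/-! ### The pseudo Y-catenoid -/

/-- The catenoidal end `c (cosh (t - log √3) cos θ, cosh (t - log √3) sin θ, σ t)`. -/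
def catenoidFace (c σ : ℝ) (z : ℝ × ℝ) : E3 :=
  !₂[c * (cosh (z.1 - log √3) * cos z.2), c * (cosh (z.1 - log √3) * sin z.2), c * (σ * z.1)]

/-- The horizontal plane outside the disk of radius `2c/√3`. -/
def planeFace (c : ℝ) (z : ℝ × ℝ) : E3 :=
  !₂[c * ((z.1 + 2 / √3) * cos z.2), c * ((z.1 + 2 / √3) * sin z.2), 0]

/-- The pseudo Y-catenoid whose interface is the circle of radius `2c/√3`. -/
def pseudoYCatenoid (c : ℝ) : Fin 3 → ℝ × ℝ → E3 :=
  ![catenoidFace c 1, planeFace c, catenoidFace c (-1)]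

end TripleJunction

end

open Real Set MeasureTheory
open scoped ContDiff

noncomputable section

namespace TripleJunction

open Filter Topology

/-! ## Primitives of locally integrable functions on `[0, ∞)` -/

/-! In the coordinates `(t, θ)` each face is a half cylinder on which the quadratic form of `Q`
reads `∫ (w u_t² + w⁻¹ u_θ² - V u²) dt dθ - β ∫ u(0, θ)² dθ`. On the catenoids `w = 1`, `V = 2
sch²`, `β = -1/2`; on the plane `w = rad`, `V = 0`, `β = 1`. `IsFace` records this together with the
densities of the function spaces, and the geometry is not used afterwards. Parseval's identity on
circles then splits the form of a face into one-dimensional forms `modeForm`, one for each `cos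
(kθ)` and `sin (kθ)` (`IsFace.hasSum_modeForm`).

The modes `k ≠ 0` are stable on each face separately. The functions `sch` and `1 / rad` are positive
decaying solutions of the equation for `k = 1`; completing the square with them leaves a boundary
term that `β` cancels exactly (`catenoid_mode_identity`, `plane_mode_identity`). What remains is a
square plus `k² - 1` times a weighted `L²` norm. So these forms are nonnegative, and a mode of zero
form vanishes as soon as `k² > 1` or its boundary value is zero (`ModeStable`).

The index comes from the radial modes of the catenoids. The radial Jacobi function `tnh` changes
sign at the neck `t = log √3`. If a radial mode `a` vanishes at the neck, completing the square with
`tnh' / tnh` on both sides of it bounds the form below by `2 a(0)²` (`catenoid_radial_le`,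
`radialForm_catenoid_ge`). On the plane the lower bound is `-a(0)²`. If `x`, `y` are the boundary
values on the catenoids, compatibility makes the one on the plane `-(x + y)`, and `2x² + 2y² - (x +
y)² = (x - y)² ≥ 0`. Hence the form is nonnegative on the common kernel of two linear functionals,
and the index is at most two. Conversely, a tent function vanishing on the boundary has negative
energy on each catenoid (`modeForm_tent_neg`), which gives two independent negative directions. The
same two facts give the Dirichlet index of a catenoid; the plane has no potential.

For the nullity, testing a null function against functions of zero trace shows that its radial modes
solve the radial Jacobi equation weakly, and finite energy excludes the growing solutions. So they
are multiples of `tnh` on the catenoids and constant on the plane. If moreover five boundary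
coefficients vanish, `Q(d, d) = 0` becomes a sum of nonnegative terms, all of which must vanish
(`eq_zero_of_null`); the nullity is at most five. Five independent null functions are explicit. One
is `(tnh, 1, tnh)`, the normal part of a vertical translation. The others are `(sch, -1/rad, 0)` and
`(0, -1/rad, sch)` times `cos θ` or `sin θ`; for each angular factor the difference of the two is,
up to sign, the normal part of a horizontal translation. -/

/-- `a` is, on `[0, ∞)`, a primitive of the locally integrable function `p`. -/
def IsPrim (a p : ℝ → ℝ) : Prop :=
  (∀ b, IntegrableOn p (Ioc 0 b)) ∧ ∀ t, 0 ≤ t → a t = a 0 + ∫ s in (0)..t, p s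

/-- Smooth functions on the line that vanish for large `t`. -/
def IsCutoff (χ : ℝ → ℝ) : Prop :=
  ContDiff ℝ ∞ χ ∧ ∃ b : ℝ, ∀ t, b ≤ t → χ t = 0

lemma intervalIntegrable_of_loc {p : ℝ → ℝ} (h : ∀ b, IntegrableOn p (Ioc 0 b)) {x y : ℝ}
    (hx : 0 ≤ x) (hy : 0 ≤ y) : IntervalIntegrable p volume x y := by
  have key : ∀ t, 0 ≤ t → IntervalIntegrable p volume 0 t := fun t ht =>
    (intervalIntegrable_iff_integrableOn_Ioc_of_le ht).2 (h t)
  exact (key x hx).symm.trans (key y hy)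

lemma integrableOn_mul_of_vanish {p g : ℝ → ℝ} (h : ∀ b, IntegrableOn p (Ioc 0 b))
    (hg : Continuous g) {b : ℝ} (hb : ∀ t, b ≤ t → g t = 0) :
    IntegrableOn (fun t => p t * g t) (Ioi 0) := by
  have h1 : IntegrableOn (fun t => p t * g t) (Ioc 0 b) := by
    have h2 : IntegrableOn p (Icc 0 b) := (integrableOn_Icc_iff_integrableOn_Ioc (by simp)).2 (h b)
    exact (h2.mul_continuousOn hg.continuousOn isCompact_Icc).mono_set Ioc_subset_Icc_self
  refine h1.of_forall_sdiff_eq_zero measurableSet_Ioi ?_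
  intro t ht
  have : b < t := by
    by_contra hlt
    exact ht.2 ⟨ht.1, not_lt.1 hlt⟩
  simp [hb t this.le]

lemma loc_of_continuous {g : ℝ → ℝ} (hg : Continuous g) (b : ℝ) : IntegrableOn g (Ioc 0 b) :=
  (hg.continuousOn.integrableOn_Icc).mono_set Ioc_subset_Icc_self

namespace IsPrim

variable {a b p q : ℝ → ℝ}

lemma of_hasDerivAt {f f' : ℝ → ℝ} (h : ∀ t, HasDerivAt f (f' t) t) (hc : Continuous f') :
    IsPrim f f' := by
  refine ⟨loc_of_continuous hc, fun t _ => ?_⟩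
  rw [intervalIntegral.integral_eq_sub_of_hasDerivAt (fun x _ => h x) (hc.intervalIntegrable _ _)]
  ring

lemma sub_eq (h : IsPrim a p) {x y : ℝ} (hx : 0 ≤ x) (hy : 0 ≤ y) :
    ∫ s in x..y, p s = a y - a x := by
  rw [h.2 x hx, h.2 y hy, ← intervalIntegral.integral_interval_sub_left
    (intervalIntegrable_of_loc h.1 le_rfl hy) (intervalIntegrable_of_loc h.1 le_rfl hx)]
  ring

/-- The explicit integral replaces `a`, because `a` is controlled on `[0, ∞)` only, while the
product rule below uses two-sided derivatives. -/
lemma abs_cont (h : IsPrim a p) {t : ℝ} (ht : 0 ≤ t) :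
    AbsolutelyContinuousOnInterval (fun x => a 0 + ∫ s in (0)..x, p s) 0 t := by
  have h1 :=
    (intervalIntegrable_of_loc h.1 le_rfl ht).absolutelyContinuousOnInterval_intervalIntegral
      (c := 0) (by simp)
  have h2 : AbsolutelyContinuousOnInterval (fun _ : ℝ => a 0) 0 t :=
    (LipschitzOnWith.of_dist_le_mul (K := 0) (by simp)).absolutelyContinuousOnInterval
  exact h2.add h1

lemma continuousOn (h : IsPrim a p) : ContinuousOn a (Ici 0) := by
  have key : ∀ t, 0 ≤ t → ContinuousOn a (Icc 0 t) := by
    intro t ht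
    have := (h.abs_cont ht).continuousOn
    rw [uIcc_of_le ht] at this
    exact this.congr fun x hx => h.2 x hx.1
  intro x hx
  have h1 := key (x + 1) (by linarith [mem_Ici.1 hx]) x ⟨hx, by linarith⟩
  refine h1.mono_of_mem_nhdsWithin ?_
  rw [← Ici_inter_Iic]
  exact inter_mem self_mem_nhdsWithin (mem_nhdsWithin_of_mem_nhds (Iic_mem_nhds (by linarith)))

lemma loc (h : IsPrim a p) (t : ℝ) : IntegrableOn a (Ioc 0 t) :=
  ((h.continuousOn.mono fun _ hx => hx.1).integrableOn_Icc (b := t)).mono_set Ioc_subset_Icc_self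

lemma loc_mul (h : IsPrim a p) (hq : ∀ b, IntegrableOn q (Ioc 0 b)) (t : ℝ) :
    IntegrableOn (fun s => a s * q s) (Ioc 0 t) := by
  have h2 : IntegrableOn q (Icc 0 t) := (integrableOn_Icc_iff_integrableOn_Ioc (by simp)).2 (hq t)
  exact (h2.continuousOn_mul (h.continuousOn.mono fun x hx => hx.1) isCompact_Icc).mono_set
    Ioc_subset_Icc_self

/-- Integration by parts for absolutely continuous functions; by Lebesgue differentiation the
derivative of an indefinite integral is its integrand almost everywhere. -/
lemma mul (ha : IsPrim a p) (hb : IsPrim b q) :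
    IsPrim (fun t => a t * b t) (fun t => p t * b t + a t * q t) := by
  refine ⟨fun t => ?_, fun t ht => ?_⟩
  · exact ((hb.loc_mul ha.1 t).congr_fun (fun s _ => mul_comm _ _) measurableSet_Ioc).add
      (ha.loc_mul hb.1 t)
  · have h1 := (ha.abs_cont ht).integral_deriv_mul_eq_sub (hb.abs_cont ht)
    have h2 : ∫ x in (0)..t, (p x * b x + a x * q x) = ∫ x in (0)..t,
        (deriv (fun x => a 0 + ∫ s in (0)..x, p s) x * (b 0 + ∫ s in (0)..x, q s) +
        (a 0 + ∫ s in (0)..x, p s) * deriv (fun x => b 0 + ∫ s in (0)..x, q s) x) := by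
      apply intervalIntegral.integral_congr_ae
      filter_upwards [(intervalIntegrable_of_loc ha.1 le_rfl ht).ae_hasDerivAt_integral,
        (intervalIntegrable_of_loc hb.1 le_rfl ht).ae_hasDerivAt_integral] with x hx hy hm
      have hm' : x ∈ uIcc 0 t := uIoc_subset_uIcc hm
      have h3 := ((hx hm' 0 (by simp)).const_add (a 0)).deriv
      have h4 := ((hy hm' 0 (by simp)).const_add (b 0)).deriv
      rw [uIcc_of_le ht] at hm'
      rw [h3, h4, ha.2 x hm'.1, hb.2 x hm'.1]
    simp only [intervalIntegral.integral_same, add_zero] at h1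
    rw [← ha.2 t ht, ← hb.2 t ht] at h1
    rw [h2, h1]; ring

lemma congr_right (ha : IsPrim a p) (h : p =ᵐ[volume.restrict (Ioi 0)] q) : IsPrim a q := by
  have h' : ∀ t, p =ᵐ[volume.restrict (Ioc 0 t)] q := fun t =>
    ae_restrict_of_ae_restrict_of_subset Ioc_subset_Ioi_self h
  refine ⟨fun t => (ha.1 t).congr (h' t), fun t ht => ?_⟩
  rw [ha.2 t ht, intervalIntegral.integral_of_le ht, intervalIntegral.integral_of_le ht,
    integral_congr_ae (h' t)]

/-- A primitive of a function that vanishes almost everywhere is constant. -/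
lemma eq_const (ha : IsPrim a p) (h : p =ᵐ[volume.restrict (Ioi 0)] 0) {t : ℝ} (ht : 0 ≤ t) :
    a t = a 0 := by
  rw [(ha.congr_right h).2 t ht]; simp

lemma integral_Ioi_of_tendsto (ha : IsPrim a p) (hp : IntegrableOn p (Ioi 0)) {L : ℝ}
    (h : Tendsto a atTop (𝓝 L)) : ∫ t in Ioi 0, p t = L - a 0 := by
  have h1 := intervalIntegral_tendsto_integral_Ioi 0 hp tendsto_id
  have h2 : Tendsto (fun t => ∫ s in (0)..t, p s) atTop (𝓝 (L - a 0)) := by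
    refine (h.sub_const (a 0)).congr' ?_
    filter_upwards [eventually_ge_atTop 0] with t ht
    rw [ha.2 t ht]; ring
  exact tendsto_nhds_unique h1 h2

lemma exists_tendsto (ha : IsPrim a p) (hp : IntegrableOn p (Ioi 0)) :
    Tendsto a atTop (𝓝 (a 0 + ∫ t in Ioi 0, p t)) := by
  refine ((intervalIntegral_tendsto_integral_Ioi 0 hp tendsto_id).const_add (a 0)).congr' ?_
  filter_upwards [eventually_ge_atTop 0] with t ht
  rw [ha.2 t ht]; rfl

/-- An integrable derivative forces a limit at infinity, and a nonzero limit would make `1 / t`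
integrable there. This removes the boundary terms at infinity in all later integrations by parts. -/
lemma tendsto_zero (ha : IsPrim a p) (hp : IntegrableOn p (Ioi 0)) {ρ : ℝ} (hρ : 0 < ρ)
    (h : IntegrableOn (fun t => a t / (t + ρ)) (Ioi 0)) : Tendsto a atTop (𝓝 0) := by
  have h1 := ha.exists_tendsto hp
  set L := a 0 + ∫ t in Ioi 0, p t
  by_cases hL : L = 0
  · rwa [hL] at h1
  exfalso
  have h2 : ∀ᶠ t in atTop, |L| / 2 < |a t| :=
    h1.abs.eventually (lt_mem_nhds (by have := abs_pos.2 hL; linarith))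
  obtain ⟨b, hb⟩ := (h2.and (eventually_ge_atTop 0)).exists_forall_of_atTop
  -- Beyond `max b ρ` one has `|a t| > |L| / 2` and `t + ρ ≤ 2 t`, whence the factor `4 / |L|`.
  have h3 : IntegrableOn (fun t : ℝ => t⁻¹) (Ioi (max b ρ)) := by
    have h4 : IntegrableOn (fun t => (4 / |L|) * (a t / (t + ρ))) (Ioi (max b ρ)) :=
      (h.mono_set (Ioi_subset_Ioi ((hb b le_rfl).2.trans (le_max_left _ _)))).const_mul _
    refine Integrable.mono h4 (by fun_prop) ?_
    filter_upwards [ae_restrict_mem measurableSet_Ioi] with t ht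
    have ht1 : b < t := lt_of_le_of_lt (le_max_left _ _) ht
    have ht2 : ρ < t := lt_of_le_of_lt (le_max_right _ _) ht
    have h5 := (hb t ht1.le).1
    have h6 : 0 < |L| := abs_pos.2 hL
    have h7 : 0 < t := hρ.trans ht2
    have h8 : 0 < t + ρ := by linarith
    simp only [norm_eq_abs, abs_mul, abs_div, abs_inv, abs_abs]
    rw [abs_of_pos h7, abs_of_pos h8, abs_of_pos (by norm_num : (0:ℝ) < 4), inv_eq_one_div,
      div_mul_div_comm, div_le_div_iff₀ h7 (by positivity)]
    nlinarith
  exact not_integrableOn_Ioi_inv h3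

lemma integral_Ioi_of_vanish (ha : IsPrim a p) {b : ℝ} (hb : ∀ t, b ≤ t → a t = 0)
    (hp : IntegrableOn p (Ioi 0)) : ∫ t in Ioi 0, p t = - a 0 := by
  have : Tendsto a atTop (𝓝 0) := tendsto_const_nhds.congr' (by
    filter_upwards [eventually_ge_atTop b] with t ht using (hb t ht).symm)
  rw [ha.integral_Ioi_of_tendsto hp this]; ring

end IsPrim

namespace IsCutoff

variable {χ : ℝ → ℝ}

lemma hasDerivAt (h : IsCutoff χ) (t : ℝ) : HasDerivAt χ (deriv χ t) t :=
  (h.1.differentiable (by simp) t).hasDerivAt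

lemma continuous_deriv (h : IsCutoff χ) : Continuous (deriv χ) := h.1.continuous_deriv (by simp)

lemma isPrim (h : IsCutoff χ) : IsPrim χ (deriv χ) := .of_hasDerivAt h.hasDerivAt h.continuous_deriv

lemma deriv (h : IsCutoff χ) : IsCutoff (deriv χ) := by
  obtain ⟨h1, b, hb⟩ := h
  refine ⟨(contDiff_infty_iff_deriv.1 h1).2, b + 1, fun t ht => ?_⟩
  have : χ =ᶠ[𝓝 t] fun _ => 0 := by
    filter_upwards [Ioi_mem_nhds (show b < t by linarith)] with x hx using hb x (le_of_lt hx)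
  rw [this.deriv_eq]; simp

lemma integrableOn (h : IsCutoff χ) {p : ℝ → ℝ} (hp : ∀ b, IntegrableOn p (Ioc 0 b)) :
    IntegrableOn (fun t => p t * χ t) (Ioi 0) := by
  obtain ⟨h1, b, hb⟩ := h
  exact integrableOn_mul_of_vanish hp h1.continuous hb

end IsCutoff

/-- The smooth primitive, vanishing for large `t`, of a smooth function with compact support. -/
lemma exists_isCutoff_deriv_eq {g : ℝ → ℝ} (hg : ContDiff ℝ ∞ g) (hs : HasCompactSupport g) :
    ∃ χ, IsCutoff χ ∧ _root_.deriv χ = g := by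
  obtain ⟨b, hb⟩ := hs.isCompact.bddAbove
  have hd : ∀ t, HasDerivAt (fun x => ∫ s in (b + 1)..x, g s) (g t) t := fun t =>
    intervalIntegral.integral_hasDerivAt_right (hg.continuous.intervalIntegrable _ _)
      (hg.continuous.stronglyMeasurableAtFilter _ _) hg.continuous.continuousAt
  have hde : _root_.deriv (fun x => ∫ s in (b + 1)..x, g s) = g := funext fun t => (hd t).deriv
  -- The base point lies to the right of the support, so the primitive vanishes for large `t`; its
  -- value at `0` is unconstrained.
  refine ⟨fun x => ∫ s in (b + 1)..x, g s, ⟨?_, b + 1, fun t ht => ?_⟩, hde⟩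
  · exact contDiff_infty_iff_deriv.2 ⟨fun t => (hd t).differentiableAt, by rwa [hde]⟩
  · apply intervalIntegral.integral_zero_ae
    refine ae_of_all _ fun x hx => ?_
    rw [uIoc_of_le ht] at hx
    by_contra hne
    have := hb (subset_tsupport _ hne)
    linarith [hx.1]

/-- The fundamental lemma of the calculus of variations on the open half line. Only `g` supported in
`(0, ∞)` matter, and for these the integral over `Ioi 0` is the integral over the line. -/
lemma ae_eq_zero_of_cutoff {d : ℝ → ℝ} (hd : ∀ b, IntegrableOn d (Ioc 0 b))
    (h : ∀ g : ℝ → ℝ, ContDiff ℝ ∞ g → HasCompactSupport g → ∫ t in Ioi 0, d t * g t = 0) :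
    d =ᵐ[volume.restrict (Ioi 0)] 0 := by
  rw [EventuallyEq, ae_restrict_iff' measurableSet_Ioi]
  refine isOpen_Ioi.ae_eq_zero_of_integral_contDiff_smul_eq_zero ?_ ?_
  · rw [locallyIntegrableOn_iff isOpen_Ioi.isLocallyClosed]
    intro k hk hc
    obtain ⟨b, hb⟩ := hc.bddAbove
    exact (hd b).mono_set fun x hx => ⟨hk hx, hb hx⟩
  · intro g h1 h2 h3
    rw [← h g h1 h2, ← integral_indicator measurableSet_Ioi]
    congr 1
    ext t
    by_cases ht : t ∈ Ioi (0:ℝ)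
    · simp [indicator_of_mem ht, mul_comm]
    · rw [indicator_of_notMem ht]
      have : g t = 0 := by
        by_contra hne
        exact ht (h3 (subset_tsupport _ hne))
      simp [this]

/-- A function with a weak derivative on the half line is almost everywhere a primitive. -/
lemma ae_eq_primitive {a p : ℝ → ℝ} {a₀ : ℝ} (ha : ∀ b, IntegrableOn a (Ioc 0 b))
    (hp : ∀ b, IntegrableOn p (Ioc 0 b))
    (h : ∀ χ, IsCutoff χ → ∫ t in Ioi 0, a t * deriv χ t = -(∫ t in Ioi 0, p t * χ t) - a₀ * χ 0) :
    a =ᵐ[volume.restrict (Ioi 0)] fun t => a₀ + ∫ s in (0)..t, p s := by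
  set U : ℝ → ℝ := fun t => a₀ + ∫ s in (0)..t, p s
  have hU0 : U 0 = a₀ := by simp [U]
  have hU : IsPrim U p := ⟨hp, fun t _ => by rw [hU0]⟩
  -- Every compactly supported `g` is `χ'` for a cutoff `χ`. The product rule for `U χ` gives `∫ U
  -- χ' = -∫ p χ - a₀ χ(0)`, which is also the value assumed for `∫ a χ'`.
  have key : (fun t => a t - U t) =ᵐ[volume.restrict (Ioi 0)] 0 := by
    refine ae_eq_zero_of_cutoff (fun b => (ha b).sub (hU.loc b)) fun g hg hs => ?_
    obtain ⟨χ, hχ, rfl⟩ := exists_isCutoff_deriv_eq hg hs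
    have h1 := h χ hχ
    obtain ⟨b, hb⟩ := hχ.2
    have i1 := hχ.integrableOn hp
    have i2 := hχ.deriv.integrableOn hU.loc
    have i3 := hχ.deriv.integrableOn ha
    have h2 := (hU.mul hχ.isPrim).integral_Ioi_of_vanish (b := b) (fun t ht => by simp [hb t ht])
      (i1.add i2)
    rw [integral_add i1 i2, hU0] at h2
    simp_rw [sub_mul]
    rw [integral_sub i3 i2]
    linarith
  filter_upwards [key] with t ht
  exact sub_eq_zero.1 ht

/-- A function on the half line with vanishing weak derivative is almost everywhere constant. -/
lemma exists_ae_eq_const {a : ℝ → ℝ} (ha : ∀ b, IntegrableOn a (Ioc 0 b))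
    (h : ∀ χ, IsCutoff χ → χ 0 = 0 → ∫ t in Ioi 0, a t * deriv χ t = 0) :
    ∃ C : ℝ, a =ᵐ[volume.restrict (Ioi 0)] fun _ => C := by
  -- Subtracting `χ(0) χ₀` from a cutoff `χ` makes it vanish at `0`, so that the hypothesis applies;
  -- the constant is the value left over by `χ₀`.
  obtain ⟨χ₀, h₀, h₁⟩ : ∃ χ₀, IsCutoff χ₀ ∧ χ₀ 0 = 1 := by
    let f : ContDiffBump (0 : ℝ) := ⟨1, 2, one_pos, one_lt_two⟩
    refine ⟨f, ⟨f.contDiff, 2, fun t ht => f.zero_of_le_dist ?_⟩,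
      f.one_of_mem_closedBall (by simp [f])⟩
    simpa [f] using ht.trans (le_abs_self t)
  refine ⟨-∫ t in Ioi 0, a t * deriv χ₀ t, ?_⟩
  have := ae_eq_primitive (p := 0) (a₀ := -∫ t in Ioi 0, a t * deriv χ₀ t) ha
    (fun b => integrableOn_zero) fun χ hχ => ?_
  · simpa using this
  have hc : IsCutoff fun t => χ t - χ 0 * χ₀ t := by
    obtain ⟨b, hb⟩ := hχ.2
    obtain ⟨b', hb'⟩ := h₀.2
    refine ⟨hχ.1.sub (contDiff_const.mul h₀.1), max b b', fun t ht => ?_⟩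
    simp [hb t (le_of_max_le_left ht), hb' t (le_of_max_le_right ht)]
  have h2 := h _ hc (by simp [h₁])
  have h3 : ∀ t, deriv (fun t => χ t - χ 0 * χ₀ t) t = deriv χ t - χ 0 * deriv χ₀ t := fun t =>
    ((hχ.hasDerivAt t).sub ((h₀.hasDerivAt t).const_mul _)).deriv
  simp_rw [h3, mul_sub, mul_left_comm _ (χ 0)] at h2
  rw [integral_sub (hχ.deriv.integrableOn ha) ((h₀.deriv.integrableOn ha).const_mul _),
    integral_const_mul] at h2
  simp
  linarith

/-! ## Model functions on the faces -/

/-- `tanh (t - log √3)`. -/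
def tnh (t : ℝ) : ℝ := Real.tanh (t - log √3)

/-- `1 / cosh (t - log √3)`. -/
def sch (t : ℝ) : ℝ := (Real.cosh (t - log √3))⁻¹

/-- The rescaled distance `t + 2/√3` to the axis, on the planar face. -/
def rad (t : ℝ) : ℝ := t + 2 / √3

lemma sch_pos (t : ℝ) : 0 < sch t := inv_pos.2 (Real.cosh_pos _)

lemma sch_le_one (t : ℝ) : sch t ≤ 1 := inv_le_one_of_one_le₀ (Real.one_le_cosh _)

lemma tnh_sq (t : ℝ) : tnh t ^ 2 = 1 - sch t ^ 2 := by
  have h := Real.cosh_sq (t - log √3)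
  have h0 := (Real.cosh_pos (t - log √3)).ne'
  rw [tnh, sch, Real.tanh_eq_sinh_div_cosh]
  field_simp
  linarith

lemma hasDerivAt_sch (t : ℝ) : HasDerivAt sch (-(sch t * tnh t)) t := by
  have h := ((((hasDerivAt_id t).sub_const (log √3)).cosh)).inv (Real.cosh_pos _).ne'
  convert! h using 1
  rw [sch, tnh, Real.tanh_eq_sinh_div_cosh]
  have h0 := (Real.cosh_pos (t - log √3)).ne'
  simp only [id]
  field_simp

lemma hasDerivAt_tnh (t : ℝ) : HasDerivAt tnh (sch t ^ 2) t := by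
  have h1 := ((hasDerivAt_id t).sub_const (log √3)).sinh
  have h := h1.mul (hasDerivAt_sch t)
  have h2 : tnh = fun t => Real.sinh (t - log √3) * sch t := by
    funext t; rw [tnh, sch, Real.tanh_eq_sinh_div_cosh]; rfl
  rw [h2]
  convert! h using 1
  rw [sch, tnh, Real.tanh_eq_sinh_div_cosh]
  have h0 := (Real.cosh_pos (t - log √3)).ne'
  have h3 := Real.cosh_sq (t - log √3)
  simp only [id]
  field_simp
  linarith

lemma contDiff_sch : ContDiff ℝ ∞ sch :=
  (Real.contDiff_cosh.comp (contDiff_id.sub contDiff_const)).inv fun _ => (Real.cosh_pos _).ne'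

lemma contDiff_tnh : ContDiff ℝ ∞ tnh := by
  have h2 : tnh = fun t => Real.sinh (t - log √3) * sch t := by
    funext t; rw [tnh, sch, Real.tanh_eq_sinh_div_cosh]; rfl
  rw [h2]
  exact (Real.contDiff_sinh.comp (contDiff_id.sub contDiff_const)).mul contDiff_sch

@[fun_prop] lemma continuous_sch : Continuous sch := contDiff_sch.continuous

@[fun_prop] lemma continuous_tnh : Continuous tnh := contDiff_tnh.continuous

@[fun_prop] lemma continuous_rad : Continuous rad := by unfold rad; fun_prop

lemma exp_log_sqrt_three : Real.exp (log √3) = √3 := Real.exp_log (by positivity)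

lemma cosh_log_sqrt_three : Real.cosh (log √3) = 2 / √3 := by
  have h : √3 * √3 = 3 := Real.mul_self_sqrt (by norm_num)
  have h0 : √3 ≠ 0 := by positivity
  rw [Real.cosh_eq, Real.exp_neg, exp_log_sqrt_three]
  field_simp
  nlinarith

lemma sinh_log_sqrt_three : Real.sinh (log √3) = 1 / √3 := by
  have h : √3 * √3 = 3 := Real.mul_self_sqrt (by norm_num)
  have h0 : √3 ≠ 0 := by positivity
  rw [Real.sinh_eq, Real.exp_neg, exp_log_sqrt_three]
  field_simp
  nlinarith

lemma sch_zero : sch 0 = √3 / 2 := by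
  rw [sch, zero_sub, Real.cosh_neg, cosh_log_sqrt_three, inv_div]

lemma tnh_zero : tnh 0 = -1 / 2 := by
  have h0 : √3 ≠ 0 := by positivity
  rw [tnh, zero_sub, Real.tanh_neg, Real.tanh_eq_sinh_div_cosh, cosh_log_sqrt_three,
    sinh_log_sqrt_three]
  field_simp

lemma sch_zero_sq : sch 0 ^ 2 = 3 / 4 := by
  rw [sch_zero, div_pow, Real.sq_sqrt (by norm_num)]; norm_num

lemma abs_tnh_le_one (t : ℝ) : |tnh t| ≤ 1 := by
  rw [abs_le_one_iff_mul_self_le_one]; nlinarith [tnh_sq t, sq_nonneg (sch t)]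

lemma rad_zero : rad 0 = 2 / √3 := by simp [rad]

lemma one_le_rad {t : ℝ} (ht : 0 ≤ t) : 1 ≤ rad t := by
  have h : √3 ≤ 2 := by rw [Real.sqrt_le_left (by norm_num)]; norm_num
  have : 1 ≤ 2 / √3 := by rw [le_div_iff₀ (by positivity)]; linarith
  unfold rad; linarith

lemma rad_pos {t : ℝ} (ht : 0 ≤ t) : 0 < rad t := by linarith [one_le_rad ht]

lemma hasDerivAt_rad (t : ℝ) : HasDerivAt rad 1 t := (hasDerivAt_id t).add_const _

/-! ## Quadratic forms on the half line -/

lemma _root_.MeasureTheory.Integrable.mul_of_sq {α : Type*} [MeasurableSpace α] {μ : Measure α}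
    {f g : α → ℝ} (mf : AEStronglyMeasurable f μ) (mg : AEStronglyMeasurable g μ)
    (hf : Integrable (fun x => f x ^ 2) μ) (hg : Integrable (fun x => g x ^ 2) μ) :
    Integrable (fun x => f x * g x) μ := by
  refine (hf.add hg).mono (mf.mul mg) (ae_of_all _ fun x => ?_)
  simp only [Pi.add_apply, norm_eq_abs]
  rw [abs_mul, abs_of_nonneg (add_nonneg (sq_nonneg (f x)) (sq_nonneg _))]
  nlinarith [sq_nonneg (|f x| - |g x|), sq_abs (f x), sq_abs (g x)]

/-- The weighted version of `MeasureTheory.Integrable.mul_of_sq`. -/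
lemma _root_.MeasureTheory.Integrable.mul_of_weighted_sq {α : Type*} [MeasurableSpace α]
    {μ : Measure α} {f g v w : α → ℝ} (mf : AEStronglyMeasurable f μ)
    (mg : AEStronglyMeasurable g μ) (hw : ∀ᵐ x ∂μ, 1 ≤ v x * w x ∧ 0 ≤ v x)
    (hf : Integrable (fun x => v x * f x ^ 2) μ)
    (hg : Integrable (fun x => w x * g x ^ 2) μ) :
    Integrable (fun x => f x * g x) μ := by
  refine (hf.add hg).mono (mf.mul mg) ?_
  filter_upwards [hw] with x ⟨h1, h2⟩
  have h3 : 0 < v x := h2.lt_of_ne (by rintro h; rw [← h] at h1; norm_num at h1)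
  have h4 : 0 ≤ w x := by
    by_contra h; nlinarith
  simp only [Pi.add_apply, norm_eq_abs]
  rw [abs_mul, abs_of_nonneg (by positivity : 0 ≤ v x * f x ^ 2 + w x * g x ^ 2)]
  have h5 : 0 ≤ |f x| * |g x| := by positivity
  have h6 : (|f x| * |g x|) ^ 2 ≤ (v x * f x ^ 2) * (w x * g x ^ 2) := by
    have : (v x * f x ^ 2) * (w x * g x ^ 2) = (v x * w x) * (|f x| * |g x|) ^ 2 := by
      rw [mul_pow, sq_abs, sq_abs]; ring
    rw [this]; nlinarith [sq_nonneg (|f x| * |g x|)]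
  have h7 : 0 ≤ v x * f x ^ 2 := by positivity
  have h8 : 0 ≤ w x * g x ^ 2 := by positivity
  nlinarith [sq_nonneg (v x * f x ^ 2 - w x * g x ^ 2)]

lemma aestronglyMeasurable_of_loc {p : ℝ → ℝ} (h : ∀ b, IntegrableOn p (Ioc 0 b)) :
    AEStronglyMeasurable p (volume.restrict (Ioi 0)) := by
  have : Ioi (0:ℝ) = ⋃ n : ℕ, Ioc (0:ℝ) n := by
    ext x
    simp only [mem_Ioi, mem_iUnion, mem_Ioc]
    exact ⟨fun hx => (exists_nat_ge x).imp fun n hn => ⟨hx, hn⟩, fun ⟨_, h, _⟩ => h⟩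
  rw [this, aestronglyMeasurable_iUnion_iff]
  exact fun n => (h n).aestronglyMeasurable

namespace IsPrim

variable {a p : ℝ → ℝ}

lemma meas (h : IsPrim a p) : AEStronglyMeasurable a (volume.restrict (Ioi 0)) :=
  aestronglyMeasurable_of_loc h.loc

lemma meas_deriv (h : IsPrim a p) : AEStronglyMeasurable p (volume.restrict (Ioi 0)) :=
  aestronglyMeasurable_of_loc h.1

/-- Both functions are continuous up to `0`, so almost everywhere equality also determines the
boundary value. -/
lemma eq_of_ae_eq (h : IsPrim a p) {f : ℝ → ℝ} (hf : Continuous f)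
    (he : a =ᵐ[volume.restrict (Ioi 0)] f) {t : ℝ} (ht : 0 ≤ t) : a t = f t := by
  have he' : a =ᵐ[volume.restrict (Ici 0)] f := by
    rwa [Measure.restrict_congr_set Ioi_ae_eq_Ici.symm]
  exact Measure.eqOn_of_ae_eq he' h.continuousOn hf.continuousOn (by simp) ht

end IsPrim

lemma integrableOn_bdd_mul {f g : ℝ → ℝ} (hg : ContinuousOn g (Ioi 0)) {C : ℝ}
    (hb : ∀ t, 0 < t → |g t| ≤ C) (hf : IntegrableOn f (Ioi 0)) :
    IntegrableOn (fun t => g t * f t) (Ioi 0) := by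
  refine Integrable.bdd_mul (c := C) hf (hg.aestronglyMeasurable measurableSet_Ioi) ?_
  filter_upwards [ae_restrict_mem measurableSet_Ioi] with t ht using hb t ht

lemma isPrim_tnh : IsPrim tnh (fun t => sch t ^ 2) := .of_hasDerivAt hasDerivAt_tnh (by fun_prop)

/-- Completing the square with the solution `sch` of `-h'' + h - 2 sch² h = 0`. -/
lemma catenoid_mode_identity {a p : ℝ → ℝ} (h : IsPrim a p)
    (hp : IntegrableOn (fun t => p t ^ 2) (Ioi 0)) (ha : IntegrableOn (fun t => a t ^ 2) (Ioi 0))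
    (m : ℝ) :
    ∫ t in Ioi 0, (p t ^ 2 + (m - 2 * sch t ^ 2) * a t ^ 2) =
      (∫ t in Ioi 0, (p t + tnh t * a t) ^ 2) + (m - 1) * (∫ t in Ioi 0, a t ^ 2)
        - 1 / 2 * a 0 ^ 2 := by
  have hap : IntegrableOn (fun t => a t * p t) (Ioi 0) := .mul_of_sq h.meas h.meas_deriv ha hp
  have i1 : IntegrableOn (fun t => sch t ^ 2 * a t ^ 2) (Ioi 0) :=
    integrableOn_bdd_mul (by fun_prop) (fun t _ => by
      rw [abs_of_nonneg (sq_nonneg _)]; exact pow_le_one₀ (sch_pos t).le (sch_le_one t)) ha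
  have i2 : IntegrableOn (fun t => tnh t * (a t * p t)) (Ioi 0) :=
    integrableOn_bdd_mul (by fun_prop) (fun t _ => abs_tnh_le_one t) hap
  have i3 : IntegrableOn (fun t => tnh t * a t ^ 2) (Ioi 0) :=
    integrableOn_bdd_mul (by fun_prop) (fun t _ => abs_tnh_le_one t) ha
  have hF := isPrim_tnh.mul (h.mul h)
  have i4 : IntegrableOn (fun t => sch t ^ 2 * (a t * a t) + tnh t * (p t * a t + a t * p t))
      (Ioi 0) := (i1.add (i2.const_mul 2)).congr (ae_of_all _ fun t => by simp; ring)
  have i5 : IntegrableOn (fun t => tnh t * (a t * a t) / (t + 1)) (Ioi 0) := by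
    have h1 : IntegrableOn (fun t => (t + 1)⁻¹ * (tnh t * a t ^ 2)) (Ioi 0) := by
      refine integrableOn_bdd_mul (C := 1) ?_ (fun t ht => ?_) i3
      · exact (continuousOn_id.add continuousOn_const).inv₀ fun t ht => by
          have : (0:ℝ) < t := ht
          exact (by positivity : t + 1 ≠ 0)
      · rw [abs_of_pos (by positivity)]
        exact inv_le_one_of_one_le₀ (by linarith)
    exact h1.congr (ae_of_all _ fun t => by ring)
  -- The function `tnh · a²` tends to zero, so its derivative integrates to `-tnh(0) a(0)² = a(0)² /
  -- 2`.
  have key := hF.integral_Ioi_of_tendsto i4 (hF.tendsto_zero i4 one_pos i5)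
  have i6 : IntegrableOn (fun t => p t ^ 2 + (m - 2 * sch t ^ 2) * a t ^ 2) (Ioi 0) :=
    (hp.add ((ha.const_mul m).sub (i1.const_mul 2))).congr (ae_of_all _ fun t => by simp; ring)
  have i7 : IntegrableOn (fun t => (m - 1) * a t ^ 2) (Ioi 0) := ha.const_mul _
  -- Here `-tnh` is the logarithmic derivative of `sch`. Expanding and using `tnh² = 1 - sch²`, the
  -- cross term combines with `sch² a²` into the derivative of `tnh · a²`.
  have e : (fun t => (p t + tnh t * a t) ^ 2) = fun t => (p t ^ 2 + (m - 2 * sch t ^ 2) * a t ^ 2)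
      + (sch t ^ 2 * (a t * a t) + tnh t * (p t * a t + a t * p t)) - (m - 1) * a t ^ 2 := by
    funext t; linear_combination a t ^ 2 * tnh_sq t
  rw [e, integral_sub (by exact i6.add i4) i7, integral_add i6 i4, key, integral_const_mul,
    tnh_zero]
  ring

/-- Completing the square with the solution `1 / rad` of `-(rad h')' + h / rad = 0`. -/
lemma plane_mode_identity {a p : ℝ → ℝ} (h : IsPrim a p)
    (hp : IntegrableOn (fun t => rad t * p t ^ 2) (Ioi 0))
    (ha : IntegrableOn (fun t => (rad t)⁻¹ * a t ^ 2) (Ioi 0)) (m : ℝ) :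
    ∫ t in Ioi 0, (rad t * p t ^ 2 + m * (rad t)⁻¹ * a t ^ 2) =
      (∫ t in Ioi 0, rad t * (p t + (rad t)⁻¹ * a t) ^ 2)
        + (m - 1) * (∫ t in Ioi 0, (rad t)⁻¹ * a t ^ 2) + a 0 ^ 2 := by
  have hap : IntegrableOn (fun t => a t * p t) (Ioi 0) := by
    refine .mul_of_weighted_sq h.meas h.meas_deriv ?_ ha hp
    filter_upwards [ae_restrict_mem measurableSet_Ioi] with t ht
    have := rad_pos (le_of_lt ht)
    exact ⟨by field_simp; rfl, by positivity⟩
  have hF := h.mul h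
  have i4 : IntegrableOn (fun t => p t * a t + a t * p t) (Ioi 0) :=
    (hap.const_mul 2).congr (ae_of_all _ fun t => by simp; ring)
  have i5 : IntegrableOn (fun t => a t * a t / (t + 2 / √3)) (Ioi 0) :=
    ha.congr (ae_of_all _ fun t => by simp only [rad]; ring)
  -- The cross term of the square is exactly `(a²)'`, since the weight `rad` cancels `1 / rad`; `a²`
  -- decays because `a² / rad` is integrable.
  have key := hF.integral_Ioi_of_tendsto i4 (hF.tendsto_zero i4 (by positivity) i5)
  have i6 : IntegrableOn (fun t => rad t * p t ^ 2 + m * (rad t)⁻¹ * a t ^ 2) (Ioi 0) :=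
    (hp.add (ha.const_mul m)).congr (ae_of_all _ fun t => by simp; ring)
  have i7 : IntegrableOn (fun t => (m - 1) * ((rad t)⁻¹ * a t ^ 2)) (Ioi 0) := ha.const_mul _
  have e : ∫ t in Ioi 0, rad t * (p t + (rad t)⁻¹ * a t) ^ 2 = ∫ t in Ioi 0,
      ((rad t * p t ^ 2 + m * (rad t)⁻¹ * a t ^ 2)
      + (p t * a t + a t * p t) - (m - 1) * ((rad t)⁻¹ * a t ^ 2)) := by
    refine setIntegral_congr_fun measurableSet_Ioi fun t ht => ?_
    have := rad_pos (le_of_lt ht)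
    field_simp
    ring
  rw [e, integral_sub (by exact i6.add i4) i7, integral_add i6 i4, key, integral_const_mul]
  ring

/-! ### The radial mode on the catenoidal faces -/

lemma tnh_pos {t : ℝ} (h : log √3 < t) : 0 < tnh t := by
  rw [tnh, Real.tanh_eq_sinh_div_cosh]
  exact div_pos (Real.sinh_pos_iff.2 (by linarith)) (Real.cosh_pos _)

lemma tnh_neg {t : ℝ} (h : t < log √3) : tnh t < 0 := by
  rw [tnh, Real.tanh_eq_sinh_div_cosh]
  exact div_neg_of_neg_of_pos (Real.sinh_neg_iff.2 (by linarith)) (Real.cosh_pos _)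

/-- The logarithmic derivative of `tnh`. -/
def logDerivTnh (t : ℝ) : ℝ := sch t ^ 2 / tnh t

/-- The Riccati equation `q' = -V - q²` of the Jacobi equation `h'' + V h = 0` with `V = 2 sch²`,
valid away from the zero of `tnh`. -/
lemma hasDerivAt_logDerivTnh {t : ℝ} (h : tnh t ≠ 0) :
    HasDerivAt logDerivTnh (-2 * sch t ^ 2 - logDerivTnh t ^ 2) t := by
  convert! ((hasDerivAt_sch t).pow 2).div (hasDerivAt_tnh t) h using 1
  simp only [logDerivTnh, Pi.pow_apply]
  field_simp
  ring

/-- With `s = t - log √3`, away from `s = 0` the logarithmic derivative is `1 / (sinh s cosh s)`,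
and `|s| ≤ |sinh s|`. The singularity at the neck is thus no worse than `1 / |s|`, which a function
with square integrable derivative vanishing there can absorb. -/
lemma abs_logDerivTnh_mul_le (t : ℝ) : |logDerivTnh t| * |t - log √3| ≤ 1 := by
  have h0 := Real.cosh_pos (t - log √3)
  have h1 := Real.one_le_cosh (t - log √3)
  have h2 : |t - log √3| ≤ |Real.sinh (t - log √3)| := by
    rw [Real.abs_sinh]; exact Real.self_le_sinh_iff.2 (abs_nonneg _)
  have h3 : logDerivTnh t = 1 / (Real.sinh (t - log √3) * Real.cosh (t - log √3)) := by
    rw [logDerivTnh, tnh, sch, Real.tanh_eq_sinh_div_cosh]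
    field_simp
  rw [h3, abs_div, abs_mul, abs_one, abs_of_pos h0]
  rcases eq_or_ne (t - log √3) 0 with h | h
  · simp [h]
  have h4 : 0 < |Real.sinh (t - log √3)| := (abs_pos.2 h).trans_le h2
  rw [div_mul_eq_mul_div, one_mul, div_le_one (by positivity)]
  nlinarith

/-- The weight is differentiable only on the segment, since it will be `logDerivTnh` away from its
pole. Its derivative is extended continuously to the whole line so that the product rule for
primitives applies. -/
lemma IsPrim.integral_weighted_sq {a p κ κ' : ℝ → ℝ} (h : IsPrim a p) {x y : ℝ} (hx : 0 ≤ x)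
    (hxy : x ≤ y) (hκ : ∀ t ∈ Icc x y, HasDerivAt κ (κ' t) t) (hc : ContinuousOn κ' (Icc x y)) :
    ∫ t in x..y, (κ' t * (a t * a t) + κ t * (p t * a t + a t * p t)) =
      κ y * (a y * a y) - κ x * (a x * a x) := by
  set f' : ℝ → ℝ := IccExtend hxy ((Icc x y).domRestrict κ')
  have hf' : Continuous f' := hc.domRestrict.Icc_extend'
  have e' : ∀ t ∈ Icc x y, f' t = κ' t := fun t ht => by
    simp [f', IccExtend_of_mem hxy _ ht]
  set f : ℝ → ℝ := fun t => κ x + ∫ s in x..t, f' s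
  have e : ∀ t ∈ Icc x y, f t = κ t := fun t ht => by
    have : ∫ s in x..t, f' s = κ t - κ x := by
      have h1 : ∀ s ∈ uIcc x t, HasDerivAt κ (f' s) s := fun s hs => by
        rw [uIcc_of_le ht.1] at hs
        rw [e' s ⟨hs.1, hs.2.trans ht.2⟩]; exact hκ s ⟨hs.1, hs.2.trans ht.2⟩
      exact intervalIntegral.integral_eq_sub_of_hasDerivAt h1 (hf'.intervalIntegrable _ _)
    simp [f, this]
  have hf : IsPrim f f' := .of_hasDerivAt (fun t => by
    have := (intervalIntegral.integral_hasDerivAt_right (hf'.intervalIntegrable x t)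
      (hf'.stronglyMeasurableAtFilter _ _) hf'.continuousAt).const_add (κ x)
    exact this) hf'
  have key := (hf.mul (h.mul h)).sub_eq hx (hx.trans hxy)
  rw [e x ⟨le_rfl, hxy⟩, e y ⟨hxy, le_rfl⟩] at key
  rw [← key]
  refine intervalIntegral.integral_congr fun t ht => ?_
  rw [uIcc_of_le hxy] at ht
  simp only [e t ht, e' t ht]

/-- The variance of `p` about its mean is nonnegative. -/
lemma sq_integral_le {p : ℝ → ℝ} {x y : ℝ} (hxy : x ≤ y) (hp : IntervalIntegrable p volume x y)
    (hp2 : IntervalIntegrable (fun t => p t ^ 2) volume x y) :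
    (∫ t in x..y, p t) ^ 2 ≤ (y - x) * ∫ t in x..y, p t ^ 2 := by
  rcases hxy.eq_or_lt with rfl | hlt
  · simp
  set I := ∫ t in x..y, p t
  set c := I / (y - x)
  have h1 : 0 ≤ ∫ t in x..y, (p t - c) ^ 2 :=
    intervalIntegral.integral_nonneg hxy fun t _ => sq_nonneg _
  have h2 : ∫ t in x..y, (p t - c) ^ 2 = (∫ t in x..y, p t ^ 2) - 2 * c * I + c ^ 2 * (y - x) := by
    have e : (fun t => (p t - c) ^ 2) = fun t => p t ^ 2 - 2 * c * p t + c ^ 2 := by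
      funext t; ring
    rw [e, intervalIntegral.integral_add (by exact hp2.sub (hp.const_mul _)) (by simp),
      intervalIntegral.integral_sub hp2 (hp.const_mul _), intervalIntegral.integral_const_mul,
      intervalIntegral.integral_const, smul_eq_mul]
    ring
  have h3 : 0 < y - x := by linarith
  have h4 : I = c * (y - x) := by simp only [c]; field_simp
  rw [h2] at h1
  rw [h4] at h1 ⊢
  nlinarith

/-- Stability of the radial mode away from the zero of `tnh`. -/
lemma catenoid_radial_segment {a p : ℝ → ℝ} (h : IsPrim a p)
    (hp : IntegrableOn (fun t => p t ^ 2) (Ioi 0)) {x y : ℝ} (hx : 0 ≤ x) (hxy : x ≤ y)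
    (hn : ∀ t ∈ Icc x y, tnh t ≠ 0) :
    logDerivTnh y * a y ^ 2 - logDerivTnh x * a x ^ 2 ≤
      ∫ t in x..y, (p t ^ 2 - 2 * sch t ^ 2 * a t ^ 2) := by
  have hcont : ContinuousOn logDerivTnh (Icc x y) := fun t ht =>
    (hasDerivAt_logDerivTnh (hn t ht)).continuousAt.continuousWithinAt
  have key := h.integral_weighted_sq hx hxy (fun t ht => hasDerivAt_logDerivTnh (hn t ht))
    (by fun_prop)
  have hy := hx.trans hxy
  have hac : ContinuousOn a (Icc x y) := h.continuousOn.mono fun t ht => hx.trans ht.1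
  have ip : IntervalIntegrable p volume x y := intervalIntegrable_of_loc h.1 hx hy
  have ip2 : IntervalIntegrable (fun t => p t ^ 2) volume x y :=
    intervalIntegrable_of_loc (fun b => hp.mono_set Ioc_subset_Ioi_self) hx hy
  rw [← uIcc_of_le hxy] at hac hcont
  have i1 : IntervalIntegrable (fun t => p t ^ 2 - 2 * sch t ^ 2 * a t ^ 2) volume x y := by
    refine ip2.sub (ContinuousOn.intervalIntegrable ?_)
    fun_prop
  have i2 : IntervalIntegrable (fun t => (-2 * sch t ^ 2 - logDerivTnh t ^ 2) * (a t * a t) +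
      logDerivTnh t * (p t * a t + a t * p t)) volume x y := by
    refine (ContinuousOn.intervalIntegrable (by fun_prop)).add ?_
    exact ((ip.mul_continuousOn hac).add (ip.continuousOn_mul hac)).continuousOn_mul hcont
  -- By the Riccati equation, `(p - q a)²` differs from the integrand of the form by the exact
  -- derivative of `q a²`.
  have e : ∫ t in x..y, (p t - logDerivTnh t * a t) ^ 2 =
      (∫ t in x..y, (p t ^ 2 - 2 * sch t ^ 2 * a t ^ 2)) -
      ∫ t in x..y, ((-2 * sch t ^ 2 - logDerivTnh t ^ 2) * (a t * a t) +
        logDerivTnh t * (p t * a t + a t * p t)) := by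
    rw [← intervalIntegral.integral_sub i1 i2]
    congr 1; funext t; ring
  have h0 : 0 ≤ ∫ t in x..y, (p t - logDerivTnh t * a t) ^ 2 :=
    intervalIntegral.integral_nonneg hxy fun t _ => sq_nonneg _
  rw [e, key] at h0
  linarith [sq (a x), sq (a y), mul_comm (logDerivTnh x) (a x ^ 2),
    show a x * a x = a x ^ 2 by ring,
    show logDerivTnh x * (a x * a x) = logDerivTnh x * a x ^ 2 by ring,
    show logDerivTnh y * (a y * a y) = logDerivTnh y * a y ^ 2 by ring]

lemma logDerivTnh_zero : logDerivTnh 0 = -3 / 2 := by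
  rw [logDerivTnh, sch_zero_sq, tnh_zero]; norm_num

lemma log_sqrt_three_pos : 0 < log √3 :=
  Real.log_pos (by rw [Real.lt_sqrt (by norm_num)]; norm_num)

/-- The zero of `tnh` splits the half line into two pieces, on each of which the square can be
completed with `q = tnh' / tnh`. The boundary terms at the neck disappear in the limit, because
`a(t)² ≤ |t - T| ∫ p²` between `t` and `T` while `|q| ≤ 1 / |t - T|`. The constant is `3 / 2 =
-q(0)`. -/
lemma catenoid_radial_le {a p : ℝ → ℝ} (h : IsPrim a p)
    (hp : IntegrableOn (fun t => p t ^ 2) (Ioi 0))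
    (ha : IntegrableOn (fun t => sch t ^ 2 * a t ^ 2) (Ioi 0)) (h0 : a (log √3) = 0) :
    3 / 2 * a 0 ^ 2 ≤ ∫ t in Ioi 0, (p t ^ 2 - 2 * sch t ^ 2 * a t ^ 2) := by
  set T := log √3 with hT
  have T0 : 0 < T := log_sqrt_three_pos
  have hp2 : ∀ b, IntegrableOn (fun t => p t ^ 2) (Ioc 0 b) := fun b =>
    hp.mono_set Ioc_subset_Ioi_self
  have iG : IntegrableOn (fun t => p t ^ 2 - 2 * sch t ^ 2 * a t ^ 2) (Ioi 0) :=
    (hp.sub (ha.const_mul 2)).congr (ae_of_all _ fun t => by simp; ring)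
  set G : ℝ → ℝ := fun t => p t ^ 2 - 2 * sch t ^ 2 * a t ^ 2
  have iG' : ∀ b, IntegrableOn G (Ioc 0 b) := fun b => iG.mono_set Ioc_subset_Ioi_self
  have hP : IsPrim (fun t => ∫ s in (0)..t, p s ^ 2) (fun t => p t ^ 2) :=
    ⟨hp2, fun t _ => by simp⟩
  have hI : IsPrim (fun t => ∫ s in (0)..t, G s) G := ⟨iG', fun t _ => by simp⟩
  have cs : ∀ x y, 0 ≤ x → x ≤ y → (a y - a x) ^ 2 ≤ (y - x) * ∫ t in x..y, p t ^ 2 := by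
    intro x y hx hxy
    rw [← h.sub_eq hx (hx.trans hxy)]
    exact sq_integral_le hxy (intervalIntegrable_of_loc h.1 hx (hx.trans hxy))
      (intervalIntegrable_of_loc hp2 hx (hx.trans hxy))
  -- The boundary term `q a²` at `t` is at most the energy `E` of `a` between `t` and the neck,
  -- which tends to zero.
  have bound : ∀ t, ∀ E, 0 ≤ E → a t ^ 2 ≤ |t - T| * E → |logDerivTnh t * a t ^ 2| ≤ E := by
    intro t E hE hb
    rw [abs_mul, abs_of_nonneg (sq_nonneg (a t))]
    have := abs_logDerivTnh_mul_le t
    rw [← hT] at this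
    have h3 := abs_nonneg (logDerivTnh t)
    nlinarith
  have left : ∀ y ∈ Ico 0 T, 3 / 2 * a 0 ^ 2 - ((∫ s in (0)..T, p s ^ 2) - ∫ s in (0)..y, p s ^ 2)
      ≤ ∫ s in (0)..y, G s := by
    intro y hy
    have h1 := catenoid_radial_segment h hp le_rfl hy.1
      fun t ht => (tnh_neg (ht.2.trans_lt hy.2)).ne
    have h2 := cs y T hy.1 hy.2.le
    rw [hP.sub_eq hy.1 T0.le] at h2
    rw [h0, zero_sub, neg_sq] at h2
    have h4 : (0:ℝ) ≤ (∫ s in (0)..T, p s ^ 2) - ∫ s in (0)..y, p s ^ 2 := by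
      rw [← hP.sub_eq hy.1 T0.le]
      exact intervalIntegral.integral_nonneg hy.2.le fun _ _ => sq_nonneg _
    have h3 := bound y _ h4 (by rwa [abs_sub_comm, abs_of_pos (by linarith [hy.2])])
    rw [logDerivTnh_zero] at h1
    have := (abs_le.1 h3).1
    linarith
  have left' : 3 / 2 * a 0 ^ 2 ≤ ∫ s in (0)..T, G s := by
    have c1 : Tendsto (fun y => ∫ s in (0)..y, p s ^ 2) (𝓝[<] T) (𝓝 (∫ s in (0)..T, p s ^ 2)) :=
      ((hP.continuousOn.continuousAt (Ici_mem_nhds T0)).tendsto).mono_left nhdsWithin_le_nhds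
    have c2 : Tendsto (fun y => ∫ s in (0)..y, G s) (𝓝[<] T) (𝓝 (∫ s in (0)..T, G s)) :=
      ((hI.continuousOn.continuousAt (Ici_mem_nhds T0)).tendsto).mono_left nhdsWithin_le_nhds
    have c3 := (tendsto_const_nhds (x := 3 / 2 * a 0 ^ 2)).sub
      ((tendsto_const_nhds (x := ∫ s in (0)..T, p s ^ 2)).sub c1)
    rw [sub_self, sub_zero] at c3
    refine le_of_tendsto_of_tendsto c3 c2 ?_
    filter_upwards [Ioo_mem_nhdsLT T0] with y hy using left y ⟨hy.1.le, hy.2⟩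
  have right : ∀ x y, T < x → x ≤ y → -((∫ s in (0)..x, p s ^ 2) - ∫ s in (0)..T, p s ^ 2)
      ≤ (∫ s in (0)..y, G s) - ∫ s in (0)..x, G s := by
    intro x y hx hxy
    have hx0 := T0.trans hx
    have h1 := catenoid_radial_segment h hp hx0.le hxy fun t ht => (tnh_pos (hx.trans_le ht.1)).ne'
    have h2 := cs T x T0.le hx.le
    rw [hP.sub_eq T0.le hx0.le] at h2
    rw [h0, sub_zero] at h2
    have h4 : (0:ℝ) ≤ (∫ s in (0)..x, p s ^ 2) - ∫ s in (0)..T, p s ^ 2 := by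
      rw [← hP.sub_eq T0.le hx0.le]
      exact intervalIntegral.integral_nonneg hx.le fun _ _ => sq_nonneg _
    have h3 := bound x _ h4 (by rwa [abs_of_pos (by linarith)])
    rw [hI.sub_eq hx0.le (hx0.le.trans hxy)] at h1
    have h5 := (abs_le.1 h3).2
    -- To the right of the neck `q > 0`, so the boundary term at the far end has the good sign and
    -- no decay is needed.
    have h6 : 0 ≤ logDerivTnh y * a y ^ 2 :=
      mul_nonneg (div_nonneg (sq_nonneg _) (tnh_pos (hx.trans_le hxy)).le) (sq_nonneg _)
    linarith
  have right' : ∀ y, T < y → 0 ≤ (∫ s in (0)..y, G s) - ∫ s in (0)..T, G s := by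
    intro y hy
    have c1 : Tendsto (fun y => ∫ s in (0)..y, p s ^ 2) (𝓝[>] T) (𝓝 (∫ s in (0)..T, p s ^ 2)) :=
      ((hP.continuousOn.continuousAt (Ici_mem_nhds T0)).tendsto).mono_left nhdsWithin_le_nhds
    have c2 : Tendsto (fun y => ∫ s in (0)..y, G s) (𝓝[>] T) (𝓝 (∫ s in (0)..T, G s)) :=
      ((hI.continuousOn.continuousAt (Ici_mem_nhds T0)).tendsto).mono_left nhdsWithin_le_nhds
    have c3 := (c1.sub (tendsto_const_nhds (x := ∫ s in (0)..T, p s ^ 2))).neg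
    rw [sub_self, neg_zero] at c3
    refine le_of_tendsto_of_tendsto c3 ((tendsto_const_nhds (x := ∫ s in (0)..y, G s)).sub c2) ?_
    filter_upwards [Ioc_mem_nhdsGT hy] with x hx using right x y hx.1 hx.2
  refine ge_of_tendsto (intervalIntegral_tendsto_integral_Ioi 0 iG tendsto_id) ?_
  filter_upwards [eventually_gt_atTop T] with y hy
  have := right' y hy
  simp only [id]
  linarith

lemma tendsto_sch : Tendsto sch atTop (𝓝 0) := by
  refine tendsto_inv_atTop_zero.comp (tendsto_atTop_mono' _ ?_
    (tendsto_atTop_add_const_right atTop (-log √3) tendsto_id))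
  filter_upwards [eventually_ge_atTop (log √3)] with t ht
  have h1 := Real.self_le_sinh_iff.2 (sub_nonneg.2 ht)
  have h2 := Real.sinh_lt_cosh (t - log √3)
  simp only [id]
  linarith

lemma tendsto_tnh : Tendsto tnh atTop (𝓝 1) := by
  have h : Tendsto (fun t => √(1 - sch t ^ 2)) atTop (𝓝 1) := by
    have := ((tendsto_sch.pow 2).const_sub 1).sqrt
    simpa using this
  refine h.congr' ?_
  filter_upwards [eventually_gt_atTop (log √3)] with t ht
  rw [← tnh_sq, Real.sqrt_sq (tnh_pos ht).le]

lemma integrableOn_sch_sq : IntegrableOn (fun t => sch t ^ 2) (Ioi 0) :=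
  integrableOn_Ioi_deriv_of_nonneg continuous_tnh.continuousWithinAt
    (fun t _ => hasDerivAt_tnh t) (fun _ _ => sq_nonneg _) tendsto_tnh

lemma abs_sch_sq_le_one (t : ℝ) : |sch t ^ 2| ≤ 1 := by
  rw [abs_of_nonneg (sq_nonneg _)]; exact pow_le_one₀ (sch_pos t).le (sch_le_one t)

/-- The quadratic form of one Fourier mode with frequency `√m` on a rotationally symmetric face. -/
def modeForm (w V : ℝ → ℝ) (β m : ℝ) (a p : ℝ → ℝ) : ℝ :=
  (∫ t in Ioi 0, (w t * p t ^ 2 + (m * (w t)⁻¹ - V t) * a t ^ 2)) - β * a 0 ^ 2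

lemma IsPrim.ae_eq_zero {a p : ℝ → ℝ} (h : IsPrim a p) (h0 : ∀ t, 0 ≤ t → a t = 0) :
    p =ᵐ[volume.restrict (Ioi 0)] 0 := by
  refine ae_eq_zero_of_cutoff h.1 fun g hg hs => ?_
  obtain ⟨b, hb⟩ := hs.isCompact.bddAbove
  have hc : IsCutoff g := ⟨hg, b + 1, fun t ht => by
    by_contra hne
    have := hb (subset_tsupport _ hne)
    linarith⟩
  obtain ⟨b', hb'⟩ := hc.2
  have i1 := hc.integrableOn h.1
  have i2 := hc.deriv.integrableOn h.loc
  have key := (h.mul hc.isPrim).integral_Ioi_of_vanish (b := b') (fun t ht => by simp [hb' t ht])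
    (i1.add i2)
  rw [integral_add i1 i2, h0 0 le_rfl, setIntegral_congr_fun (g := fun _ => (0:ℝ)) measurableSet_Ioi
    (fun t ht => by simp [h0 t (le_of_lt ht)] : EqOn (fun t => a t * deriv g t) _ _)] at key
  simpa using key

/-- Nonnegativity of all modes of frequency at least one, with the equality case. -/
structure ModeStable (w V : ℝ → ℝ) (β : ℝ) : Prop where
  nonneg : ∀ {m : ℝ} {a p : ℝ → ℝ}, 1 ≤ m → IsPrim a p →
    IntegrableOn (fun t => w t * p t ^ 2) (Ioi 0) →
    IntegrableOn (fun t => (w t)⁻¹ * a t ^ 2) (Ioi 0) → 0 ≤ modeForm w V β m a p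
  eq_zero : ∀ {m : ℝ} {a p : ℝ → ℝ}, 1 ≤ m → IsPrim a p →
    IntegrableOn (fun t => w t * p t ^ 2) (Ioi 0) →
    IntegrableOn (fun t => (w t)⁻¹ * a t ^ 2) (Ioi 0) → modeForm w V β m a p = 0 →
    (a 0 = 0 ∨ 1 < m) → ∀ t, 0 ≤ t → a t = 0

/-- The coefficient `β = -1/2` cancels the boundary term of `catenoid_mode_identity`, leaving `∫ (p
+ tnh a)² + (m - 1) ∫ a²`. For `m > 1` equality kills `a` directly; otherwise it makes `a` a
multiple of `sch`, which the boundary condition kills. -/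
lemma modeStable_catenoid : ModeStable (fun _ => 1) (fun t => 2 * sch t ^ 2) (-1 / 2) := by
  have id1 : ∀ {m : ℝ} {a p : ℝ → ℝ}, IsPrim a p →
      IntegrableOn (fun t => 1 * p t ^ 2) (Ioi 0) →
      IntegrableOn (fun t => (1:ℝ)⁻¹ * a t ^ 2) (Ioi 0) →
      modeForm (fun _ => 1) (fun t => 2 * sch t ^ 2) (-1 / 2) m a p =
      (∫ t in Ioi 0, (p t + tnh t * a t) ^ 2) + (m - 1) * (∫ t in Ioi 0, a t ^ 2) := by
    intro m a p h h1 h2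
    simp only [one_mul, inv_one] at h1 h2
    simp only [modeForm, one_mul, inv_one, mul_one]
    rw [catenoid_mode_identity h h1 h2]; ring
  constructor
  · intro m a p hm h h1 h2
    rw [id1 h h1 h2]
    have n1 : 0 ≤ ∫ t in Ioi 0, (p t + tnh t * a t) ^ 2 := integral_nonneg fun t => sq_nonneg _
    have n2 : 0 ≤ ∫ t in Ioi 0, a t ^ 2 := integral_nonneg fun t => sq_nonneg _
    have : 0 ≤ m - 1 := by linarith
    positivity
  · intro m a p hm h h1 h2 h3 h4
    rw [id1 h h1 h2] at h3
    simp only [one_mul, inv_one] at h1 h2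
    have n1 : 0 ≤ ∫ t in Ioi 0, (p t + tnh t * a t) ^ 2 := integral_nonneg fun t => sq_nonneg _
    have n2 : 0 ≤ ∫ t in Ioi 0, a t ^ 2 := integral_nonneg fun t => sq_nonneg _
    rcases h4 with h4 | h4
    · have h5 : ∫ t in Ioi 0, (p t + tnh t * a t) ^ 2 = 0 := by nlinarith
      have i1 : IntegrableOn (fun t => tnh t ^ 2 * a t ^ 2) (Ioi 0) :=
        integrableOn_bdd_mul (C := 1) (by fun_prop) (fun t _ => by
          rw [abs_pow]; exact pow_le_one₀ (abs_nonneg _) (abs_tnh_le_one t)) h2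
      have i2 : IntegrableOn (fun t => tnh t * (a t * p t)) (Ioi 0) :=
        integrableOn_bdd_mul (C := 1) (by fun_prop) (fun t _ => abs_tnh_le_one t)
          (.mul_of_sq h.meas h.meas_deriv h2 h1)
      have i3 : IntegrableOn (fun t => (p t + tnh t * a t) ^ 2) (Ioi 0) :=
        ((h1.add i1).add (i2.const_mul 2)).congr (ae_of_all _ fun t => by simp; ring)
      rw [integral_eq_zero_iff_of_nonneg (fun t => sq_nonneg _) i3] at h5
      -- From `p = -tnh a` the product `a / sch` has derivative zero, so it keeps its boundary
      -- value.
      have hs : IsPrim (fun t => (sch t)⁻¹) (fun t => tnh t * (sch t)⁻¹) := by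
        refine .of_hasDerivAt (fun t => ?_) (contDiff_tnh.continuous.mul
          (continuous_sch.inv₀ fun t => (sch_pos t).ne'))
        convert! (hasDerivAt_sch t).inv (sch_pos t).ne' using 1
        have := (sch_pos t).ne'
        field_simp
      intro t ht
      have := (hs.mul h).eq_const (by
        filter_upwards [h5] with t ht
        have h6 : p t + tnh t * a t = 0 := by simpa using ht
        simp only [Pi.zero_apply]
        linear_combination (sch t)⁻¹ * h6) ht
      simpa [h4, (sch_pos t).ne'] using this
    · have h5 : ∫ t in Ioi 0, a t ^ 2 = 0 := by nlinarith
      rw [integral_eq_zero_iff_of_nonneg (fun t => sq_nonneg _) h2] at h5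
      intro t ht
      refine h.eq_of_ae_eq (f := fun _ => 0) continuous_const ?_ ht
      filter_upwards [h5] with t ht using by simpa using ht

/-- As on the catenoid, `β = 1` cancels the boundary term of `plane_mode_identity`; the extremal
solution is now `1 / rad`. -/
lemma modeStable_plane : ModeStable rad (fun _ => 0) 1 := by
  have id1 : ∀ {m : ℝ} {a p : ℝ → ℝ}, IsPrim a p →
      IntegrableOn (fun t => rad t * p t ^ 2) (Ioi 0) →
      IntegrableOn (fun t => (rad t)⁻¹ * a t ^ 2) (Ioi 0) →
      modeForm rad (fun _ => 0) 1 m a p =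
      (∫ t in Ioi 0, rad t * (p t + (rad t)⁻¹ * a t) ^ 2)
        + (m - 1) * (∫ t in Ioi 0, (rad t)⁻¹ * a t ^ 2) := by
    intro m a p h h1 h2
    simp only [modeForm, sub_zero, one_mul]
    rw [plane_mode_identity h h1 h2]; ring
  have n1 : ∀ a p : ℝ → ℝ, 0 ≤ ∫ t in Ioi 0, rad t * (p t + (rad t)⁻¹ * a t) ^ 2 := fun a p =>
    setIntegral_nonneg measurableSet_Ioi fun t ht => by have := rad_pos (le_of_lt ht); positivity
  have n2 : ∀ a : ℝ → ℝ, 0 ≤ ∫ t in Ioi 0, (rad t)⁻¹ * a t ^ 2 := fun a =>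
    setIntegral_nonneg measurableSet_Ioi fun t ht => by have := rad_pos (le_of_lt ht); positivity
  constructor
  · intro m a p hm h h1 h2
    rw [id1 h h1 h2]
    have := n1 a p
    have := n2 a
    have : 0 ≤ m - 1 := by linarith
    positivity
  · intro m a p hm h h1 h2 h3 h4
    rw [id1 h h1 h2] at h3
    have m1 := n1 a p
    have m2 := n2 a
    rcases h4 with h4 | h4
    · have h5 : ∫ t in Ioi 0, rad t * (p t + (rad t)⁻¹ * a t) ^ 2 = 0 := by nlinarith
      have i2 : IntegrableOn (fun t => a t * p t) (Ioi 0) := by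
        refine .mul_of_weighted_sq h.meas h.meas_deriv ?_ h2 h1
        filter_upwards [ae_restrict_mem measurableSet_Ioi] with t ht
        have := rad_pos (le_of_lt ht)
        exact ⟨by field_simp; rfl, by positivity⟩
      have i3 : IntegrableOn (fun t => rad t * (p t + (rad t)⁻¹ * a t) ^ 2) (Ioi 0) := by
        refine ((h1.add h2).add (i2.const_mul 2)).congr ?_
        filter_upwards [ae_restrict_mem measurableSet_Ioi] with t ht
        have := rad_pos (le_of_lt ht)
        simp only [Pi.add_apply]
        field_simp
        ring
      rw [setIntegral_eq_zero_iff_of_nonneg_ae ?_ i3] at h5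
      -- The vanishing of the square says that `rad · a` is constant.
      · have hs : IsPrim rad (fun _ => 1) := .of_hasDerivAt hasDerivAt_rad continuous_const
        intro t ht
        have := (hs.mul h).eq_const (by
          filter_upwards [h5, ae_restrict_mem measurableSet_Ioi] with t ht ht'
          have h7 := rad_pos (le_of_lt ht')
          have h6 : p t + (rad t)⁻¹ * a t = 0 := by simpa [h7.ne'] using ht
          have h8 : rad t * (rad t)⁻¹ = 1 := mul_inv_cancel₀ h7.ne'
          simp only [Pi.zero_apply]
          linear_combination rad t * h6 - a t * h8) ht
        simpa [h4, (rad_pos ht).ne'] using this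
      · filter_upwards [ae_restrict_mem measurableSet_Ioi] with t ht
        have := rad_pos (le_of_lt ht)
        simp only [Pi.zero_apply]
        positivity
    · have h5 : ∫ t in Ioi 0, (rad t)⁻¹ * a t ^ 2 = 0 := by nlinarith
      rw [setIntegral_eq_zero_iff_of_nonneg_ae ?_ h2] at h5
      · intro t ht
        refine h.eq_of_ae_eq (f := fun _ => 0) continuous_const ?_ ht
        filter_upwards [h5, ae_restrict_mem measurableSet_Ioi] with t ht ht'
        simpa [(rad_pos (le_of_lt ht')).ne'] using ht
      · filter_upwards [ae_restrict_mem measurableSet_Ioi] with t ht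
        have := rad_pos (le_of_lt ht)
        simp only [Pi.zero_apply]
        positivity

/-! ### Radial solutions -/

/-- The Jacobi function `s tanh s - 1`, `s = t - log √3`. -/
def tnhSecond (t : ℝ) : ℝ := (t - log √3) * tnh t - 1

/-- The derivative of `tnhSecond`. -/
def tnhSecond' (t : ℝ) : ℝ := tnh t + (t - log √3) * sch t ^ 2

lemma hasDerivAt_tnhSecond (t : ℝ) : HasDerivAt tnhSecond (tnhSecond' t) t := by
  convert! (((hasDerivAt_id t).sub_const (log √3)).mul (hasDerivAt_tnh t)).sub_const 1 using 1
  simp [tnhSecond']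

lemma hasDerivAt_tnhSecond' (t : ℝ) :
    HasDerivAt tnhSecond' (-(2 * sch t ^ 2) * tnhSecond t) t := by
  convert! (hasDerivAt_tnh t).add
    (((hasDerivAt_id t).sub_const (log √3)).mul ((hasDerivAt_sch t).pow 2)) using 1
  simp [tnhSecond]
  ring

lemma hasDerivAt_sch_sq (t : ℝ) :
    HasDerivAt (fun t => sch t ^ 2) (-(2 * sch t ^ 2) * tnh t) t := by
  convert! (hasDerivAt_sch t).pow 2 using 1
  simp
  ring

/-- A function of finite energy both of whose Wronskians with the radial Jacobi functions are
constant is a multiple of `tnh`. -/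
lemma catenoid_radial_solution {a p : ℝ → ℝ} (h : IsPrim a p)
    (hp : IntegrableOn (fun t => p t ^ 2) (Ioi 0)) {C₁ C₂ : ℝ}
    (h1 : ∀ᵐ t ∂volume.restrict (Ioi 0), tnh t * p t - sch t ^ 2 * a t = C₁)
    (h2 : ∀ᵐ t ∂volume.restrict (Ioi 0), tnhSecond t * p t - tnhSecond' t * a t = C₂) :
    ∃ c : ℝ, (∀ t, 0 ≤ t → a t = c * tnh t) ∧
      ∀ᵐ t ∂volume.restrict (Ioi 0), p t = c * sch t ^ 2 := by
  -- The two radial Jacobi functions have Wronskian one, so Cramer's rule expresses `a` and `p`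
  -- through `C₁` and `C₂`.
  have hW : ∀ t, tnh t * tnhSecond' t - tnhSecond t * sch t ^ 2 = 1 := fun t => by
    simp only [tnhSecond', tnhSecond]; linear_combination tnh_sq t
  have hpe : ∀ᵐ t ∂volume.restrict (Ioi 0), p t = C₁ * tnhSecond' t - C₂ * sch t ^ 2 := by
    filter_upwards [h1, h2] with t h1 h2
    linear_combination tnhSecond' t * h1 - sch t ^ 2 * h2 - p t * hW t
  have hae : ∀ᵐ t ∂volume.restrict (Ioi 0), a t = C₁ * tnhSecond t - C₂ * tnh t := by
    filter_upwards [h1, h2] with t h1 h2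
    linear_combination tnhSecond t * h1 - tnh t * h2 - a t * hW t
  -- Beyond `log √3 + 1` the derivative of the second solution is at least `1 / 2`. If `C₁ ≠ 0`, a
  -- positive constant would be dominated there by the integrable function `p² + C₂² sch⁴`; the
  -- factor `8` comes from this `1 / 2` and from `(x + y)² ≤ 2 (x² + y²)`.
  have hC : C₁ = 0 := by
    by_contra hne
    have i1 : IntegrableOn (fun t => (sch t ^ 2) ^ 2) (Ioi 0) :=
      (integrableOn_bdd_mul (by fun_prop) (fun t _ => abs_sch_sq_le_one t)
        integrableOn_sch_sq).congr (ae_of_all _ fun t => by ring)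
    have i2 : IntegrableOn (fun _ : ℝ => (1:ℝ)) (Ioi (log √3 + 1)) := by
      have i3 : IntegrableOn (fun t => 8 / C₁ ^ 2 * (p t ^ 2 + C₂ ^ 2 * (sch t ^ 2) ^ 2))
          (Ioi (log √3 + 1)) :=
        IntegrableOn.mono_set ((hp.add (i1.const_mul _)).const_mul _)
          (Ioi_subset_Ioi (by linarith [log_sqrt_three_pos]))
      refine Integrable.mono i3 (by fun_prop) ?_
      filter_upwards [ae_restrict_mem measurableSet_Ioi, ae_restrict_of_ae_restrict_of_subset
        (Ioi_subset_Ioi (by linarith [log_sqrt_three_pos] : (0:ℝ) ≤ log √3 + 1)) hpe] with t ht hpt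
      have g1 : 1 / 2 ≤ tnhSecond' t := by
        have : 1 / 2 ≤ tnh t := by
          have hs : 1 ≤ Real.sinh (t - log √3) :=
            (by linarith [mem_Ioi.1 ht] : (1:ℝ) ≤ t - log √3).trans
              (Real.self_le_sinh_iff.2 (by linarith [mem_Ioi.1 ht]))
          have hc := Real.cosh_sq (t - log √3)
          have hc0 := Real.cosh_pos (t - log √3)
          rw [tnh, Real.tanh_eq_sinh_div_cosh, div_le_div_iff₀ (by norm_num) hc0]
          nlinarith
        have h0 : 0 ≤ (t - log √3) * sch t ^ 2 :=
          mul_nonneg (by linarith [mem_Ioi.1 ht]) (sq_nonneg _)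
        simp only [tnhSecond']; linarith
      have hC2 : 0 < C₁ ^ 2 := by positivity
      have g2 : C₁ ^ 2 * tnhSecond' t ^ 2 ≤ 2 * (p t ^ 2 + C₂ ^ 2 * (sch t ^ 2) ^ 2) := by
        have : C₁ * tnhSecond' t = p t + C₂ * sch t ^ 2 := by rw [hpt]; ring
        rw [← mul_pow, this]
        nlinarith [sq_nonneg (p t - C₂ * sch t ^ 2)]
      have g3 : C₁ ^ 2 * (1 / 4) ≤ C₁ ^ 2 * tnhSecond' t ^ 2 := by gcongr; nlinarith
      rw [norm_one, norm_eq_abs, abs_of_nonneg (by positivity), div_mul_eq_mul_div, le_div_iff₀ hC2]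
      linarith
    have := (integrableOn_const_iff (C := (1:ℝ))).1 i2
    simp at this
  refine ⟨-C₂, fun t ht => ?_, ?_⟩
  · refine h.eq_of_ae_eq (f := fun t => -C₂ * tnh t) (by fun_prop) ?_ ht
    filter_upwards [hae] with t ht
    rw [ht, hC]; ring
  · filter_upwards [hpe] with t ht
    rw [ht, hC]; ring

/-- A constant flux `rad · p = C` gives the energy density `C² / rad`, which diverges
logarithmically unless `C = 0`; this excludes the solution `log rad`. -/
lemma plane_radial_solution {p : ℝ → ℝ}
    (hp : IntegrableOn (fun t => rad t * p t ^ 2) (Ioi 0)) {C : ℝ}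
    (h1 : ∀ᵐ t ∂volume.restrict (Ioi 0), rad t * p t = C) :
    p =ᵐ[volume.restrict (Ioi 0)] 0 := by
  have hC : C = 0 := by
    by_contra hne
    have : IntegrableOn (fun t : ℝ => t⁻¹) (Ioi 2) := by
      have i3 : IntegrableOn (fun t => 4 / C ^ 2 * (rad t * p t ^ 2)) (Ioi 2) :=
        IntegrableOn.mono_set (hp.const_mul _) (Ioi_subset_Ioi (by norm_num))
      refine Integrable.mono i3 (by fun_prop) ?_
      filter_upwards [ae_restrict_mem measurableSet_Ioi, ae_restrict_of_ae_restrict_of_subset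
        (Ioi_subset_Ioi (by norm_num : (0:ℝ) ≤ 2)) h1] with t ht hpt
      have ht0 : 0 < t := by linarith [mem_Ioi.1 ht]
      have hr := rad_pos ht0.le
      have hr2 : rad t ≤ 2 * t := by
        have : 2 / √3 ≤ 2 := by
          rw [div_le_iff₀ (by positivity)]
          have : (1:ℝ) ≤ √3 := by rw [Real.one_le_sqrt]; norm_num
          linarith
        unfold rad; linarith [mem_Ioi.1 ht]
      have e : rad t * p t ^ 2 = C ^ 2 / rad t := by rw [← hpt]; field_simp
      rw [e, norm_eq_abs, norm_eq_abs, abs_of_pos (by positivity), abs_of_pos (by positivity),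
        div_mul_div_comm, inv_eq_one_div, div_le_div_iff₀ ht0 (by positivity)]
      have : 0 < C ^ 2 := by positivity
      nlinarith
    exact not_integrableOn_Ioi_inv this
  filter_upwards [h1, ae_restrict_mem measurableSet_Ioi] with t ht ht'
  simpa [hC, (rad_pos (le_of_lt ht')).ne'] using ht

/-- The quadratic form of the radial Jacobi function `tnh` on a catenoidal face. -/
lemma modeForm_tnh {a p : ℝ → ℝ} {c : ℝ} (h0 : ∀ t, 0 ≤ t → a t = c * tnh t)
    (h1 : ∀ᵐ t ∂volume.restrict (Ioi 0), p t = c * sch t ^ 2) :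
    modeForm (fun _ => 1) (fun t => 2 * sch t ^ 2) (-1 / 2) 0 a p = c ^ 2 / 2 := by
  -- Since `tnh` solves the Jacobi equation, the energy density of `tnh` is the derivative of `tnh ·
  -- tnh'`. Its total change is `3 / 8`, and the boundary term of the form adds `1 / 8`.
  have hF := isPrim_tnh.mul (IsPrim.of_hasDerivAt hasDerivAt_sch_sq (by fun_prop))
  have lim : Tendsto (fun t => tnh t * sch t ^ 2) atTop (𝓝 0) := by
    simpa using tendsto_tnh.mul (tendsto_sch.pow 2)
  have int : IntegrableOn (fun t => sch t ^ 2 * sch t ^ 2 + tnh t * (-(2 * sch t ^ 2) * tnh t))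
      (Ioi 0) := by
    refine (integrableOn_bdd_mul (g := fun t => sch t ^ 2 - 2 * tnh t ^ 2) (C := 3) (by fun_prop)
      (fun t _ => ?_) integrableOn_sch_sq).congr (ae_of_all _ fun t => by ring)
    rw [abs_le]
    have := tnh_sq t
    constructor <;> nlinarith [sq_nonneg (sch t), sq_nonneg (tnh t)]
  have key := hF.integral_Ioi_of_tendsto int lim
  have e : ∫ t in Ioi 0, (1 * p t ^ 2 + (0 * (1:ℝ)⁻¹ - 2 * sch t ^ 2) * a t ^ 2) =
      ∫ t in Ioi 0, c ^ 2 * (sch t ^ 2 * sch t ^ 2 + tnh t * (-(2 * sch t ^ 2) * tnh t)) := by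
    refine integral_congr_ae ?_
    filter_upwards [h1, ae_restrict_mem measurableSet_Ioi] with t h1 ht
    rw [h1, h0 t (le_of_lt ht)]; ring
  rw [modeForm, e, integral_const_mul, key, h0 0 le_rfl, tnh_zero, sch_zero_sq]
  ring

/-! ## Fourier modes on the half cylinder -/

instance : IsFiniteMeasure circleMeasure := by unfold circleMeasure; infer_instance

lemma stripMeasure_eq : stripMeasure = (volume.restrict (Ioi 0)).prod circleMeasure := by
  rw [stripMeasure, circleMeasure, Measure.volume_eq_prod, Measure.prod_restrict]

lemma integral_strip {g : ℝ × ℝ → ℝ} (h : Integrable g stripMeasure) :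
    ∫ z, g z ∂stripMeasure = ∫ t in Ioi 0, ∫ θ, g (t, θ) ∂circleMeasure := by
  rw [stripMeasure_eq] at h ⊢
  exact integral_prod _ h

lemma integrableOn_strip {g : ℝ × ℝ → ℝ} {b : ℝ} (h : IntegrableOn g (Iio b ×ˢ univ) stripMeasure) :
    Integrable g ((volume.restrict (Iio b ∩ Ioi 0)).prod circleMeasure) := by
  rw [IntegrableOn, stripMeasure_eq, ← Measure.prod_restrict, Measure.restrict_univ,
    Measure.restrict_restrict measurableSet_Iio] at h
  exact h

lemma ae_strip_pos : ∀ᵐ z ∂stripMeasure, 0 < z.1 := by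
  unfold stripMeasure
  filter_upwards [ae_restrict_mem (measurableSet_Ioi.prod measurableSet_Ioc)] with z hz using hz.1

/-- Smooth `2π`-periodic functions of the angle. -/
def IsAngular (e : ℝ → ℝ) : Prop := ContDiff ℝ ∞ e ∧ ∀ θ, e (θ + 2 * π) = e θ

namespace IsAngular

variable {e : ℝ → ℝ}

lemma continuous (h : IsAngular e) : Continuous e := h.1.continuous

lemma deriv (h : IsAngular e) : IsAngular (deriv e) := by
  refine ⟨(contDiff_infty_iff_deriv.1 h.1).2, fun θ => ?_⟩
  rw [← deriv_comp_add_const]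
  congr 1
  funext x
  exact h.2 x

lemma hasDerivAt (h : IsAngular e) (θ : ℝ) : HasDerivAt e (_root_.deriv e θ) θ :=
  (h.1.differentiable (by simp) θ).hasDerivAt

lemma integral_deriv (h : IsAngular e) : ∫ θ, _root_.deriv e θ ∂circleMeasure = 0 := by
  rw [circleMeasure, ← intervalIntegral.integral_of_le (by positivity),
    intervalIntegral.integral_eq_sub_of_hasDerivAt (fun x _ => h.hasDerivAt x)
      (h.deriv.continuous.intervalIntegrable _ _)]
  have := h.2 0
  rw [zero_add] at this
  rw [this, sub_self]

lemma mul {f : ℝ → ℝ} (h : IsAngular e) (hf : IsAngular f) : IsAngular fun θ => e θ * f θ :=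
  ⟨h.1.mul hf.1, fun θ => by simp only [h.2, hf.2]⟩

lemma isTest (h : IsAngular e) {χ : ℝ → ℝ} (hχ : IsCutoff χ) :
    IsTest fun z => χ z.1 * e z.2 := by
  refine ⟨(hχ.1.comp contDiff_fst).mul (h.1.comp contDiff_snd), fun t θ => ?_, ?_⟩
  · simp only [h.2]
  · obtain ⟨b, hb⟩ := hχ.2
    exact ⟨b, fun t θ ht => by simp [hb t ht]⟩

lemma fderiv_fst (h : IsAngular e) {χ : ℝ → ℝ} (hχ : IsCutoff χ) (z : ℝ × ℝ) :
    fderiv ℝ (fun z : ℝ × ℝ => χ z.1 * e z.2) z (1, 0) = _root_.deriv χ z.1 * e z.2 := by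
  have h1 : HasFDerivAt (fun z : ℝ × ℝ => χ z.1) _ z :=
    (hχ.hasDerivAt z.1).hasFDerivAt.comp z hasFDerivAt_fst
  have h2 : HasFDerivAt (fun z : ℝ × ℝ => e z.2) _ z :=
    (h.hasDerivAt z.2).hasFDerivAt.comp z hasFDerivAt_snd
  rw [(h1.fun_mul h2).fderiv]
  simp [mul_comm]

lemma fderiv_snd (h : IsAngular e) {χ : ℝ → ℝ} (hχ : IsCutoff χ) (z : ℝ × ℝ) :
    fderiv ℝ (fun z : ℝ × ℝ => χ z.1 * e z.2) z (0, 1) = χ z.1 * _root_.deriv e z.2 := by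
  have h1 : HasFDerivAt (fun z : ℝ × ℝ => χ z.1) _ z :=
    (hχ.hasDerivAt z.1).hasFDerivAt.comp z hasFDerivAt_fst
  have h2 : HasFDerivAt (fun z : ℝ × ℝ => e z.2) _ z :=
    (h.hasDerivAt z.2).hasFDerivAt.comp z hasFDerivAt_snd
  rw [(h1.fun_mul h2).fderiv]
  simp

end IsAngular

lemma isAngular_one : IsAngular fun _ => 1 := ⟨contDiff_const, fun _ => rfl⟩

/-- `cos (k θ)`. -/
def cosMode (k : ℤ) (θ : ℝ) : ℝ := cos (k * θ)

/-- `sin (k θ)`. -/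
def sinMode (k : ℤ) (θ : ℝ) : ℝ := sin (k * θ)

lemma isAngular_cosMode (k : ℤ) : IsAngular (cosMode k) := by
  refine ⟨Real.contDiff_cos.comp (contDiff_const.mul contDiff_id), fun θ => ?_⟩
  rw [cosMode, mul_add, Real.cos_add_int_mul_two_pi]; rfl

lemma isAngular_sinMode (k : ℤ) : IsAngular (sinMode k) := by
  refine ⟨Real.contDiff_sin.comp (contDiff_const.mul contDiff_id), fun θ => ?_⟩
  rw [sinMode, mul_add, Real.sin_add_int_mul_two_pi]; rfl

lemma deriv_cosMode (k : ℤ) : deriv (cosMode k) = fun θ => -k * sinMode k θ := by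
  funext θ
  have := (((hasDerivAt_id θ).const_mul (k : ℝ)).cos).deriv
  simp only [id] at this
  rw [show cosMode k = fun θ => cos (k * θ) from rfl, this, sinMode]
  ring

lemma deriv_sinMode (k : ℤ) : deriv (sinMode k) = fun θ => k * cosMode k θ := by
  funext θ
  have := (((hasDerivAt_id θ).const_mul (k : ℝ)).sin).deriv
  simp only [id] at this
  rw [show sinMode k = fun θ => sin (k * θ) from rfl, this, cosMode]
  ring

/-! ### Fourier coefficients on circles -/

/-- The coefficient `∫ f (t, θ) e (θ) dθ` of a function on the half cylinder. -/
def coef (e : ℝ → ℝ) (f : ℝ × ℝ → ℝ) (t : ℝ) : ℝ := ∫ θ, f (t, θ) * e θ ∂circleMeasure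

lemma exists_bound_of_vanish {g : ℝ × ℝ → ℝ} (hg : Continuous g) {b : ℝ}
    (hb : ∀ t θ, b ≤ t → g (t, θ) = 0) : ∃ C, ∀ᵐ z ∂stripMeasure, ‖g z‖ ≤ C := by
  obtain ⟨C, hC⟩ := ((isCompact_Icc (a := (0:ℝ)) (b := b)).prod
    (isCompact_Icc (a := (0:ℝ)) (b := 2 * π))).exists_bound_of_continuousOn hg.continuousOn
  refine ⟨max C 0, ?_⟩
  unfold stripMeasure
  filter_upwards [ae_restrict_mem (measurableSet_Ioi.prod measurableSet_Ioc)] with z hz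
  rcases le_total b z.1 with h | h
  · rw [show z = (z.1, z.2) from rfl, hb _ _ h]; simp
  · exact (hC z ⟨⟨le_of_lt hz.1, h⟩, ⟨le_of_lt hz.2.1, hz.2.2⟩⟩).trans (le_max_left _ _)

lemma LocInt.integrable_mul {f : FaceFun} (hf : LocInt f) {g : ℝ × ℝ → ℝ} (hg : Continuous g)
    {b : ℝ} (hb : ∀ t θ, b ≤ t → g (t, θ) = 0) : Integrable (fun z => f z * g z) stripMeasure := by
  obtain ⟨C, hC⟩ := exists_bound_of_vanish hg hb
  have h1 : IntegrableOn (fun z => f z * g z) (Iio b ×ˢ univ) stripMeasure :=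
    Integrable.mul_bdd (c := C) (hf b) hg.aestronglyMeasurable (ae_restrict_of_ae hC)
  rw [← integrableOn_univ]
  refine h1.of_forall_sdiff_eq_zero MeasurableSet.univ fun z hz => ?_
  have : b ≤ z.1 := by
    by_contra h
    exact hz.2 ⟨not_le.1 h, trivial⟩
  rw [show z = (z.1, z.2) from rfl, hb _ _ this, mul_zero]

lemma LocInt.loc_coef {f : FaceFun} (hf : LocInt f) {e : ℝ → ℝ} (he : IsAngular e) (b : ℝ) :
    IntegrableOn (coef e f) (Ioc 0 b) := by
  -- `LocInt` concerns open slabs `t < b`, so `b + 1` is taken in order to cover `Ioc 0 b`.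
  have h1 := integrableOn_strip (hf (b + 1))
  obtain ⟨C, hC⟩ := (isCompact_Icc (a := (0:ℝ)) (b := 2 * π)).exists_bound_of_continuousOn
    he.continuous.continuousOn
  have h2 : Integrable (fun z : ℝ × ℝ => f z * e z.2)
      ((volume.restrict (Iio (b + 1) ∩ Ioi 0)).prod circleMeasure) := by
    refine h1.mul_bdd (c := C) (he.continuous.comp continuous_snd).aestronglyMeasurable ?_
    have h3 : ∀ᵐ θ ∂circleMeasure, ‖e θ‖ ≤ C := by
      unfold circleMeasure
      filter_upwards [ae_restrict_mem measurableSet_Ioc] with θ hθ using hC θ ⟨hθ.1.le, hθ.2⟩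
    exact Measure.quasiMeasurePreserving_snd.ae h3
  have h4 : IntegrableOn (coef e f) (Iio (b + 1) ∩ Ioi 0) := h2.integral_prod_left
  exact h4.mono_set fun x hx => ⟨by simp only [mem_Iio]; linarith [hx.2], hx.1⟩

lemma LocInt.integral_mul_cutoff {f : FaceFun} (hf : LocInt f) {e : ℝ → ℝ} (he : IsAngular e)
    {χ : ℝ → ℝ} (hχ : IsCutoff χ) :
    ∫ z, f z * (χ z.1 * e z.2) ∂stripMeasure = ∫ t in Ioi 0, coef e f t * χ t := by
  obtain ⟨b, hb⟩ := hχ.2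
  have h := hf.integrable_mul (g := fun z => χ z.1 * e z.2)
    ((hχ.1.continuous.comp continuous_fst).mul (he.continuous.comp continuous_snd)) (b := b)
    (fun t θ ht => by simp [hb t ht])
  rw [integral_strip h]
  congr 1
  funext t
  rw [coef, ← integral_mul_const]
  congr 1
  funext θ
  ring

/-! ### Modes of Sobolev functions -/

/-- The continuous representative of the coefficient `∫ u (t, θ) e (θ) dθ` of a Sobolev function
`u`. -/
def mode (e : ℝ → ℝ) (φ : Jet) (t : ℝ) : ℝ :=
  ∫ θ, φ.trace θ * e θ ∂circleMeasure + ∫ s in (0)..t, coef e φ.pt s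

lemma mode_zero (e : ℝ → ℝ) (φ : Jet) : mode e φ 0 = ∫ θ, φ.trace θ * e θ ∂circleMeasure := by
  simp [mode]

namespace HasWeakGradTrace

variable {φ : Jet} {e : ℝ → ℝ}

lemma isPrim_mode (h : HasWeakGradTrace φ) (he : IsAngular e) :
    IsPrim (mode e φ) (coef e φ.pt) :=
  ⟨h.2.1.loc_coef he, fun t _ => by rw [mode_zero]; rfl⟩

/-- Testing with `χ(t) e(θ)` turns the weak `t`-derivative and the trace into a one-dimensional weak
derivative with boundary value, to which `ae_eq_primitive` applies. -/
lemma coef_val (h : HasWeakGradTrace φ) (he : IsAngular e) :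
    coef e φ.val =ᵐ[volume.restrict (Ioi 0)] mode e φ := by
  refine ae_eq_primitive (h.1.loc_coef he) (h.2.1.loc_coef he) fun χ hχ => ?_
  have := (h.2.2.2.2 _ (he.isTest hχ)).1
  simp_rw [he.fderiv_fst hχ] at this
  rw [h.1.integral_mul_cutoff he hχ.deriv, h.2.1.integral_mul_cutoff he hχ] at this
  rw [this, ← integral_mul_const]
  congr 2
  funext θ
  ring

/-- Periodicity leaves no boundary term in `θ`, so separated test functions move the `θ`-derivative
onto `e`. -/
lemma coef_pθ (h : HasWeakGradTrace φ) (he : IsAngular e) :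
    ∀ᵐ t ∂volume.restrict (Ioi 0), coef e φ.pθ t = -coef (deriv e) φ.val t := by
  have l1 := h.2.2.1.loc_coef he
  have l2 := h.1.loc_coef he.deriv
  have key : (fun t => coef e φ.pθ t + coef (deriv e) φ.val t) =ᵐ[volume.restrict (Ioi 0)] 0 := by
    refine ae_eq_zero_of_cutoff (fun b => (l1 b).add (l2 b)) fun g hg hs => ?_
    obtain ⟨b, hb⟩ := hs.isCompact.bddAbove
    have hc : IsCutoff g := ⟨hg, b + 1, fun t ht => by
      by_contra hne
      have := hb (subset_tsupport _ hne)
      linarith⟩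
    have := (h.2.2.2.2 _ (he.isTest hc)).2
    simp_rw [he.fderiv_snd hc] at this
    rw [h.1.integral_mul_cutoff he.deriv hc, h.2.2.1.integral_mul_cutoff he hc] at this
    simp_rw [add_mul]
    rw [integral_add (hc.integrableOn l1) (hc.integrableOn l2), this]
    ring
  filter_upwards [key] with t ht
  have : coef e φ.pθ t + coef (deriv e) φ.val t = 0 := ht
  linarith

lemma coef_cos_pθ (h : HasWeakGradTrace φ) (k : ℤ) :
    ∀ᵐ t ∂volume.restrict (Ioi 0), coef (cosMode k) φ.pθ t = k * mode (sinMode k) φ t := by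
  filter_upwards [h.coef_pθ (isAngular_cosMode k), h.coef_val (isAngular_sinMode k)] with t h1 h2
  rw [h1, ← h2, deriv_cosMode, coef, coef, ← integral_const_mul, ← integral_neg]
  congr 1; funext θ; ring

lemma coef_sin_pθ (h : HasWeakGradTrace φ) (k : ℤ) :
    ∀ᵐ t ∂volume.restrict (Ioi 0), coef (sinMode k) φ.pθ t = -k * mode (cosMode k) φ t := by
  filter_upwards [h.coef_pθ (isAngular_sinMode k), h.coef_val (isAngular_cosMode k)] with t h1 h2
  rw [h1, ← h2, deriv_sinMode, coef, coef, ← integral_const_mul, ← integral_neg]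
  congr 1; funext θ; ring

end HasWeakGradTrace

/-! ### Parseval's identity -/

/-- The two integrals are, up to sign, the real and imaginary parts of `∫ h e^{-ikθ}`. Since `k`
ranges over all integers, each nonzero frequency is counted twice, and the constant is `2π`
throughout. -/
lemma hasSum_sq_circle {h : ℝ → ℝ} (hh : MemLp h 2 circleMeasure) :
    HasSum (fun k : ℤ => (∫ θ, h θ * cosMode k θ ∂circleMeasure) ^ 2 +
      (∫ θ, h θ * sinMode k θ ∂circleMeasure) ^ 2) (2 * π * ∫ θ, h θ ^ 2 ∂circleMeasure) := by
  have hpi : (0:ℝ) < 2 * π := by positivity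
  have h1 := hasSum_sq_fourierCoeffOn (f := fun θ => (h θ : ℂ)) hpi
    (by have := hh.ofReal (K := ℂ); exact this)
  have h2 := h1.mul_left ((2 * π) ^ 2)
  have int : Integrable h circleMeasure := hh.integrable (by norm_num)
  convert! h2 using 1
  · funext k
    rw [fourierCoeffOn_eq_integral]
    have e : ∫ x in (0)..(2 * π), (fourier (-k) (x : AddCircle (2 * π - 0))) • (h x : ℂ) =
        ((∫ θ, h θ * cosMode k θ ∂circleMeasure : ℝ) : ℂ) -
          ((∫ θ, h θ * sinMode k θ ∂circleMeasure : ℝ) : ℂ) * Complex.I := by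
      rw [intervalIntegral.integral_of_le hpi.le, ← integral_complex_ofReal,
        ← integral_complex_ofReal, ← integral_mul_const, ← integral_sub]
      · refine integral_congr_ae (ae_of_all _ fun θ => ?_)
        simp only
        rw [fourier_coe_apply]
        have : 2 * (π:ℂ) * Complex.I * ((-k : ℤ) : ℂ) * (θ : ℂ) / ((2 * π - 0 : ℝ) : ℂ) =
            ((-(k * θ) : ℝ) : ℂ) * Complex.I := by
          have : (π : ℂ) ≠ 0 := by exact_mod_cast Real.pi_ne_zero
          push_cast
          rw [sub_zero]
          field_simp
        rw [this, Complex.exp_mul_I, ← Complex.ofReal_cos, ← Complex.ofReal_sin, Real.cos_neg,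
          Real.sin_neg, smul_eq_mul, cosMode, sinMode]
        push_cast
        ring
      · exact (int.mul_bdd (c := 1) (isAngular_cosMode k).continuous.aestronglyMeasurable
          (ae_of_all _ fun θ => Real.abs_cos_le_one _)).ofReal
      · exact (int.mul_bdd (c := 1) (isAngular_sinMode k).continuous.aestronglyMeasurable
          (ae_of_all _ fun θ => Real.abs_sin_le_one _)).ofReal.mul_const _
    rw [e, norm_smul, sub_zero, mul_pow _ ‖_‖, ← Complex.normSq_eq_norm_sq, Complex.normSq_apply]
    simp
    field_simp
    rw [sq_abs]
  · rw [intervalIntegral.integral_of_le hpi.le, sub_zero, smul_eq_mul]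
    simp only [Complex.norm_real, norm_eq_abs, sq_abs]
    rw [circleMeasure]
    field_simp

section StripParseval

variable {f : ℝ × ℝ → ℝ} {W : ℝ → ℝ}

lemma ae_memLp_slice (hf : AEStronglyMeasurable f stripMeasure) (hW : ∀ t, 0 < t → 0 < W t)
    (h : Integrable (fun z => W z.1 * f z ^ 2) stripMeasure) :
    ∀ᵐ t ∂volume.restrict (Ioi 0), MemLp (fun θ => f (t, θ)) 2 circleMeasure := by
  rw [stripMeasure_eq] at h hf
  filter_upwards [h.prod_right_ae, hf.prodMk_left, ae_restrict_mem measurableSet_Ioi]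
    with t h1 h2 ht
  rw [memLp_two_iff_integrable_sq h2]
  refine (h1.const_mul (W t)⁻¹).congr (ae_of_all _ fun θ => ?_)
  have := (hW t ht).ne'
  simp only
  field_simp

lemma aestronglyMeasurable_coef (hf : AEStronglyMeasurable f stripMeasure) {e : ℝ → ℝ}
    (he : IsAngular e) : AEStronglyMeasurable (coef e f) (volume.restrict (Ioi 0)) := by
  rw [stripMeasure_eq] at hf
  exact (hf.mul (he.continuous.comp continuous_snd).aestronglyMeasurable).integral_prod_right'

/-- Bessel's inequality: a single term is at most the Parseval sum of the slice, whose weighted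
integral in `t` is finite. -/
lemma integrable_sq_coef (hf : AEStronglyMeasurable f stripMeasure)
    (hs : ∀ᵐ t ∂volume.restrict (Ioi 0), MemLp (fun θ => f (t, θ)) 2 circleMeasure)
    (hW : ∀ t, 0 < t → 0 ≤ W t) (hc : ContinuousOn W (Ioi 0))
    (h : Integrable (fun z => W z.1 * f z ^ 2) stripMeasure) (k : ℤ) :
    IntegrableOn (fun t => W t * coef (cosMode k) f t ^ 2) (Ioi 0) ∧
    IntegrableOn (fun t => W t * coef (sinMode k) f t ^ 2) (Ioi 0) := by
  have mW := hc.aestronglyMeasurable (μ := volume) measurableSet_Ioi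
  have m1 := aestronglyMeasurable_coef hf (isAngular_cosMode k)
  have m2 := aestronglyMeasurable_coef hf (isAngular_sinMode k)
  rw [stripMeasure_eq] at h
  have hi := h.integral_prod_left.const_mul (2 * π)
  have key : ∀ᵐ t ∂volume.restrict (Ioi 0), 0 ≤ W t ∧
      W t * (coef (cosMode k) f t ^ 2 + coef (sinMode k) f t ^ 2) ≤
        2 * π * ∫ θ, W t * f (t, θ) ^ 2 ∂circleMeasure := by
    filter_upwards [hs, ae_restrict_mem measurableSet_Ioi] with t ht ht'
    refine ⟨hW t ht', ?_⟩
    have := le_hasSum (hasSum_sq_circle ht) k fun j _ => by positivity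
    rw [integral_const_mul]
    calc _ ≤ W t * _ := mul_le_mul_of_nonneg_left this (hW t ht')
      _ = _ := by ring
  constructor
  · refine Integrable.mono' hi (mW.mul (m1.pow 2)) ?_
    filter_upwards [key] with t ⟨h1, h2⟩
    rw [norm_eq_abs, abs_of_nonneg (by positivity)]
    nlinarith [mul_nonneg h1 (sq_nonneg (coef (sinMode k) f t)),
      mul_nonneg h1 (sq_nonneg (coef (cosMode k) f t))]
  · refine Integrable.mono' hi (mW.mul (m2.pow 2)) ?_
    filter_upwards [key] with t ⟨h1, h2⟩
    rw [norm_eq_abs, abs_of_nonneg (by positivity)]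
    nlinarith [mul_nonneg h1 (sq_nonneg (coef (sinMode k) f t)),
      mul_nonneg h1 (sq_nonneg (coef (cosMode k) f t))]

/-- Parseval on almost every circle, integrated in `t`. The terms are nonnegative, so they serve as
their own dominating family, and their sum is integrable by Fubini. -/
lemma hasSum_strip (hf : AEStronglyMeasurable f stripMeasure)
    (hs : ∀ᵐ t ∂volume.restrict (Ioi 0), MemLp (fun θ => f (t, θ)) 2 circleMeasure)
    (hW : ∀ t, 0 < t → 0 ≤ W t) (hc : ContinuousOn W (Ioi 0))
    (h : Integrable (fun z => W z.1 * f z ^ 2) stripMeasure) :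
    HasSum (fun k : ℤ => ∫ t in Ioi 0, (W t * coef (cosMode k) f t ^ 2 +
      W t * coef (sinMode k) f t ^ 2)) (2 * π * ∫ z, W z.1 * f z ^ 2 ∂stripMeasure) := by
  have hi := fun k => integrable_sq_coef hf hs hW hc h k
  rw [stripMeasure_eq] at h
  have hsum : ∀ᵐ t ∂volume.restrict (Ioi 0), HasSum (fun k : ℤ => W t * coef (cosMode k) f t ^ 2 +
      W t * coef (sinMode k) f t ^ 2) (2 * π * ∫ θ, W t * f (t, θ) ^ 2 ∂circleMeasure) := by
    filter_upwards [hs] with t ht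
    have := (hasSum_sq_circle ht).mul_left (W t)
    rw [integral_const_mul]
    convert! this using 1
    · funext k; simp only [coef]; ring
    · ring
  rw [stripMeasure_eq, integral_prod _ h, ← integral_const_mul]
  refine hasSum_integral_of_dominated_convergence
    (fun k t => W t * coef (cosMode k) f t ^ 2 + W t * coef (sinMode k) f t ^ 2)
    (fun k => ((hi k).1.add (hi k).2).aestronglyMeasurable) (fun k => ?_) ?_ ?_ hsum
  · filter_upwards [ae_restrict_mem measurableSet_Ioi] with t ht
    have := hW t ht
    rw [norm_eq_abs, abs_of_nonneg (by positivity)]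
  · filter_upwards [hsum] with t ht using ht.summable
  · refine (h.integral_prod_left.const_mul (2 * π)).congr ?_
    filter_upwards [hsum] with t ht using ht.tsum_eq.symm

/-- A function on the half cylinder all of whose Fourier coefficients vanish is zero. -/
lemma ae_eq_zero_of_coef (hf : AEStronglyMeasurable f stripMeasure) (hW : ∀ t, 0 < t → 0 < W t)
    (hc : ContinuousOn W (Ioi 0)) (h : Integrable (fun z => W z.1 * f z ^ 2) stripMeasure)
    (h1 : ∀ k, coef (cosMode k) f =ᵐ[volume.restrict (Ioi 0)] 0)
    (h2 : ∀ k, coef (sinMode k) f =ᵐ[volume.restrict (Ioi 0)] 0) : f =ᵐ[stripMeasure] 0 := by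
  have h3 := hasSum_strip hf (ae_memLp_slice hf hW h) (fun t ht => (hW t ht).le) hc h
  have h4 : ∀ k : ℤ, ∫ t in Ioi 0, (W t * coef (cosMode k) f t ^ 2 +
      W t * coef (sinMode k) f t ^ 2) = 0 := fun k => by
    refine integral_eq_zero_of_ae ?_
    filter_upwards [h1 k, h2 k] with t e1 e2
    simp [e1, e2]
  simp_rw [h4] at h3
  have h5 := h3.unique hasSum_zero
  have h6 : ∫ z, W z.1 * f z ^ 2 ∂stripMeasure = 0 := by
    have := Real.pi_pos
    rcases mul_eq_zero.1 h5 with h | h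
    · linarith
    · exact h
  rw [integral_eq_zero_iff_of_nonneg_ae ?_ h] at h6
  · filter_upwards [h6, ae_strip_pos] with z hz hz'
    simpa [(hW _ hz').ne'] using hz
  · filter_upwards [ae_strip_pos] with z hz
    have := hW _ hz
    simp only [Pi.zero_apply]
    positivity

end StripParseval

/-! ## Rotationally symmetric faces -/

lemma inv_firstForm_of_orthogonal {X : ℝ × ℝ → E3} {z : ℝ × ℝ} {E G : ℝ} (hE : E ≠ 0) (hG : G ≠ 0)
    (h₁ : inner ℝ (dT X z) (dT X z) = E ^ 2) (h₂ : inner ℝ (dTheta X z) (dTheta X z) = G ^ 2)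
    (h₃ : inner ℝ (dT X z) (dTheta X z) = 0) :
    (firstForm X z)⁻¹ = !![(E ^ 2)⁻¹, 0; 0, (G ^ 2)⁻¹] := by
  refine Matrix.inv_eq_right_inv ?_
  rw [firstForm, h₁, h₂, h₃, real_inner_comm, h₃]
  ext i j
  fin_cases i <;> fin_cases j <;> simp [hE, hG]

/-- A face with first fundamental form `e² dt² + g² dθ²`, distance `N` to the origin,
`|A|² = V / (e g)`, and `∫ (H · ν) u v = β ∫ u v dθ` on the boundary. -/
structure IsRotFace (X : ℝ × ℝ → E3) (e g N V : ℝ → ℝ) (β : ℝ) : Prop where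
  cont_e : Continuous e
  cont_g : Continuous g
  cont_N : Continuous N
  cont_V : Continuous V
  e_pos : ∀ t, 0 ≤ t → 0 < e t
  g_pos : ∀ t, 0 ≤ t → 0 < g t
  N_nonneg : ∀ t, 0 ≤ N t
  cont_dT : Continuous (dT X)
  cont_dTheta : Continuous (dTheta X)
  inner_dT : ∀ z, inner ℝ (dT X z) (dT X z) = e z.1 ^ 2
  inner_dTheta : ∀ z, inner ℝ (dTheta X z) (dTheta X z) = g z.1 ^ 2
  inner_dT_dTheta : ∀ z, inner ℝ (dT X z) (dTheta X z) = 0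
  norm_eq : ∀ z : ℝ × ℝ, ‖X z‖ = N z.1
  normSqA_eq : ∀ z : ℝ × ℝ, 0 < z.1 → normSqA X z = V z.1 / (e z.1 * g z.1)
  norm_boundary : ∀ θ, ‖deriv (boundaryCurve X) θ‖ = g 0
  curvature_conormal : ∀ θ, inner ℝ (curvatureVec X θ) (conormal X θ) * g 0 = β

/-- The density of the measure of `L²_*` on a rotationally symmetric face. -/
def starDensity (e g N : ℝ → ℝ) (t : ℝ) : ℝ :=
  e t * g t * ((1 + N t ^ 2)⁻¹ * (log (2 + N t) ^ 2)⁻¹)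

namespace IsRotFace

variable {X : ℝ × ℝ → E3} {e g N V : ℝ → ℝ} {β : ℝ}

lemma inv_firstForm (h : IsRotFace X e g N V β) {z : ℝ × ℝ} (hz : 0 < z.1) :
    (firstForm X z)⁻¹ = !![(e z.1 ^ 2)⁻¹, 0; 0, (g z.1 ^ 2)⁻¹] :=
  inv_firstForm_of_orthogonal (h.e_pos _ hz.le).ne' (h.g_pos _ hz.le).ne' (h.inner_dT z)
    (h.inner_dTheta z) (h.inner_dT_dTheta z)

lemma sqrt_det (h : IsRotFace X e g N V β) {z : ℝ × ℝ} (hz : 0 < z.1) :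
    √(firstForm X z).det = e z.1 * g z.1 := by
  have he := (h.e_pos _ hz.le)
  have hg := (h.g_pos _ hz.le)
  rw [firstForm, h.inner_dT, h.inner_dTheta, h.inner_dT_dTheta, real_inner_comm, h.inner_dT_dTheta,
    Matrix.det_fin_two_of, mul_zero, sub_zero, ← mul_pow, Real.sqrt_sq (by positivity)]

lemma inner_gradVec (h : IsRotFace X e g N V β) {z : ℝ × ℝ} (hz : 0 < z.1) (p q p' q' : ℝ) :
    inner ℝ (gradVec X z p q) (gradVec X z p' q') =
      (e z.1 ^ 2)⁻¹ * (p * p') + (g z.1 ^ 2)⁻¹ * (q * q') := by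
  have he := (h.e_pos _ hz.le).ne'
  have hg := (h.g_pos _ hz.le).ne'
  have h1 : inner ℝ (dTheta X z) (dT X z) = 0 := by rw [real_inner_comm, h.inner_dT_dTheta]
  simp only [gradVec, h.inv_firstForm hz, inner_add_left, inner_add_right, real_inner_smul_left,
    real_inner_smul_right, h.inner_dT, h.inner_dTheta, h.inner_dT_dTheta, h1]
  simp [Matrix.mulVec, dotProduct, Fin.sum_univ_two]
  field_simp

lemma areaMeasure_eq (h : IsRotFace X e g N V β) :
    areaMeasure X = stripMeasure.withDensity fun z => ENNReal.ofReal (e z.1 * g z.1) := by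
  refine withDensity_congr_ae ?_
  filter_upwards [ae_strip_pos] with z hz
  rw [h.sqrt_det hz]

lemma measurable_density (h : IsRotFace X e g N V β) :
    Measurable fun z : ℝ × ℝ => ENNReal.ofReal (e z.1 * g z.1) :=
  ((h.cont_e.comp continuous_fst).mul (h.cont_g.comp continuous_fst)).measurable.ennreal_ofReal

lemma integrable_area_iff (h : IsRotFace X e g N V β) {f : ℝ × ℝ → ℝ} :
    Integrable f (areaMeasure X) ↔ Integrable (fun z => e z.1 * g z.1 * f z) stripMeasure := by
  rw [h.areaMeasure_eq, integrable_withDensity_iff_integrable_smul' h.measurable_density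
    (ae_of_all _ fun z => ENNReal.ofReal_lt_top)]
  refine integrable_congr ?_
  filter_upwards [ae_strip_pos] with z hz
  have he := (h.e_pos _ hz.le)
  have hg := (h.g_pos _ hz.le)
  rw [ENNReal.toReal_ofReal (by positivity), smul_eq_mul]

lemma integral_area (h : IsRotFace X e g N V β) (f : ℝ × ℝ → ℝ) :
    ∫ z, f z ∂(areaMeasure X) = ∫ z, e z.1 * g z.1 * f z ∂stripMeasure := by
  rw [h.areaMeasure_eq, integral_withDensity_eq_integral_toReal_smul h.measurable_density
    (ae_of_all _ fun z => ENNReal.ofReal_lt_top)]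
  refine integral_congr_ae ?_
  filter_upwards [ae_strip_pos] with z hz
  have he := (h.e_pos _ hz.le)
  have hg := (h.g_pos _ hz.le)
  rw [ENNReal.toReal_ofReal (by positivity), smul_eq_mul]

lemma area_ac (X : ℝ × ℝ → E3) : areaMeasure X ≪ stripMeasure :=
  withDensity_absolutelyContinuous _ _

/-- The area density `e g` turns `e⁻²` and `g⁻²` into `g / e` and `e / g`, and turns `|A|² = V / (e
g)` into `V`. -/
lemma faceForm_eq (h : IsRotFace X e g N V β) (φ ψ : Jet) :
    faceForm X φ ψ = ∫ z, (g z.1 / e z.1 * (φ.pt z * ψ.pt z) +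
      (g z.1 / e z.1)⁻¹ * (φ.pθ z * ψ.pθ z) - V z.1 * (φ.val z * ψ.val z)) ∂stripMeasure := by
  rw [faceForm, h.integral_area]
  refine integral_congr_ae ?_
  filter_upwards [ae_strip_pos] with z hz
  have he := (h.e_pos _ hz.le).ne'
  have hg := (h.g_pos _ hz.le).ne'
  rw [grad, grad, h.inner_gradVec hz, h.normSqA_eq z hz]
  field_simp

lemma aestronglyMeasurable_grad (h : IsRotFace X e g N V β) (φ : Jet) :
    AEStronglyMeasurable (grad X φ) stripMeasure := by
  have h1 : AEStronglyMeasurable (fun z : ℝ × ℝ => ((e z.1 ^ 2)⁻¹ * φ.pt z) • dT X z +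
      ((g z.1 ^ 2)⁻¹ * φ.pθ z) • dTheta X z) stripMeasure := by
    have m1 : AEStronglyMeasurable (fun z : ℝ × ℝ => (e z.1 ^ 2)⁻¹) stripMeasure :=
      ((h.cont_e.comp continuous_fst).pow 2).measurable.inv.aestronglyMeasurable
    have m2 : AEStronglyMeasurable (fun z : ℝ × ℝ => (g z.1 ^ 2)⁻¹) stripMeasure :=
      ((h.cont_g.comp continuous_fst).pow 2).measurable.inv.aestronglyMeasurable
    exact ((m1.mul φ.pt.aestronglyMeasurable).smul h.cont_dT.aestronglyMeasurable).add
      ((m2.mul φ.pθ.aestronglyMeasurable).smul h.cont_dTheta.aestronglyMeasurable)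
  refine h1.congr ?_
  filter_upwards [ae_strip_pos] with z hz
  rw [grad, gradVec, h.inv_firstForm hz]
  simp [Matrix.mulVec, dotProduct, Fin.sum_univ_two]

lemma memLp_grad_iff (h : IsRotFace X e g N V β) (φ : Jet) :
    MemLp (grad X φ) 2 (areaMeasure X) ↔
      Integrable (fun z => g z.1 / e z.1 * φ.pt z ^ 2) stripMeasure ∧
      Integrable (fun z => (g z.1 / e z.1)⁻¹ * φ.pθ z ^ 2) stripMeasure := by
  rw [memLp_two_iff_integrable_sq_norm ((h.aestronglyMeasurable_grad φ).mono_ac (area_ac X)),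
    h.integrable_area_iff]
  have e1 : (fun z => e z.1 * g z.1 * ‖grad X φ z‖ ^ 2) =ᵐ[stripMeasure] fun z =>
      g z.1 / e z.1 * φ.pt z ^ 2 + (g z.1 / e z.1)⁻¹ * φ.pθ z ^ 2 := by
    filter_upwards [ae_strip_pos] with z hz
    have he := (h.e_pos _ hz.le).ne'
    have hg := (h.g_pos _ hz.le).ne'
    rw [← real_inner_self_eq_norm_sq, grad, h.inner_gradVec hz]
    field_simp
  rw [integrable_congr e1]
  have mw : AEStronglyMeasurable (fun z : ℝ × ℝ => g z.1 / e z.1) stripMeasure :=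
    ((h.cont_g.comp continuous_fst).measurable.div
      (h.cont_e.comp continuous_fst).measurable).aestronglyMeasurable
  have mw' : AEStronglyMeasurable (fun z : ℝ × ℝ => (g z.1 / e z.1)⁻¹) stripMeasure :=
    ((h.cont_g.comp continuous_fst).measurable.div
      (h.cont_e.comp continuous_fst).measurable).inv.aestronglyMeasurable
  refine ⟨fun hi => ⟨hi.mono' (mw.mul (φ.pt.aestronglyMeasurable.pow 2)) ?_,
    hi.mono' (mw'.mul (φ.pθ.aestronglyMeasurable.pow 2)) ?_⟩, fun hi => hi.1.add hi.2⟩ <;>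
  · filter_upwards [ae_strip_pos] with z hz
    have he := (h.e_pos _ hz.le)
    have hg := (h.g_pos _ hz.le)
    rw [norm_eq_abs, abs_of_nonneg (by positivity)]
    simp only [le_add_iff_nonneg_right, le_add_iff_nonneg_left]
    positivity

lemma memLp_area_iff (h : IsRotFace X e g N V β) (f : FaceFun) :
    MemLp f 2 (areaMeasure X) ↔ Integrable (fun z => e z.1 * g z.1 * f z ^ 2) stripMeasure := by
  rw [memLp_two_iff_integrable_sq (f.aestronglyMeasurable.mono_ac (area_ac X)),
    h.integrable_area_iff]

lemma memLp_star_iff (h : IsRotFace X e g N V β) (f : FaceFun) :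
    MemLp f 2 (starMeasure X) ↔
      Integrable (fun z => starDensity e g N z.1 * f z ^ 2) stripMeasure := by
  have hX : (fun z => ENNReal.ofReal ((1 + ‖X z‖ ^ 2)⁻¹ * (log (2 + ‖X z‖) ^ 2)⁻¹)) =
      fun z : ℝ × ℝ => ENNReal.ofReal ((1 + N z.1 ^ 2)⁻¹ * (log (2 + N z.1) ^ 2)⁻¹) := by
    funext z; rw [h.norm_eq]
  have hm : Measurable fun z : ℝ × ℝ =>
      ENNReal.ofReal ((1 + N z.1 ^ 2)⁻¹ * (log (2 + N z.1) ^ 2)⁻¹) := by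
    have := h.cont_N.measurable
    fun_prop
  have hac : starMeasure X ≪ stripMeasure :=
    (withDensity_absolutelyContinuous _ _).trans (area_ac X)
  rw [memLp_two_iff_integrable_sq (f.aestronglyMeasurable.mono_ac hac), starMeasure, hX,
    integrable_withDensity_iff_integrable_smul' hm (ae_of_all _ fun z => ENNReal.ofReal_lt_top),
    h.integrable_area_iff]
  refine integrable_congr (ae_of_all _ fun z => ?_)
  simp only
  rw [ENNReal.toReal_ofReal (by positivity), smul_eq_mul, starDensity]
  ring

lemma lengthMeasure_eq (h : IsRotFace X e g N V β) :
    lengthMeasure X = ENNReal.ofReal (g 0) • circleMeasure := by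
  rw [lengthMeasure]
  simp_rw [h.norm_boundary]
  rw [withDensity_const]

lemma memLp_length_iff (h : IsRotFace X e g N V β) (f : CircleFun) :
    MemLp f 2 (lengthMeasure X) ↔ MemLp f 2 circleMeasure := by
  have h0 := h.g_pos 0 le_rfl
  rw [h.lengthMeasure_eq]
  refine ⟨fun hf => ?_, fun hf => hf.smul_measure ENNReal.ofReal_ne_top⟩
  have := hf.smul_measure (c := ENNReal.ofReal (g 0)⁻¹) ENNReal.ofReal_ne_top
  rwa [smul_smul, ← ENNReal.ofReal_mul (by positivity), inv_mul_cancel₀ h0.ne', ENNReal.ofReal_one,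
    one_smul] at this

lemma boundaryForm_eq (h : IsRotFace X e g N V β) (φ ψ : Jet) :
    boundaryForm X φ ψ = β * ∫ θ, φ.trace θ * ψ.trace θ ∂circleMeasure := by
  have h0 := h.g_pos 0 le_rfl
  have e1 : ∀ θ, inner ℝ (curvatureVec X θ) (conormal X θ) = β / g 0 := fun θ => by
    rw [eq_div_iff h0.ne', h.curvature_conormal]
  rw [boundaryForm, h.lengthMeasure_eq, integral_smul_measure]
  simp_rw [e1]
  rw [integral_const_mul, ENNReal.toReal_ofReal h0.le, smul_eq_mul]
  field_simp

end IsRotFace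

/-- The description of a face of the pseudo Y-catenoid in the coordinates `(t, θ)`: the energy
weight `w`, the potential `V`, the densities `σ` of `L²_*` and `ρ` of the area measure, and the
boundary coefficient `β`. -/
structure IsFace (X : ℝ × ℝ → E3) (w V σ ρ : ℝ → ℝ) (β : ℝ) : Prop where
  cont_w : ContinuousOn w (Ici 0)
  cont_V : Continuous V
  cont_σ : Continuous σ
  cont_ρ : Continuous ρ
  one_le_w : ∀ t, 0 ≤ t → 1 ≤ w t
  V_nonneg : ∀ t, 0 ≤ V t
  σ_pos : ∀ t, 0 ≤ t → 0 < σ t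
  V_le : ∃ K, ∀ t, 0 ≤ t → V t ≤ K * σ t
  σ_le : ∃ K, ∀ t, 0 ≤ t → σ t ≤ K * ρ t
  int_σ : IntegrableOn σ (Ioi 0)
  faceForm_eq : ∀ φ ψ : Jet, faceForm X φ ψ = ∫ z, (w z.1 * (φ.pt z * ψ.pt z) +
    (w z.1)⁻¹ * (φ.pθ z * ψ.pθ z) - V z.1 * (φ.val z * ψ.val z)) ∂stripMeasure
  boundaryForm_eq : ∀ φ ψ : Jet, boundaryForm X φ ψ =
    β * ∫ θ, φ.trace θ * ψ.trace θ ∂circleMeasure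
  finiteEnergy_iff : ∀ φ : Jet, FiniteEnergy X φ ↔ HasWeakGradTrace φ ∧
    Integrable (fun z => w z.1 * φ.pt z ^ 2) stripMeasure ∧
    Integrable (fun z => (w z.1)⁻¹ * φ.pθ z ^ 2) stripMeasure ∧ MemLp φ.trace 2 circleMeasure
  memLp_star_iff : ∀ f : FaceFun, MemLp f 2 (starMeasure X) ↔
    Integrable (fun z => σ z.1 * f z ^ 2) stripMeasure
  memLp_area_iff : ∀ f : FaceFun, MemLp f 2 (areaMeasure X) ↔
    Integrable (fun z => ρ z.1 * f z ^ 2) stripMeasure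

/-- The passage from geometry to analysis: only the quotient `g / e` and the densities survive. -/
lemma IsRotFace.isFace {X : ℝ × ℝ → E3} {e g N V w : ℝ → ℝ} {β : ℝ} (h : IsRotFace X e g N V β)
    (hw : ∀ t, 0 ≤ t → g t / e t = w t) (hw1 : ∀ t, 0 ≤ t → 1 ≤ w t)
    (hV : ∀ t, 0 ≤ V t)
    (hVσ : ∃ K, ∀ t, 0 ≤ t → V t ≤ K * starDensity e g N t)
    (hint : IntegrableOn (starDensity e g N) (Ioi 0)) :
    IsFace X w V (starDensity e g N) (fun t => e t * g t) β := by
  have hwe : ∀ᵐ z ∂stripMeasure, g z.1 / e z.1 = w z.1 := by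
    filter_upwards [ae_strip_pos] with z hz using hw _ hz.le
  have hlog : ∀ t, log 2 ≤ log (2 + N t) := fun t =>
    Real.log_le_log (by norm_num) (by linarith [h.N_nonneg t])
  have hl2 : 0 < log 2 := Real.log_pos (by norm_num)
  have hlog0 : ∀ t, 0 < log (2 + N t) := fun t => hl2.trans_le (hlog t)
  refine ⟨?_, h.cont_V, ?_, h.cont_e.mul h.cont_g, hw1, hV, ?_, hVσ, ?_, hint, ?_,
    h.boundaryForm_eq, ?_, h.memLp_star_iff, h.memLp_area_iff⟩
  · refine ContinuousOn.congr (f := fun t => g t / e t) ?_ fun t ht => (hw t ht).symm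
    exact h.cont_g.continuousOn.div h.cont_e.continuousOn fun t ht => (h.e_pos t ht).ne'
  · refine (h.cont_e.mul h.cont_g).mul (.mul ?_ ?_)
    · exact (continuous_const.add (h.cont_N.pow 2)).inv₀ fun t =>
        (by positivity : (1:ℝ) + N t ^ 2 ≠ 0)
    · refine ((continuous_const.add h.cont_N).log fun t => ?_).pow 2 |>.inv₀ fun t => ?_
      · exact (by linarith [h.N_nonneg t] : (0:ℝ) < 2 + N t).ne'
      · exact (pow_pos (hlog0 t) 2).ne'
  · intro t ht
    have := h.e_pos t ht
    have := h.g_pos t ht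
    have := hlog0 t
    unfold starDensity; positivity
  -- The weight is largest at distance zero, where it equals `(log 2)⁻²`.
  · refine ⟨(log 2 ^ 2)⁻¹, fun t ht => ?_⟩
    have h1 := h.e_pos t ht
    have h2 := h.g_pos t ht
    rw [starDensity, mul_comm (log 2 ^ 2)⁻¹]
    refine mul_le_mul_of_nonneg_left ?_ (by positivity)
    calc _ ≤ 1 * (log 2 ^ 2)⁻¹ := by
          gcongr
          · exact inv_le_one_of_one_le₀ (by nlinarith [sq_nonneg (N t)])
          · linarith [h.N_nonneg t]
      _ = _ := one_mul _
  · intro φ ψ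
    rw [h.faceForm_eq]
    refine integral_congr_ae ?_
    filter_upwards [hwe] with z hz
    rw [hz]
  · intro φ
    have c1 : (fun z : ℝ × ℝ => g z.1 / e z.1 * φ.pt z ^ 2) =ᵐ[stripMeasure]
        fun z => w z.1 * φ.pt z ^ 2 := by
      filter_upwards [hwe] with z hz; rw [hz]
    have c2 : (fun z : ℝ × ℝ => (g z.1 / e z.1)⁻¹ * φ.pθ z ^ 2) =ᵐ[stripMeasure]
        fun z => (w z.1)⁻¹ * φ.pθ z ^ 2 := by
      filter_upwards [hwe] with z hz; rw [hz]
    rw [FiniteEnergy, h.memLp_grad_iff, h.memLp_length_iff, integrable_congr c1,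
      integrable_congr c2]
    tauto

/-! ## Surfaces of revolution -/

/-- The surface of revolution with profile curve `(r, h)`. -/
def revolution (r h : ℝ → ℝ) (z : ℝ × ℝ) : E3 := !₂[r z.1 * cos z.2, r z.1 * sin z.2, h z.1]

lemma fderiv_vec3 {f₀ f₁ f₂ : ℝ × ℝ → ℝ} {z : ℝ × ℝ} (h₀ : DifferentiableAt ℝ f₀ z)
    (h₁ : DifferentiableAt ℝ f₁ z) (h₂ : DifferentiableAt ℝ f₂ z) (v : ℝ × ℝ) :
    fderiv ℝ (fun z => (!₂[f₀ z, f₁ z, f₂ z] : E3)) z v =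
      !₂[fderiv ℝ f₀ z v, fderiv ℝ f₁ z v, fderiv ℝ f₂ z v] := by
  have hd : DifferentiableAt ℝ (fun z => (!₂[f₀ z, f₁ z, f₂ z] : E3)) z := by
    rw [differentiableAt_euclidean]
    intro i
    fin_cases i
    · exact h₀
    · exact h₁
    · exact h₂
  have key : ∀ i, (fderiv ℝ (fun z => (!₂[f₀ z, f₁ z, f₂ z] : E3)) z v) i =
      fderiv ℝ (fun z => (!₂[f₀ z, f₁ z, f₂ z] : E3) i) z v := by
    intro i
    have := ((EuclideanSpace.proj i : E3 →L[ℝ] ℝ).hasFDerivAt.comp z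
      hd.hasFDerivAt).fderiv
    simp only [Function.comp_def, EuclideanSpace.coe_proj] at this
    rw [this]
    rfl
  ext i
  rw [key]
  fin_cases i <;> rfl

lemma differentiableAt_prod {a b : ℝ → ℝ} {z : ℝ × ℝ} {a' b' : ℝ} (ha : HasDerivAt a a' z.1)
    (hb : HasDerivAt b b' z.2) : DifferentiableAt ℝ (fun z : ℝ × ℝ => a z.1 * b z.2) z ∧
    fderiv ℝ (fun z : ℝ × ℝ => a z.1 * b z.2) z (1, 0) = a' * b z.2 ∧
    fderiv ℝ (fun z : ℝ × ℝ => a z.1 * b z.2) z (0, 1) = a z.1 * b' := by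
  have h1 : HasFDerivAt (fun z : ℝ × ℝ => a z.1) _ z := ha.hasFDerivAt.comp z hasFDerivAt_fst
  have h2 : HasFDerivAt (fun z : ℝ × ℝ => b z.2) _ z := hb.hasFDerivAt.comp z hasFDerivAt_snd
  have h3 := h1.fun_mul h2
  refine ⟨h3.differentiableAt, ?_, ?_⟩ <;> rw [h3.fderiv] <;> simp [mul_comm]

/-- Vectors with entries `a(t) b(θ)` are stable under both derivatives, so the second derivatives
come from the same rule. -/
lemma dT_vec3 {a₀ a₁ a₂ b₀ b₁ b₂ a₀' a₁' a₂' b₀' b₁' b₂' : ℝ → ℝ}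
    (h₀ : ∀ t, HasDerivAt a₀ (a₀' t) t) (h₁ : ∀ t, HasDerivAt a₁ (a₁' t) t)
    (h₂ : ∀ t, HasDerivAt a₂ (a₂' t) t) (k₀ : ∀ t, HasDerivAt b₀ (b₀' t) t)
    (k₁ : ∀ t, HasDerivAt b₁ (b₁' t) t) (k₂ : ∀ t, HasDerivAt b₂ (b₂' t) t) :
    (dT fun z => !₂[a₀ z.1 * b₀ z.2, a₁ z.1 * b₁ z.2, a₂ z.1 * b₂ z.2]) =
      (fun z => !₂[a₀' z.1 * b₀ z.2, a₁' z.1 * b₁ z.2, a₂' z.1 * b₂ z.2]) ∧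
    (dTheta fun z => !₂[a₀ z.1 * b₀ z.2, a₁ z.1 * b₁ z.2, a₂ z.1 * b₂ z.2]) =
      (fun z => !₂[a₀ z.1 * b₀' z.2, a₁ z.1 * b₁' z.2, a₂ z.1 * b₂' z.2]) := by
  constructor <;>
  · funext z
    obtain ⟨d₀, e₀, g₀⟩ := differentiableAt_prod (z := z) (h₀ z.1) (k₀ z.2)
    obtain ⟨d₁, e₁, g₁⟩ := differentiableAt_prod (z := z) (h₁ z.1) (k₁ z.2)
    obtain ⟨d₂, e₂, g₂⟩ := differentiableAt_prod (z := z) (h₂ z.1) (k₂ z.2)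
    simp only [dT, dTheta]
    rw [fderiv_vec3 d₀ d₁ d₂]
    simp only [e₀, e₁, e₂, g₀, g₁, g₂]

lemma inner_vec3 (a b c a' b' c' : ℝ) :
    inner ℝ (!₂[a, b, c] : E3) (!₂[a', b', c'] : E3) = a * a' + b * b' + c * c' := by
  rw [PiLp.inner_apply, Fin.sum_univ_three]
  simp
  ring

lemma hasDerivAt_vec3 {f₀ f₁ f₂ : ℝ → ℝ} {a b c t : ℝ} (h₀ : HasDerivAt f₀ a t)
    (h₁ : HasDerivAt f₁ b t) (h₂ : HasDerivAt f₂ c t) :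
    HasDerivAt (fun t => (!₂[f₀ t, f₁ t, f₂ t] : E3)) !₂[a, b, c] t := by
  have h : HasDerivAt (fun t => ![f₀ t, f₁ t, f₂ t]) ![a, b, c] t := by
    rw [hasDerivAt_pi]
    intro i
    fin_cases i
    · exact h₀
    · exact h₁
    · exact h₂
  exact (PiLp.continuousLinearEquiv 2 ℝ (fun _ : Fin 3 => ℝ)).symm.hasFDerivAt.comp_hasDerivAt t h

lemma smul_vec3 (k a b c : ℝ) : k • (!₂[a, b, c] : E3) = !₂[k * a, k * b, k * c] := by
  ext i; fin_cases i <;> rfl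

lemma sub_vec3 (a b c a' b' c' : ℝ) :
    (!₂[a, b, c] : E3) - !₂[a', b', c'] = !₂[a - a', b - b', c - c'] := by
  ext i; fin_cases i <;> rfl

lemma norm_sq_vec3 (a b c : ℝ) : ‖(!₂[a, b, c] : E3)‖ ^ 2 = a ^ 2 + b ^ 2 + c ^ 2 := by
  rw [← real_inner_self_eq_norm_sq, inner_vec3]; ring

lemma norm_vec3 {a b c k : ℝ} (hk : 0 ≤ k) (h : a ^ 2 + b ^ 2 + c ^ 2 = k ^ 2) :
    ‖(!₂[a, b, c] : E3)‖ = k := by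
  rw [← abs_of_nonneg hk, ← abs_norm, ← sq_eq_sq_iff_abs_eq_abs, norm_sq_vec3, h]

lemma continuous_vec3 {α : Type*} [TopologicalSpace α] {f₀ f₁ f₂ : α → ℝ} (h₀ : Continuous f₀)
    (h₁ : Continuous f₁) (h₂ : Continuous f₂) :
    Continuous fun z => (!₂[f₀ z, f₁ z, f₂ z] : E3) := by
  refine (PiLp.continuous_toLp 2 _).comp (continuous_pi fun i => ?_)
  fin_cases i
  · exact h₀
  · exact h₁
  · exact h₂

section Revolution

variable {r r' r'' h h' h'' : ℝ → ℝ}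

lemma revolution_eq (r h : ℝ → ℝ) : revolution r h =
    fun z => !₂[r z.1 * cos z.2, r z.1 * sin z.2, h z.1 * (fun _ => 1) z.2] := by
  funext z; simp [revolution]

lemma dT_revolution (hr : ∀ t, HasDerivAt r (r' t) t) (hh : ∀ t, HasDerivAt h (h' t) t) :
    dT (revolution r h) = revolution r' h' := by
  rw [revolution_eq, (dT_vec3 hr hr hh Real.hasDerivAt_cos Real.hasDerivAt_sin
    fun t => hasDerivAt_const t (1:ℝ)).1, revolution_eq]

lemma dTheta_revolution (hr : ∀ t, HasDerivAt r (r' t) t) (hh : ∀ t, HasDerivAt h (h' t) t) :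
    dTheta (revolution r h) = fun z => !₂[r z.1 * -sin z.2, r z.1 * cos z.2, 0] := by
  rw [revolution_eq, (dT_vec3 hr hr hh Real.hasDerivAt_cos Real.hasDerivAt_sin
    fun t => hasDerivAt_const t (1:ℝ)).2]
  simp

lemma dT_dTheta_revolution (hr : ∀ t, HasDerivAt r (r' t) t) (hh : ∀ t, HasDerivAt h (h' t) t) :
    dT (dTheta (revolution r h)) = fun z => !₂[r' z.1 * -sin z.2, r' z.1 * cos z.2, 0] := by
  have := (dT_vec3 hr hr hr (fun t => (Real.hasDerivAt_sin t).neg) Real.hasDerivAt_cos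
    fun t => hasDerivAt_const t (0:ℝ)).1
  rw [dTheta_revolution hr hh]
  simpa using this

lemma dTheta_dTheta_revolution (hr : ∀ t, HasDerivAt r (r' t) t)
    (hh : ∀ t, HasDerivAt h (h' t) t) :
    dTheta (dTheta (revolution r h)) = fun z => !₂[r z.1 * -cos z.2, r z.1 * -sin z.2, 0] := by
  have := (dT_vec3 hr hr hr (fun t => (Real.hasDerivAt_sin t).neg) Real.hasDerivAt_cos
    fun t => hasDerivAt_const t (0:ℝ)).2
  rw [dTheta_revolution hr hh]
  simpa using this

/-- The hypothesis `hV` is the sum of the squares of the meridian and parallel curvatures. At the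
boundary `H` points to the axis with length `1 / r`, and the radial part of `ν` is `-r' / e`; this
explains `β = r'(0) / e(0)`. -/
lemma isRotFace_revolution {e V : ℝ → ℝ} {β : ℝ} (hr : ∀ t, HasDerivAt r (r' t) t)
    (hr' : ∀ t, HasDerivAt r' (r'' t) t) (hh : ∀ t, HasDerivAt h (h' t) t)
    (hh' : ∀ t, HasDerivAt h' (h'' t) t) (ce : Continuous e) (cV : Continuous V)
    (he : ∀ t, e t ^ 2 = r' t ^ 2 + h' t ^ 2) (epos : ∀ t, 0 ≤ t → 0 < e t)
    (rpos : ∀ t, 0 ≤ t → 0 < r t)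
    (hV : ∀ t, 0 < t → ((r' t * h'' t - r'' t * h' t) / e t ^ 3) ^ 2 + (h' t / (e t * r t)) ^ 2 =
      V t / (e t * r t)) (hβ : r' 0 / e 0 = β) :
    IsRotFace (revolution r h) e r (fun t => √(r t ^ 2 + h t ^ 2)) V β := by
  have cr : Continuous r := continuous_iff_continuousAt.2 fun t => (hr t).continuousAt
  have ch : Continuous h := continuous_iff_continuousAt.2 fun t => (hh t).continuousAt
  have cr' : Continuous r' := continuous_iff_continuousAt.2 fun t => (hr' t).continuousAt
  have ch' : Continuous h' := continuous_iff_continuousAt.2 fun t => (hh' t).continuousAt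
  have sc : ∀ θ, sin θ ^ 2 + cos θ ^ 2 = 1 := Real.sin_sq_add_cos_sq
  have bd : deriv (boundaryCurve (revolution r h)) =
      fun θ => !₂[r 0 * -sin θ, r 0 * cos θ, 0] := by
    funext θ
    exact (hasDerivAt_vec3 ((Real.hasDerivAt_cos θ).const_mul (r 0))
      ((Real.hasDerivAt_sin θ).const_mul (r 0)) (hasDerivAt_const θ (h 0))).deriv
  have bd2 : ∀ θ, deriv (deriv (boundaryCurve (revolution r h))) θ =
      !₂[r 0 * -cos θ, r 0 * -sin θ, 0] := by
    intro θ
    rw [bd]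
    exact (hasDerivAt_vec3 ((Real.hasDerivAt_sin θ).neg.const_mul (r 0))
      ((Real.hasDerivAt_cos θ).const_mul (r 0)) (hasDerivAt_const θ (0 : ℝ))).deriv
  have nb : ∀ θ, ‖deriv (boundaryCurve (revolution r h)) θ‖ = r 0 := by
    intro θ
    rw [bd]
    exact norm_vec3 (rpos 0 le_rfl).le (by linear_combination r 0 ^ 2 * sc θ)
  refine
  { cont_e := ce
    cont_g := cr
    cont_N := by fun_prop
    cont_V := cV
    e_pos := epos
    g_pos := rpos
    N_nonneg := fun t => Real.sqrt_nonneg _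
    cont_dT := ?_
    cont_dTheta := ?_
    inner_dT := fun z => ?_
    inner_dTheta := fun z => ?_
    inner_dT_dTheta := fun z => ?_
    norm_eq := fun z => ?_
    normSqA_eq := fun z hz => ?_
    norm_boundary := nb
    curvature_conormal := fun θ => ?_ }
  · rw [dT_revolution hr hh]
    exact continuous_vec3 (by fun_prop) (by fun_prop) (by fun_prop)
  · rw [dTheta_revolution hr hh]
    exact continuous_vec3 (by fun_prop) (by fun_prop) (by fun_prop)
  · rw [dT_revolution hr hh, revolution, inner_vec3, he]
    linear_combination r' z.1 ^ 2 * sc z.2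
  · rw [dTheta_revolution hr hh, inner_vec3]
    linear_combination r z.1 ^ 2 * sc z.2
  · rw [dTheta_revolution hr hh, dT_revolution hr hh, revolution, inner_vec3]
    ring
  · rw [norm_eq_sqrt_real_inner, revolution, inner_vec3]
    congr 1
    linear_combination r z.1 ^ 2 * sc z.2
  · have e0 := epos z.1 hz.le
    have r0 := rpos z.1 hz.le
    have hm : ∀ m : E3, m = WithLp.toLp 2 (crossProduct (WithLp.ofLp (dT (revolution r h) z))
        (WithLp.ofLp (dTheta (revolution r h) z))) →
        m = !₂[-(r z.1 * h' z.1 * cos z.2), -(r z.1 * h' z.1 * sin z.2), r z.1 * r' z.1] := by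
      rintro m rfl
      rw [dTheta_revolution hr hh, dT_revolution hr hh, revolution, cross_apply]
      ext i
      fin_cases i
      · simp; ring
      · simp; ring
      · simp; linear_combination r z.1 * r' z.1 * sc z.2
    have hn : unitNormal (revolution r h) z = (r z.1 * e z.1)⁻¹ •
        !₂[-(r z.1 * h' z.1 * cos z.2), -(r z.1 * h' z.1 * sin z.2), r z.1 * r' z.1] := by
      have hnorm : ‖(!₂[-(r z.1 * h' z.1 * cos z.2), -(r z.1 * h' z.1 * sin z.2),
          r z.1 * r' z.1] : E3)‖ = r z.1 * e z.1 := by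
        refine norm_vec3 (mul_pos r0 e0).le ?_
        linear_combination r z.1 ^ 2 * h' z.1 ^ 2 * sc z.2 - r z.1 ^ 2 * he z.1
      simp only [unitNormal]
      rw [hm _ rfl, hnorm]
    have hII : secondForm (revolution r h) z =
        !![(r' z.1 * h'' z.1 - r'' z.1 * h' z.1) / e z.1, 0; 0, r z.1 * h' z.1 / e z.1] := by
      rw [secondForm, hn, dT_revolution hr hh, dT_revolution hr' hh',
        ← dT_revolution hr hh, dT_dTheta_revolution hr hh, dTheta_dTheta_revolution hr hh,
        dT_revolution hr hh, dTheta_revolution hr' hh']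
      simp only [real_inner_smul_right, revolution, inner_vec3]
      have e1 : (r z.1 * e z.1)⁻¹ * (r z.1 * r z.1 * h' z.1) = r z.1 * h' z.1 / e z.1 := by
        field_simp
      have e2 : (r z.1 * e z.1)⁻¹ * (r z.1 * (r' z.1 * h'' z.1 - r'' z.1 * h' z.1)) =
          (r' z.1 * h'' z.1 - r'' z.1 * h' z.1) / e z.1 := by
        field_simp
      rw [← e1, ← e2]
      ext i j
      fin_cases i <;> fin_cases j
      · simp; left; linear_combination -r z.1 * h' z.1 * r'' z.1 * sc z.2
      · simp; right; ring
      · simp; right; ring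
      · simp; left; linear_combination r z.1 * r z.1 * h' z.1 * sc z.2
    have hI : (firstForm (revolution r h) z)⁻¹ = !![(e z.1 ^ 2)⁻¹, 0; 0, (r z.1 ^ 2)⁻¹] := by
      refine inv_firstForm_of_orthogonal e0.ne' r0.ne' ?_ ?_ ?_
      · rw [dT_revolution hr hh, revolution, inner_vec3, he]
        linear_combination r' z.1 ^ 2 * sc z.2
      · rw [dTheta_revolution hr hh, inner_vec3]
        linear_combination r z.1 ^ 2 * sc z.2
      · rw [dTheta_revolution hr hh, dT_revolution hr hh, revolution, inner_vec3]
        ring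
    rw [normSqA, hII, hI, ← hV z.1 hz]
    simp [Matrix.trace, Fin.sum_univ_two]
    field_simp
  · have e0 := epos 0 le_rfl
    have r0 := rpos 0 le_rfl
    have hx : inner ℝ (dT (revolution r h) (0, θ)) (dTheta (revolution r h) (0, θ)) = 0 := by
      rw [dTheta_revolution hr hh, dT_revolution hr hh, revolution, inner_vec3]; ring
    have hH : curvatureVec (revolution r h) θ = !₂[-cos θ / r 0, -sin θ / r 0, 0] := by
      simp only [curvatureVec]
      rw [nb, bd2, bd, inner_vec3, smul_vec3, sub_vec3, smul_vec3]
      congr 1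
      ext i
      fin_cases i
      · simp; field_simp; ring
      · simp; field_simp; ring
      · simp
    have hν : conormal (revolution r h) θ =
        !₂[-(r' 0 * cos θ) / e 0, -(r' 0 * sin θ) / e 0, -h' 0 / e 0] := by
      simp only [conormal]
      rw [hx, zero_div, zero_smul, zero_sub, norm_neg, dT_revolution hr hh, revolution,
        norm_vec3 e0.le (by simp only; rw [he]; linear_combination r' 0 ^ 2 * sc θ), smul_neg,
        smul_vec3, ← neg_one_smul ℝ, smul_vec3]
      congr 1
      ext i
      fin_cases i
      · simp; field_simp
      · simp; field_simp
      · simp; field_simp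
    rw [hH, hν, inner_vec3, ← hβ]
    field_simp
    linear_combination r' 0 * sc θ

end Revolution

/-! ### The faces of the pseudo Y-catenoid -/

/-- Integrability of a density dominated by the derivative of `-1 / log (2 + f)`. -/
lemma integrableOn_of_le_log {σ f f' : ℝ → ℝ} (hf : ∀ t, HasDerivAt f (f' t) t)
    (h0 : ∀ t, 0 ≤ t → 0 ≤ f t) (h1 : ∀ t, 0 ≤ t → 0 ≤ f' t) (hlim : Tendsto f atTop atTop)
    (hσ : AEStronglyMeasurable σ (volume.restrict (Ioi 0))) {K : ℝ}
    (hK : ∀ t, 0 < t → |σ t| ≤ K * (f' t / (2 + f t) / log (2 + f t) ^ 2)) :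
    IntegrableOn σ (Ioi 0) := by
  have hl : ∀ t, 0 ≤ t → 0 < log (2 + f t) := fun t ht =>
    Real.log_pos (by linarith [h0 t ht])
  have hd : ∀ t, 0 ≤ t →
      HasDerivAt (fun t => -(log (2 + f t))⁻¹) (f' t / (2 + f t) / log (2 + f t) ^ 2) t := by
    intro t ht
    have := ((((hf t).const_add 2).log (by linarith [h0 t ht])).inv (hl t ht).ne').neg
    convert! this using 1
    ring
  have hg : IntegrableOn (fun t => f' t / (2 + f t) / log (2 + f t) ^ 2) (Ioi 0) := by
    refine integrableOn_Ioi_deriv_of_nonneg (l := -0) (hd 0 le_rfl).continuousAt.continuousWithinAt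
      (fun t ht => hd t (le_of_lt ht)) (fun t ht => ?_) ?_
    · have := h0 t (le_of_lt ht)
      have := h1 t (le_of_lt ht)
      positivity
    · exact (tendsto_inv_atTop_zero.comp (Real.tendsto_log_atTop.comp
        (tendsto_atTop_add_const_left _ 2 hlim))).neg
  refine (hg.const_mul K).mono' hσ ?_
  filter_upwards [ae_restrict_mem measurableSet_Ioi] with t ht using hK t ht

/-- The `L²_*` density of the planar face. -/
def planeDensity (c : ℝ) : ℝ → ℝ :=
  starDensity (fun _ => c) (fun t => c * rad t) fun t => √((c * rad t) ^ 2 + (0:ℝ) ^ 2)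

/-- The `L²_*` density of the catenoidal faces. -/
def catenoidDensity (c κ : ℝ) : ℝ → ℝ :=
  starDensity (fun t => c * cosh (t - log √3)) (fun t => c * cosh (t - log √3))
    fun t => √((c * cosh (t - log √3)) ^ 2 + (c * (κ * t)) ^ 2)

/-- The boundary coefficient is the slope of the radius in arc length, which is one on a plane; the
potential vanishes because the plane is flat. -/
lemma isFace_planeFace {c : ℝ} (hc : 0 < c) :
    IsFace (planeFace c) rad (fun _ => 0) (planeDensity c) (fun t => c * (c * rad t)) 1 := by
  have hX : planeFace c = revolution (fun t => c * rad t) fun _ => 0 := by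
    funext z
    simp only [planeFace, revolution, rad]
    congr 1
    ext i
    fin_cases i
    · simp; ring
    · simp; ring
    · simp
  have hr : ∀ t, HasDerivAt (fun t => c * rad t) c t := fun t => by
    simpa using (hasDerivAt_rad t).const_mul c
  have h := isRotFace_revolution (e := fun _ => c) (V := fun _ => 0) (β := 1)
    (r := fun t => c * rad t) (r' := fun _ => c) (r'' := fun _ => 0) (h := fun _ => 0)
    (h' := fun _ => 0) (h'' := fun _ => 0) hr (fun t => hasDerivAt_const t c)
    (fun t => hasDerivAt_const t 0) (fun t => hasDerivAt_const t 0) continuous_const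
    continuous_const (fun t => by ring) (fun t _ => hc) (fun t ht => mul_pos hc (rad_pos ht))
    (fun t _ => by simp) (div_self hc.ne')
  rw [← hX] at h
  refine h.isFace (fun t _ => by field_simp) (fun t => one_le_rad) (fun _ => le_rfl)
    ⟨0, fun t _ => by simp⟩ ?_
  have hN : ∀ t, 0 ≤ t → √((c * rad t) ^ 2 + (0:ℝ) ^ 2) = c * rad t := fun t ht => by
    rw [zero_pow two_ne_zero, add_zero, Real.sqrt_sq (mul_pos hc (rad_pos ht)).le]
  -- The comparison function is the radius `x = c · rad` itself; `K = 2` works because `2 (1 + x²) -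
  -- x (2 + x) = (x - 1)² + 1`.
  refine integrableOn_of_le_log (K := 2) hr (fun t ht => (mul_pos hc (rad_pos ht)).le)
    (fun _ _ => hc.le) ?_ ?_ fun t ht => ?_
  · exact (tendsto_atTop_add_const_right _ _ tendsto_id).const_mul_atTop hc
  · have : Measurable rad := continuous_rad.measurable
    unfold starDensity
    exact Measurable.aestronglyMeasurable (by fun_prop)
  · have hr0 := mul_pos hc (rad_pos ht.le)
    simp only [starDensity]
    rw [hN t ht.le]
    set x := c * rad t
    have hl : 0 < log (2 + x) := Real.log_pos (by linarith)
    rw [abs_of_pos (by positivity)]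
    have e1 : c * x * ((1 + x ^ 2)⁻¹ * (log (2 + x) ^ 2)⁻¹) =
        c * x / (1 + x ^ 2) / log (2 + x) ^ 2 := by field_simp
    rw [e1, ← mul_div_assoc]
    refine div_le_div_of_nonneg_right ?_ (by positivity)
    rw [← mul_div_assoc, div_le_div_iff₀ (by positivity) (by positivity)]
    nlinarith [mul_nonneg hc.le (sq_nonneg (x - 1))]

/-- The parametrization is conformal, so `w = 1`. The principal curvatures are `± 1 / (c cosh²)` and
the area density is `c² cosh²`, so `V = 2 / cosh²`; the slope at the boundary is `tanh (-log √3) =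
-1/2`. -/
lemma isFace_catenoidFace {c κ : ℝ} (hc : 0 < c) (hκ : κ ^ 2 = 1) :
    IsFace (catenoidFace c κ) (fun _ => 1) (fun t => 2 * sch t ^ 2) (catenoidDensity c κ)
      (fun t => c * cosh (t - log √3) * (c * cosh (t - log √3))) (-1 / 2) := by
  have hX : catenoidFace c κ =
      revolution (fun t => c * cosh (t - log √3)) fun t => c * (κ * t) := by
    funext z
    simp only [catenoidFace, revolution]
    congr 1
    ext i
    fin_cases i
    · simp; ring
    · simp; ring
    · simp
  have ch : ∀ t, 0 < cosh (t - log √3) := fun t => Real.cosh_pos _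
  have csq : ∀ t, cosh (t - log √3) ^ 2 = sinh (t - log √3) ^ 2 + 1 := fun t => Real.cosh_sq _
  have hr : ∀ t, HasDerivAt (fun t => c * cosh (t - log √3)) (c * sinh (t - log √3)) t :=
      fun t => by
    simpa using (((hasDerivAt_id t).sub_const (log √3)).cosh).const_mul c
  have hr' : ∀ t, HasDerivAt (fun t => c * sinh (t - log √3)) (c * cosh (t - log √3)) t :=
      fun t => by
    simpa using (((hasDerivAt_id t).sub_const (log √3)).sinh).const_mul c
  have h := isRotFace_revolution (e := fun t => c * cosh (t - log √3))
    (V := fun t => 2 * sch t ^ 2) (β := -1 / 2)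
    (r := fun t => c * cosh (t - log √3)) (r' := fun t => c * sinh (t - log √3))
    (r'' := fun t => c * cosh (t - log √3)) (h := fun t => c * (κ * t))
    (h' := fun _ => c * κ) (h'' := fun _ => 0) hr hr'
    (fun t => by simpa using ((hasDerivAt_id t).const_mul κ).const_mul c)
    (fun t => hasDerivAt_const t _) (by fun_prop) (by fun_prop)
    (fun t => by linear_combination c ^ 2 * csq t - c ^ 2 * hκ) (fun t _ => mul_pos hc (ch t))
    (fun t _ => mul_pos hc (ch t))
    (fun t _ => by
      have := (ch t).ne'
      rw [sch]
      field_simp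
      linear_combination 2 * c ^ 2 * cosh (t - log √3) ^ 2 * hκ)
    (by
      rw [zero_sub, Real.sinh_neg, Real.cosh_neg, cosh_log_sqrt_three, sinh_log_sqrt_three]
      have : √3 ≠ 0 := by positivity
      field_simp)
  rw [← hX] at h
  have hN1 : ∀ t, c * cosh (t - log √3) ≤ √((c * cosh (t - log √3)) ^ 2 + (c * (κ * t)) ^ 2) :=
    fun t => Real.le_sqrt_of_sq_le (by nlinarith [sq_nonneg (c * (κ * t))])
  refine h.isFace (fun t _ => div_self (mul_pos hc (ch t)).ne') (fun t _ => le_rfl)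
    (fun t => by positivity) ?_ ?_
  -- The constant `B` gives `1 + N² ≤ B cosh²`, using `t ≤ (1 + log √3) cosh`. With `log (2 + N) ≤ 1
  -- + N`, the density decays at most like `1 / cosh²`, which is the size of the potential.
  · set B := 1 + c ^ 2 * (1 + (1 + log √3) ^ 2)
    refine ⟨4 * B ^ 2 / c ^ 2, fun t ht => ?_⟩
    simp only [starDensity]
    set N := √((c * cosh (t - log √3)) ^ 2 + (c * (κ * t)) ^ 2)
    have hN0 : 0 ≤ N := Real.sqrt_nonneg _
    have hN2 : N ^ 2 = (c * cosh (t - log √3)) ^ 2 + (c * (κ * t)) ^ 2 :=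
      Real.sq_sqrt (by positivity)
    have hl0 : 0 < log (2 + N) := Real.log_pos (by linarith)
    have hl : log (2 + N) ≤ 1 + N := by
      have := Real.log_le_sub_one_of_pos (by linarith : 0 < 2 + N); linarith
    have hT := log_sqrt_three_pos
    have h1 := Real.one_le_cosh (t - log √3)
    have ht2 : t ≤ (1 + log √3) * cosh (t - log √3) := by
      have : t - log √3 ≤ cosh (t - log √3) := by
        rcases le_total (t - log √3) 0 with h | h
        · linarith
        · exact (Real.self_le_sinh_iff.2 h).trans (Real.sinh_lt_cosh _).le
      nlinarith
    set C := cosh (t - log √3)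
    have hC := ch t
    have hB : 1 + N ^ 2 ≤ B * C ^ 2 := by
      have e1 : (c * (κ * t)) ^ 2 = c ^ 2 * t ^ 2 := by linear_combination c ^ 2 * t ^ 2 * hκ
      have e2 : t ^ 2 ≤ ((1 + log √3) * C) ^ 2 := by gcongr
      have e3 : c ^ 2 * t ^ 2 ≤ c ^ 2 * ((1 + log √3) * C) ^ 2 := by gcongr
      have e4 : 1 ≤ C ^ 2 := by nlinarith
      rw [hN2, e1]
      simp only [B]
      nlinarith
    have hB0 : 0 < B := by positivity
    have h2 : (1 + N ^ 2) * log (2 + N) ^ 2 ≤ 2 * (B * C ^ 2) ^ 2 := by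
      have e1 : log (2 + N) ^ 2 ≤ (1 + N) ^ 2 := by gcongr
      have e2 : (1 + N) ^ 2 ≤ 2 * (1 + N ^ 2) := by nlinarith [sq_nonneg (N - 1)]
      calc _ ≤ (1 + N ^ 2) * (2 * (1 + N ^ 2)) := by gcongr; linarith
        _ = 2 * (1 + N ^ 2) ^ 2 := by ring
        _ ≤ _ := by gcongr
    have e : 4 * B ^ 2 / c ^ 2 * (c * C * (c * C) * ((1 + N ^ 2)⁻¹ * (log (2 + N) ^ 2)⁻¹)) =
        4 * B ^ 2 * C ^ 2 / ((1 + N ^ 2) * log (2 + N) ^ 2) := by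
      field_simp
    rw [e, sch, le_div_iff₀ (by positivity)]
    calc _ ≤ 2 * (C⁻¹) ^ 2 * (2 * (B * C ^ 2) ^ 2) := by gcongr
      _ = _ := by field_simp; ring
  -- This is the coefficient of `exp t` in `c cosh (t - log √3)`. The density is at most `(log (2 +
  -- N))⁻²` and `N ≥ a exp t`, so `a exp t` is the comparison function; `K = (2 + a) / a` bounds `(2
  -- + x) / x` for `x ≥ a`.
  · set a := c / (2 * √3)
    have ha : 0 < a := by positivity
    have hexp : ∀ t, a * exp t ≤ c * cosh (t - log √3) := fun t => by
      have e1 : exp (t - log √3) = exp t / √3 := by rw [Real.exp_sub, exp_log_sqrt_three]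
      rw [Real.cosh_eq, e1]
      have := exp_pos (-(t - log √3))
      have e2 : a * exp t = c * (exp t / √3 / 2) := by simp only [a]; field_simp
      rw [e2]
      gcongr
      linarith
    refine integrableOn_of_le_log (K := (2 + a) / a) (f := fun t => a * exp t)
      (f' := fun t => a * exp t) (fun t => (Real.hasDerivAt_exp t).const_mul a)
      (fun t _ => by positivity) (fun t _ => by positivity)
      (Real.tendsto_exp_atTop.const_mul_atTop ha) ?_ fun t ht => ?_
    · unfold starDensity
      exact Measurable.aestronglyMeasurable (by fun_prop)
    · simp only [starDensity]
      have hN1' := hN1 t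
      have he := hexp t
      have hC := mul_pos hc (ch t)
      have hN2 : √((c * cosh (t - log √3)) ^ 2 + (c * (κ * t)) ^ 2) ^ 2 =
        (c * cosh (t - log √3)) ^ 2 + (c * (κ * t)) ^ 2 := Real.sq_sqrt (by positivity)
      set N := √((c * cosh (t - log √3)) ^ 2 + (c * (κ * t)) ^ 2)
      set x := a * exp t
      have hx : a ≤ x := by
        simp only [x]; nlinarith [Real.one_le_exp ht.le]
      have hl0 : 0 < log (2 + x) := Real.log_pos (by linarith)
      have hl : log (2 + x) ≤ log (2 + N) := Real.log_le_log (by linarith) (by linarith)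
      have hl' := hl0.trans_le hl
      rw [abs_of_pos (by positivity)]
      have e1 : (c * cosh (t - log √3) * (c * cosh (t - log √3))) * (1 + N ^ 2)⁻¹ ≤ 1 := by
        rw [← div_eq_mul_inv, div_le_one (by positivity), hN2]
        nlinarith [sq_nonneg (c * (κ * t))]
      have e2 : 1 ≤ (2 + a) / a * (x / (2 + x)) := by
        rw [div_mul_div_comm, le_div_iff₀ (by positivity)]
        nlinarith
      calc _ = (c * cosh (t - log √3) * (c * cosh (t - log √3))) * (1 + N ^ 2)⁻¹ *
            (log (2 + N) ^ 2)⁻¹ := by ring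
        _ ≤ 1 * (log (2 + x) ^ 2)⁻¹ := by gcongr
        _ ≤ ((2 + a) / a * (x / (2 + x))) * (log (2 + x) ^ 2)⁻¹ := by gcongr
        _ = _ := by ring

/-! ## The index form as a sum over Fourier modes -/

namespace IsFace

variable {X : ℝ × ℝ → E3} {w V σ ρ : ℝ → ℝ} {β : ℝ} {φ : Jet}

lemma w_pos (hX : IsFace X w V σ ρ β) {t : ℝ} (ht : 0 ≤ t) : 0 < w t :=
  one_pos.trans_le (hX.one_le_w t ht)

lemma cont_w' (hX : IsFace X w V σ ρ β) : ContinuousOn w (Ioi 0) :=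
  hX.cont_w.mono Ioi_subset_Ici_self

lemma cont_w_inv (hX : IsFace X w V σ ρ β) : ContinuousOn (fun t => (w t)⁻¹) (Ioi 0) :=
  hX.cont_w'.inv₀ fun _ ht => (hX.w_pos (le_of_lt ht)).ne'

lemma weak (hX : IsFace X w V σ ρ β) (hφ : MemWStar X φ) : HasWeakGradTrace φ :=
  ((hX.finiteEnergy_iff φ).1 hφ.1).1

lemma int_pt (hX : IsFace X w V σ ρ β) (hφ : MemWStar X φ) :
    Integrable (fun z => w z.1 * φ.pt z ^ 2) stripMeasure :=
  ((hX.finiteEnergy_iff φ).1 hφ.1).2.1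

lemma int_pθ (hX : IsFace X w V σ ρ β) (hφ : MemWStar X φ) :
    Integrable (fun z => (w z.1)⁻¹ * φ.pθ z ^ 2) stripMeasure :=
  ((hX.finiteEnergy_iff φ).1 hφ.1).2.2.1

lemma memLp_trace (hX : IsFace X w V σ ρ β) (hφ : MemWStar X φ) : MemLp φ.trace 2 circleMeasure :=
  ((hX.finiteEnergy_iff φ).1 hφ.1).2.2.2

lemma int_σ_val (hX : IsFace X w V σ ρ β) (hφ : MemWStar X φ) :
    Integrable (fun z => σ z.1 * φ.val z ^ 2) stripMeasure :=
  (hX.memLp_star_iff _).1 hφ.2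

lemma int_V_val (hX : IsFace X w V σ ρ β) (hφ : MemWStar X φ) :
    Integrable (fun z => V z.1 * φ.val z ^ 2) stripMeasure := by
  obtain ⟨K, hK⟩ := hX.V_le
  refine ((hX.int_σ_val hφ).const_mul K).mono' ?_ ?_
  · exact (hX.cont_V.comp continuous_fst).aestronglyMeasurable.mul
      (φ.val.aestronglyMeasurable.pow 2)
  · filter_upwards [ae_strip_pos] with z hz
    rw [norm_eq_abs, abs_of_nonneg (mul_nonneg (hX.V_nonneg _) (sq_nonneg _)), ← mul_assoc]
    exact mul_le_mul_of_nonneg_right (hK _ hz.le) (sq_nonneg _)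

lemma slice_pt (hX : IsFace X w V σ ρ β) (hφ : MemWStar X φ) :
    ∀ᵐ t ∂volume.restrict (Ioi 0), MemLp (fun θ => φ.pt (t, θ)) 2 circleMeasure :=
  ae_memLp_slice φ.pt.aestronglyMeasurable (fun _ ht => hX.w_pos (le_of_lt ht)) (hX.int_pt hφ)

lemma slice_pθ (hX : IsFace X w V σ ρ β) (hφ : MemWStar X φ) :
    ∀ᵐ t ∂volume.restrict (Ioi 0), MemLp (fun θ => φ.pθ (t, θ)) 2 circleMeasure :=
  ae_memLp_slice φ.pθ.aestronglyMeasurable (W := fun t => (w t)⁻¹)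
    (fun _ ht => inv_pos.2 (hX.w_pos (le_of_lt ht))) (hX.int_pθ hφ)

lemma slice_val (hX : IsFace X w V σ ρ β) (hφ : MemWStar X φ) :
    ∀ᵐ t ∂volume.restrict (Ioi 0), MemLp (fun θ => φ.val (t, θ)) 2 circleMeasure :=
  ae_memLp_slice φ.val.aestronglyMeasurable (fun t ht => hX.σ_pos t (le_of_lt ht)) (hX.int_σ_val hφ)

lemma int_mode_pt (hX : IsFace X w V σ ρ β) (hφ : MemWStar X φ) (k : ℤ) :
    IntegrableOn (fun t => w t * coef (cosMode k) φ.pt t ^ 2) (Ioi 0) ∧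
    IntegrableOn (fun t => w t * coef (sinMode k) φ.pt t ^ 2) (Ioi 0) :=
  integrable_sq_coef φ.pt.aestronglyMeasurable (hX.slice_pt hφ)
    (fun _ ht => (hX.w_pos (le_of_lt ht)).le) hX.cont_w' (hX.int_pt hφ) k

lemma int_mode_val (hX : IsFace X w V σ ρ β) (hφ : MemWStar X φ) (k : ℤ) :
    IntegrableOn (fun t => V t * mode (cosMode k) φ t ^ 2) (Ioi 0) ∧
    IntegrableOn (fun t => V t * mode (sinMode k) φ t ^ 2) (Ioi 0) := by
  have h := integrable_sq_coef φ.val.aestronglyMeasurable (hX.slice_val hφ)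
    (fun t _ => hX.V_nonneg t) hX.cont_V.continuousOn (hX.int_V_val hφ) k
  refine ⟨h.1.congr ?_, h.2.congr ?_⟩
  · filter_upwards [(hX.weak hφ).coef_val (isAngular_cosMode k)] with t ht using by rw [ht]
  · filter_upwards [(hX.weak hφ).coef_val (isAngular_sinMode k)] with t ht using by rw [ht]

lemma int_mode_pθ (hX : IsFace X w V σ ρ β) (hφ : MemWStar X φ) (k : ℤ) :
    IntegrableOn (fun t => (k:ℝ) ^ 2 * ((w t)⁻¹ * mode (cosMode k) φ t ^ 2)) (Ioi 0) ∧
    IntegrableOn (fun t => (k:ℝ) ^ 2 * ((w t)⁻¹ * mode (sinMode k) φ t ^ 2)) (Ioi 0) := by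
  have h := integrable_sq_coef φ.pθ.aestronglyMeasurable (hX.slice_pθ hφ)
    (fun t ht => (inv_pos.2 (hX.w_pos (le_of_lt ht))).le) hX.cont_w_inv (hX.int_pθ hφ) k
  refine ⟨h.2.congr ?_, h.1.congr ?_⟩
  · filter_upwards [(hX.weak hφ).coef_sin_pθ k] with t ht using by rw [ht]; ring
  · filter_upwards [(hX.weak hφ).coef_cos_pθ k] with t ht using by rw [ht]; ring

lemma int_mode_pθ' (hX : IsFace X w V σ ρ β) (hφ : MemWStar X φ) {k : ℤ} (hk : k ≠ 0) :
    IntegrableOn (fun t => (w t)⁻¹ * mode (cosMode k) φ t ^ 2) (Ioi 0) ∧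
    IntegrableOn (fun t => (w t)⁻¹ * mode (sinMode k) φ t ^ 2) (Ioi 0) := by
  have hk' : (k:ℝ) ≠ 0 := by exact_mod_cast hk
  have h := hX.int_mode_pθ hφ k
  exact ⟨(h.1.const_mul ((k:ℝ) ^ 2)⁻¹).congr (ae_of_all _ fun t => by field_simp),
    (h.2.const_mul ((k:ℝ) ^ 2)⁻¹).congr (ae_of_all _ fun t => by field_simp)⟩

/-- The quadratic form of a face is the sum of the forms of the Fourier modes. -/
lemma hasSum_modeForm (hX : IsFace X w V σ ρ β) (hφ : MemWStar X φ) :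
    HasSum (fun k : ℤ =>
      modeForm w V β ((k:ℝ) ^ 2) (mode (cosMode k) φ) (coef (cosMode k) φ.pt) +
      modeForm w V β ((k:ℝ) ^ 2) (mode (sinMode k) φ) (coef (sinMode k) φ.pt))
      (2 * π * (faceForm X φ φ - boundaryForm X φ φ)) := by
  have s1 := hasSum_strip φ.pt.aestronglyMeasurable (hX.slice_pt hφ)
    (fun _ ht => (hX.w_pos (le_of_lt ht)).le) hX.cont_w' (hX.int_pt hφ)
  have s2 := hasSum_strip φ.pθ.aestronglyMeasurable (hX.slice_pθ hφ)
    (fun t ht => (inv_pos.2 (hX.w_pos (le_of_lt ht))).le) hX.cont_w_inv (hX.int_pθ hφ)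
  have s3 := hasSum_strip φ.val.aestronglyMeasurable (hX.slice_val hφ)
    (fun t _ => hX.V_nonneg t) hX.cont_V.continuousOn (hX.int_V_val hφ)
  have s4 := (hasSum_sq_circle (hX.memLp_trace hφ)).mul_left β
  -- Parseval is applied separately to `u_t`, `u_θ`, the potential term and the trace.
  have key := ((s1.add s2).sub s3).sub s4
  have hQ : 2 * π * (faceForm X φ φ - boundaryForm X φ φ) =
      2 * π * (∫ z, w z.1 * φ.pt z ^ 2 ∂stripMeasure) +
      2 * π * (∫ z, (w z.1)⁻¹ * φ.pθ z ^ 2 ∂stripMeasure) -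
      2 * π * (∫ z, V z.1 * φ.val z ^ 2 ∂stripMeasure) -
      β * (2 * π * ∫ θ, φ.trace θ ^ 2 ∂circleMeasure) := by
    rw [hX.faceForm_eq, hX.boundaryForm_eq]
    simp_rw [← sq]
    rw [integral_sub (by exact (hX.int_pt hφ).add (hX.int_pθ hφ)) (hX.int_V_val hφ),
      integral_add (hX.int_pt hφ) (hX.int_pθ hφ)]
    ring
  rw [hQ]
  convert! key using 1
  funext k
  have i1 := hX.int_mode_pt hφ k
  have i2 := hX.int_mode_pθ hφ k
  have i3 := hX.int_mode_val hφ k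
  have e1 : ∀ e : ℝ → ℝ, ∀ a : ℝ → ℝ,
      IntegrableOn (fun t => w t * coef e φ.pt t ^ 2) (Ioi 0) →
      IntegrableOn (fun t => (k:ℝ) ^ 2 * ((w t)⁻¹ * a t ^ 2)) (Ioi 0) →
      IntegrableOn (fun t => V t * a t ^ 2) (Ioi 0) →
      modeForm w V β ((k:ℝ) ^ 2) a (coef e φ.pt) = (∫ t in Ioi 0, w t * coef e φ.pt t ^ 2) +
      (∫ t in Ioi 0, (k:ℝ) ^ 2 * ((w t)⁻¹ * a t ^ 2)) - (∫ t in Ioi 0, V t * a t ^ 2) -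
        β * a 0 ^ 2 := by
    intro e a j1 j2 j3
    rw [modeForm, ← integral_add j1 j2, ← integral_sub (by exact j1.add j2) j3]
    congr 2
    funext t
    ring
  rw [e1 _ _ i1.1 i2.1 i3.1, e1 _ _ i1.2 i2.2 i3.2, integral_add i1.1 i1.2, mode_zero, mode_zero]
  -- The `θ`-derivative exchanges `cos` and `sin`, so the two coefficients match only after being
  -- added together.
  have f2 : ∫ t in Ioi 0, ((w t)⁻¹ * coef (cosMode k) φ.pθ t ^ 2 +
      (w t)⁻¹ * coef (sinMode k) φ.pθ t ^ 2) =
      (∫ t in Ioi 0, (k:ℝ) ^ 2 * ((w t)⁻¹ * mode (cosMode k) φ t ^ 2)) +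
      ∫ t in Ioi 0, (k:ℝ) ^ 2 * ((w t)⁻¹ * mode (sinMode k) φ t ^ 2) := by
    rw [← integral_add i2.1 i2.2]
    refine integral_congr_ae ?_
    filter_upwards [(hX.weak hφ).coef_sin_pθ k, (hX.weak hφ).coef_cos_pθ k] with t h1 h2
    rw [h1, h2]; ring
  have f3 : ∫ t in Ioi 0, (V t * coef (cosMode k) φ.val t ^ 2 +
      V t * coef (sinMode k) φ.val t ^ 2) =
      (∫ t in Ioi 0, V t * mode (cosMode k) φ t ^ 2) +
      ∫ t in Ioi 0, V t * mode (sinMode k) φ t ^ 2 := by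
    rw [← integral_add i3.1 i3.2]
    refine integral_congr_ae ?_
    filter_upwards [(hX.weak hφ).coef_val (isAngular_cosMode k),
      (hX.weak hφ).coef_val (isAngular_sinMode k)] with t h1 h2
    rw [h1, h2]
  rw [f2, f3]
  ring

/-- The sum of the forms of the two modes of frequency `k`. -/
lemma modes_nonneg (hX : IsFace X w V σ ρ β) (hs : ModeStable w V β) (hφ : MemWStar X φ) {k : ℤ}
    (hk : k ≠ 0) :
    0 ≤ modeForm w V β ((k:ℝ) ^ 2) (mode (cosMode k) φ) (coef (cosMode k) φ.pt) ∧
    0 ≤ modeForm w V β ((k:ℝ) ^ 2) (mode (sinMode k) φ) (coef (sinMode k) φ.pt) := by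
  have h1 : (1:ℝ) ≤ (k:ℝ) ^ 2 := by
    have : (1:ℤ) ≤ k ^ 2 := by have := sq_pos_of_ne_zero hk; omega
    exact_mod_cast this
  exact ⟨hs.nonneg h1 ((hX.weak hφ).isPrim_mode (isAngular_cosMode k)) (hX.int_mode_pt hφ k).1
      (hX.int_mode_pθ' hφ hk).1,
    hs.nonneg h1 ((hX.weak hφ).isPrim_mode (isAngular_sinMode k)) (hX.int_mode_pt hφ k).2
      (hX.int_mode_pθ' hφ hk).2⟩

lemma memWStar_of_memWc (hX : IsFace X w V σ ρ β) (hφ : MemWc X φ) : MemWStar X φ := by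
  refine ⟨hφ.1, (hX.memLp_star_iff _).2 ?_⟩
  obtain ⟨K, hK⟩ := hX.σ_le
  refine (((hX.memLp_area_iff _).1 hφ.2.1).const_mul K).mono' ?_ ?_
  · exact (hX.cont_σ.comp continuous_fst).aestronglyMeasurable.mul
      (φ.val.aestronglyMeasurable.pow 2)
  · filter_upwards [ae_strip_pos] with z hz
    rw [norm_eq_abs, abs_of_nonneg (mul_nonneg (hX.σ_pos _ hz.le).le (sq_nonneg _)), ← mul_assoc]
    exact mul_le_mul_of_nonneg_right (hK _ hz.le) (sq_nonneg _)

end IsFace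

lemma mode_sinMode_zero (φ : Jet) : mode (sinMode 0) φ = 0 := by
  funext t
  simp [mode, sinMode, coef]

lemma coef_sinMode_zero (f : ℝ × ℝ → ℝ) : coef (sinMode 0) f = 0 := by
  funext t
  simp [sinMode, coef]

lemma modeForm_zero_right (w V : ℝ → ℝ) (β m : ℝ) : modeForm w V β m 0 0 = 0 := by
  simp [modeForm]

/-- The form of the radial mode of a function on a face. -/
def radialForm (w V : ℝ → ℝ) (β : ℝ) (φ : Jet) : ℝ :=
  modeForm w V β 0 (mode (cosMode 0) φ) (coef (cosMode 0) φ.pt)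

/-! ### Linearity of modes -/

lemma integrable_slab {f : FaceFun} (hf : LocInt f) {e : ℝ → ℝ} (he : IsAngular e) (b : ℝ) :
    Integrable (fun z : ℝ × ℝ => f z * e z.2) ((volume.restrict (Ioc 0 b)).prod circleMeasure) := by
  obtain ⟨C, hC⟩ := (isCompact_Icc (a := (0:ℝ)) (b := 2 * π)).exists_bound_of_continuousOn
    he.continuous.continuousOn
  have hle : (volume.restrict (Ioc 0 b)).prod circleMeasure ≤
      (volume.restrict (Iio (b + 1) ∩ Ioi 0)).prod circleMeasure := by
    refine Measure.prod_mono (Measure.restrict_mono ?_ le_rfl) le_rfl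
    exact fun x hx => ⟨by simp only [mem_Iio]; linarith [hx.2], hx.1⟩
  refine ((integrableOn_strip (hf (b + 1))).mono_measure hle).mul_bdd (c := C)
    (he.continuous.comp continuous_snd).aestronglyMeasurable ?_
  have h3 : ∀ᵐ θ ∂circleMeasure, ‖e θ‖ ≤ C := by
    unfold circleMeasure
    filter_upwards [ae_restrict_mem measurableSet_Ioc] with θ hθ using hC θ ⟨hθ.1.le, hθ.2⟩
  exact Measure.quasiMeasurePreserving_snd.ae h3

lemma slab_ac (b : ℝ) : (volume.restrict (Ioc 0 b)).prod circleMeasure ≪ stripMeasure := by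
  rw [stripMeasure_eq]
  exact (Measure.prod_mono (Measure.restrict_mono Ioc_subset_Ioi_self le_rfl)
    le_rfl).absolutelyContinuous

/-- Written as a double integral, the mode is linear by almost everywhere equalities on the strip,
with no need to choose slices of equivalence classes. -/
lemma mode_eq {φ : Jet} (h : HasWeakGradTrace φ) {e : ℝ → ℝ} (he : IsAngular e) {t : ℝ}
    (ht : 0 ≤ t) : mode e φ t = (∫ θ, φ.trace θ * e θ ∂circleMeasure) +
      ∫ z, φ.pt z * e z.2 ∂((volume.restrict (Ioc 0 t)).prod circleMeasure) := by
  rw [mode, intervalIntegral.integral_of_le ht, integral_prod _ (integrable_slab h.2.1 he t)]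
  rfl

lemma integrable_trace_mul {φ : Jet} (h : HasWeakGradTrace φ) {e : ℝ → ℝ} (he : IsAngular e) :
    Integrable (fun θ => φ.trace θ * e θ) circleMeasure := by
  obtain ⟨C, hC⟩ := (isCompact_Icc (a := (0:ℝ)) (b := 2 * π)).exists_bound_of_continuousOn
    he.continuous.continuousOn
  refine h.2.2.2.1.mul_bdd (c := C) he.continuous.aestronglyMeasurable ?_
  unfold circleMeasure
  filter_upwards [ae_restrict_mem measurableSet_Ioc] with θ hθ using hC θ ⟨hθ.1.le, hθ.2⟩

lemma mode_add {φ ψ : Jet} (hφ : HasWeakGradTrace φ) (hψ : HasWeakGradTrace ψ)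
    (hs : HasWeakGradTrace (φ + ψ)) {e : ℝ → ℝ} (he : IsAngular e) {t : ℝ} (ht : 0 ≤ t) :
    mode e (φ + ψ) t = mode e φ t + mode e ψ t := by
  rw [mode_eq hφ he ht, mode_eq hψ he ht, mode_eq hs he ht]
  have e1 : ∫ θ, (φ + ψ).trace θ * e θ ∂circleMeasure =
      (∫ θ, φ.trace θ * e θ ∂circleMeasure) + ∫ θ, ψ.trace θ * e θ ∂circleMeasure := by
    rw [← integral_add (integrable_trace_mul hφ he) (integrable_trace_mul hψ he)]
    refine integral_congr_ae ?_
    filter_upwards [AEEqFun.coeFn_add φ.trace ψ.trace] with θ hθ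
    rw [show (φ + ψ).trace = φ.trace + ψ.trace from rfl, hθ, Pi.add_apply, add_mul]
  have e2 : ∫ z, (φ + ψ).pt z * e z.2 ∂((volume.restrict (Ioc 0 t)).prod circleMeasure) =
      (∫ z, φ.pt z * e z.2 ∂((volume.restrict (Ioc 0 t)).prod circleMeasure)) +
      ∫ z, ψ.pt z * e z.2 ∂((volume.restrict (Ioc 0 t)).prod circleMeasure) := by
    rw [← integral_add (integrable_slab hφ.2.1 he t) (integrable_slab hψ.2.1 he t)]
    refine integral_congr_ae ?_
    filter_upwards [(slab_ac t).ae_le (AEEqFun.coeFn_add φ.pt ψ.pt)] with θ hθ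
    rw [show (φ + ψ).pt = φ.pt + ψ.pt from rfl, hθ, Pi.add_apply, add_mul]
  rw [e1, e2]; ring

lemma mode_smul {φ : Jet} (hφ : HasWeakGradTrace φ) (r : ℝ) (hs : HasWeakGradTrace (r • φ))
    {e : ℝ → ℝ} (he : IsAngular e) {t : ℝ} (ht : 0 ≤ t) : mode e (r • φ) t = r * mode e φ t := by
  rw [mode_eq hφ he ht, mode_eq hs he ht, mul_add, ← integral_const_mul, ← integral_const_mul]
  congr 1
  · refine integral_congr_ae ?_
    filter_upwards [AEEqFun.coeFn_smul r φ.trace] with θ hθ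
    rw [show (r • φ).trace = r • φ.trace from rfl, hθ, Pi.smul_apply, smul_eq_mul, mul_assoc]
  · refine integral_congr_ae ?_
    filter_upwards [(slab_ac t).ae_le (AEEqFun.coeFn_smul r φ.pt)] with θ hθ
    rw [show (r • φ).pt = r • φ.pt from rfl, hθ, Pi.smul_apply, smul_eq_mul, mul_assoc]

/-! ### Upper bounds for the index -/

/-- A nonzero vector killed by all the functionals would have both negative and nonnegative form, so
they are injective on a negative definite subspace. -/
lemma finrank_le_of_nonneg_on_ker {W : Type*} [AddCommGroup W] [Module ℝ W] {S : Submodule ℝ W}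
    [FiniteDimensional ℝ S] {B : W → W → ℝ} (hneg : ∀ φ ∈ S, φ ≠ 0 → B φ φ < 0) {n : ℕ}
    (L : S →ₗ[ℝ] (Fin n → ℝ)) (h : ∀ φ : S, L φ = 0 → 0 ≤ B φ φ) : Module.finrank ℝ S ≤ n := by
  have hinj : Function.Injective L := by
    rw [← LinearMap.ker_eq_bot, LinearMap.ker_eq_bot']
    intro φ hφ
    by_contra hne
    exact absurd (hneg φ φ.2 fun h0 => hne (Subtype.ext h0)) (not_lt.2 (h φ hφ))
  simpa using LinearMap.finrank_le_finrank_of_injective hinj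

/-! ### Lower bounds for the form and upper bounds for the indices -/

section Faces

variable {c : ℝ}

/-- The radial part of the form on a catenoidal face, for functions whose mean vanishes at
`t = log √3`. -/
lemma radialForm_catenoid_ge {κ : ℝ} (hc : 0 < c) (hκ : κ ^ 2 = 1) {φ : Jet}
    (hφ : MemWStar (catenoidFace c κ) φ) (h0 : mode (cosMode 0) φ (log √3) = 0) :
    2 * mode (cosMode 0) φ 0 ^ 2 ≤
      radialForm (fun _ => 1) (fun t => 2 * sch t ^ 2) (-1 / 2) φ := by
  have hX := isFace_catenoidFace hc hκ
  have h1 := (hX.int_mode_pt hφ 0).1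
  have h2 := (hX.int_mode_val hφ 0).1
  simp only [one_mul] at h1
  have h3 := catenoid_radial_le ((hX.weak hφ).isPrim_mode (isAngular_cosMode 0)) h1
    ((h2.const_mul (1 / 2)).congr (ae_of_all _ fun t => by ring)) h0
  simp only [radialForm, modeForm, one_mul, zero_mul, zero_sub]
  have e : ∫ t in Ioi 0, (coef (cosMode 0) φ.pt t ^ 2 + -(2 * sch t ^ 2) * mode (cosMode 0) φ t ^ 2)
      = ∫ t in Ioi 0, (coef (cosMode 0) φ.pt t ^ 2 - 2 * sch t ^ 2 * mode (cosMode 0) φ t ^ 2) := by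
    congr 1; funext t; ring
  rw [e]
  -- The bulk contributes `3 / 2` and the boundary coefficient `-β = 1 / 2`.
  linarith

/-- Without a potential, only the boundary term can be negative, and `β = 1`. -/
lemma radialForm_plane_ge (φ : Jet) :
    -mode (cosMode 0) φ 0 ^ 2 ≤ radialForm rad (fun _ => 0) 1 φ := by
  have : 0 ≤ ∫ t in Ioi 0, (rad t * coef (cosMode 0) φ.pt t ^ 2 +
      (0 * (rad t)⁻¹ - 0) * mode (cosMode 0) φ t ^ 2) :=
    setIntegral_nonneg measurableSet_Ioi fun t ht => by
      have := rad_pos (le_of_lt ht)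
      rw [zero_mul, sub_zero, zero_mul, add_zero]
      positivity
  simp only [radialForm, modeForm]
  linarith

/-- The form on a face is at least its radial part. -/
lemma IsFace.radialForm_le {X : ℝ × ℝ → E3} {w V σ ρ : ℝ → ℝ} {β : ℝ} {φ : Jet}
    (hX : IsFace X w V σ ρ β) (hs : ModeStable w V β) (hφ : MemWStar X φ) :
    radialForm w V β φ ≤ 2 * π * (faceForm X φ φ - boundaryForm X φ φ) := by
  -- All terms with `k ≠ 0` are nonnegative, so the sum is at least its term `k = 0`, where the sine
  -- mode is zero.
  have h := le_hasSum (hX.hasSum_modeForm hφ) 0 fun k hk =>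
    add_nonneg (hX.modes_nonneg hs hφ hk).1 (hX.modes_nonneg hs hφ hk).2
  rw [mode_sinMode_zero, coef_sinMode_zero, modeForm_zero_right, add_zero] at h
  simpa [radialForm] using h

lemma mode_compatible {φ : JFun} (hw : ∀ i, HasWeakGradTrace (φ i))
    (hc : Compatible φ) {e : ℝ → ℝ} (he : IsAngular e) :
    mode e (φ 0) 0 + mode e (φ 1) 0 + mode e (φ 2) 0 = 0 := by
  have i := fun i => integrable_trace_mul (hw i) he
  rw [mode_zero, mode_zero, mode_zero, ← integral_add (i 0) (i 1),
    ← integral_add (by exact (i 0).add (i 1)) (i 2)]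
  refine integral_eq_zero_of_ae ?_
  have h : (φ 0).trace + (φ 1).trace + (φ 2).trace = 0 := hc
  have h' := AEEqFun.coeFn_add ((φ 0).trace + (φ 1).trace) (φ 2).trace
  rw [h] at h'
  filter_upwards [h', AEEqFun.coeFn_add (φ 0).trace (φ 1).trace,
    AEEqFun.coeFn_zero (α := ℝ) (β := ℝ) (μ := circleMeasure)] with θ h1 h2 h3
  rw [h3, Pi.add_apply, h2] at h1
  simp only [Pi.zero_apply, Pi.add_apply] at h1 ⊢
  linear_combination -e θ * h1

lemma isFace_zero (hc : 0 < c) : IsFace (pseudoYCatenoid c 0) (fun _ => 1) (fun t => 2 * sch t ^ 2)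
    (catenoidDensity c 1) (fun t => c * cosh (t - log √3) * (c * cosh (t - log √3))) (-1 / 2) :=
  isFace_catenoidFace hc (by norm_num)

lemma isFace_one (hc : 0 < c) : IsFace (pseudoYCatenoid c 1) rad (fun _ => 0) (planeDensity c)
    (fun t => c * (c * rad t)) 1 :=
  isFace_planeFace hc

lemma isFace_two (hc : 0 < c) : IsFace (pseudoYCatenoid c 2) (fun _ => 1) (fun t => 2 * sch t ^ 2)
    (catenoidDensity c (-1)) (fun t => c * cosh (t - log √3) * (c * cosh (t - log √3))) (-1 / 2) :=
  isFace_catenoidFace hc (by norm_num)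

/-- If `x`, `y` are the radial boundary values on the catenoids, the plane carries `-(x + y)`, and
the bounds add up to `2x² + 2y² - (x + y)² = (x - y)²`. -/
lemma indexForm_nonneg (hc : 0 < c) {φ : JFun} (hφ : φ ∈ WDeltaStar (pseudoYCatenoid c))
    (h0 : mode (cosMode 0) (φ 0) (log √3) = 0) (h2 : mode (cosMode 0) (φ 2) (log √3) = 0) :
    0 ≤ indexForm (pseudoYCatenoid c) φ φ := by
  have a0 := radialForm_catenoid_ge hc (by norm_num) (hφ.1 0) h0
  have a1 := radialForm_plane_ge (φ 1)
  have a2 := radialForm_catenoid_ge hc (by norm_num) (hφ.1 2) h2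
  have b0 := (isFace_zero hc).radialForm_le modeStable_catenoid (hφ.1 0)
  have b1 := (isFace_one hc).radialForm_le modeStable_plane (hφ.1 1)
  have b2 := (isFace_two hc).radialForm_le modeStable_catenoid (hφ.1 2)
  have hcomp := mode_compatible (fun i => (hφ.1 i).1.1) hφ.2
    (isAngular_cosMode 0)
  rw [indexForm, Fin.sum_univ_three]
  have hpi : 0 < 2 * π := by positivity
  set x := mode (cosMode 0) (φ 0) 0
  set y := mode (cosMode 0) (φ 2) 0
  have hz : mode (cosMode 0) (φ 1) 0 = -(x + y) := by linarith
  rw [hz] at a1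
  have : 0 ≤ 2 * π * ((faceForm (pseudoYCatenoid c 0) (φ 0) (φ 0) -
      boundaryForm (pseudoYCatenoid c 0) (φ 0) (φ 0)) +
      (faceForm (pseudoYCatenoid c 1) (φ 1) (φ 1) -
      boundaryForm (pseudoYCatenoid c 1) (φ 1) (φ 1)) +
      (faceForm (pseudoYCatenoid c 2) (φ 2) (φ 2) -
      boundaryForm (pseudoYCatenoid c 2) (φ 2) (φ 2))) := by
    nlinarith [sq_nonneg (x - y)]
  exact nonneg_of_mul_nonneg_right this hpi

/-- The index form has index at most two. -/
lemma finrank_le_two (hc : 0 < c) {S : Submodule ℝ JFun}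
    (hS : (S : Set JFun) ⊆ WDeltaStar (pseudoYCatenoid c)) [FiniteDimensional ℝ S]
    (hneg : ∀ φ ∈ S, φ ≠ 0 → indexForm (pseudoYCatenoid c) φ φ < 0) : Module.finrank ℝ S ≤ 2 := by
  have hw : ∀ φ ∈ S, ∀ i, HasWeakGradTrace (φ i) := fun φ hφ i => ((hS hφ).1 i).1.1
  have T0 := log_sqrt_three_pos.le
  -- The two functionals are the radial modes at the necks of the two catenoids.
  let L : S →ₗ[ℝ] (Fin 2 → ℝ) :=
    { toFun := fun φ => ![mode (cosMode 0) (φ.1 0) (log √3), mode (cosMode 0) (φ.1 2) (log √3)]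
      map_add' := fun φ ψ => by
        have := fun i => mode_add (hw _ φ.2 i) (hw _ ψ.2 i) (hw _ (φ + ψ).2 i)
          (isAngular_cosMode 0) T0
        ext j
        fin_cases j
        · exact this 0
        · exact this 2
      map_smul' := fun r φ => by
        have := fun i => mode_smul (hw _ φ.2 i) r (hw _ (r • φ).2 i) (isAngular_cosMode 0) T0
        ext j
        fin_cases j
        · exact this 0
        · exact this 2 }
  refine finrank_le_of_nonneg_on_ker hneg L fun φ hφ => ?_
  exact indexForm_nonneg hc (hS φ.2) (congrFun hφ 0) (congrFun hφ 1)

lemma mode_zero_of_trace {φ : Jet} (h : φ.trace = 0) {e : ℝ → ℝ} : mode e φ 0 = 0 := by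
  rw [mode_zero, h]
  refine integral_eq_zero_of_ae ?_
  filter_upwards [AEEqFun.coeFn_zero (α := ℝ) (β := ℝ) (μ := circleMeasure)] with θ hθ
  simp [hθ]

lemma boundaryForm_zero_of_trace {X : ℝ × ℝ → E3} {w V σ ρ : ℝ → ℝ} {β : ℝ}
    (hX : IsFace X w V σ ρ β) {φ : Jet} (h : φ.trace = 0) : boundaryForm X φ φ = 0 := by
  rw [hX.boundaryForm_eq, h, integral_eq_zero_of_ae, mul_zero]
  filter_upwards [AEEqFun.coeFn_zero (α := ℝ) (β := ℝ) (μ := circleMeasure)] with θ hθ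
  simp [hθ]

/-- The Dirichlet index of a catenoidal face is at most one. -/
lemma finrank_le_one {κ : ℝ} (hc : 0 < c) (hκ : κ ^ 2 = 1) {S : Submodule ℝ Jet}
    (hS : (S : Set Jet) ⊆ WDirichlet (catenoidFace c κ)) [FiniteDimensional ℝ S]
    (hneg : ∀ φ ∈ S, φ ≠ 0 → faceForm (catenoidFace c κ) φ φ < 0) : Module.finrank ℝ S ≤ 1 := by
  have hX := isFace_catenoidFace hc hκ
  have hw : ∀ φ ∈ S, HasWeakGradTrace φ := fun φ hφ => (hS hφ).1.1.1
  have T0 := log_sqrt_three_pos.le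
  -- With zero trace there is no boundary interaction, and the neck value alone controls the sign.
  let L : S →ₗ[ℝ] (Fin 1 → ℝ) :=
    { toFun := fun φ => ![mode (cosMode 0) φ.1 (log √3)]
      map_add' := fun φ ψ => by
        ext j
        fin_cases j
        exact mode_add (hw _ φ.2) (hw _ ψ.2) (hw _ (φ + ψ).2) (isAngular_cosMode 0) T0
      map_smul' := fun r φ => by
        ext j
        fin_cases j
        exact mode_smul (hw _ φ.2) r (hw _ (r • φ).2) (isAngular_cosMode 0) T0 }
  refine finrank_le_of_nonneg_on_ker hneg L fun φ hφ => ?_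
  have h1 := hS φ.2
  have h2 := hX.memWStar_of_memWc h1.1
  have h3 := radialForm_catenoid_ge hc hκ h2 (congrFun hφ 0)
  have h4 := hX.radialForm_le modeStable_catenoid h2
  rw [mode_zero_of_trace h1.2] at h3
  rw [boundaryForm_zero_of_trace hX h1.2, sub_zero] at h4
  exact nonneg_of_mul_nonneg_right (by linarith : 0 ≤ 2 * π * _) (by positivity)

/-- The Dirichlet form of the planar face is nonnegative. -/
lemma faceForm_plane_nonneg (hc : 0 < c) (φ : Jet) : 0 ≤ faceForm (planeFace c) φ φ := by
  rw [(isFace_planeFace hc).faceForm_eq]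
  refine integral_nonneg_of_ae ?_
  filter_upwards [ae_strip_pos] with z hz
  have := rad_pos (le_of_lt hz)
  have h1 := mul_self_nonneg (φ.pt z)
  have h2 := mul_self_nonneg (φ.pθ z)
  rw [zero_mul, sub_zero, Pi.zero_apply]
  positivity

end Faces

/-! ## Linear structure of the function spaces -/

namespace IsTest

variable {η : ℝ × ℝ → ℝ}

lemma continuous_fderiv (h : IsTest η) (v : ℝ × ℝ) : Continuous fun z => fderiv ℝ η z v :=
  (h.1.continuous_fderiv (by simp)).clm_apply continuous_const

lemma exists_vanish (h : IsTest η) :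
    ∃ b : ℝ, ∀ t θ, b ≤ t → η (t, θ) = 0 ∧ ∀ v, fderiv ℝ η (t, θ) v = 0 := by
  obtain ⟨b, hb⟩ := h.2.2
  refine ⟨b + 1, fun t θ ht => ⟨hb t θ (by linarith), fun v => ?_⟩⟩
  have : η =ᶠ[𝓝 (t, θ)] fun _ => 0 := by
    have hmem : {z : ℝ × ℝ | b < z.1} ∈ 𝓝 (t, θ) :=
      (isOpen_lt continuous_const continuous_fst).mem_nhds (by simp; linarith)
    filter_upwards [hmem] with z hz
    exact hb z.1 z.2 (le_of_lt hz)
  rw [this.fderiv_eq]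
  simp

lemma hasFDerivAt (h : IsTest η) (z : ℝ × ℝ) : HasFDerivAt η (fderiv ℝ η z) z :=
  (h.1.differentiable (by simp) z).hasFDerivAt

lemma isCutoff (h : IsTest η) (θ : ℝ) : IsCutoff fun t => η (t, θ) :=
  ⟨h.1.comp (contDiff_id.prodMk contDiff_const), h.2.2.imp fun _ hb t ht => hb t θ ht⟩

lemma deriv_fst (h : IsTest η) (t θ : ℝ) :
    deriv (fun t => η (t, θ)) t = fderiv ℝ η (t, θ) (1, 0) := by
  have h1 : HasDerivAt (fun t : ℝ => (t, θ)) ((1:ℝ), (0:ℝ)) t :=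
    (hasDerivAt_id t).prodMk (hasDerivAt_const t θ)
  exact ((h.hasFDerivAt (t, θ)).comp_hasDerivAt t h1).deriv

lemma isAngular (h : IsTest η) (t : ℝ) : IsAngular fun θ => η (t, θ) :=
  ⟨h.1.comp (contDiff_const.prodMk contDiff_id), fun θ => h.2.1 t θ⟩

lemma deriv_snd (h : IsTest η) (t θ : ℝ) :
    deriv (fun θ => η (t, θ)) θ = fderiv ℝ η (t, θ) (0, 1) := by
  have h1 : HasDerivAt (fun θ : ℝ => (t, θ)) ((0:ℝ), (1:ℝ)) θ :=
    (hasDerivAt_const θ t).prodMk (hasDerivAt_id θ)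
  exact ((h.hasFDerivAt (t, θ)).comp_hasDerivAt θ h1).deriv

end IsTest

lemma LocInt.add {f g : FaceFun} (hf : LocInt f) (hg : LocInt g) : LocInt (f + g) := fun b =>
  ((hf b).add (hg b)).congr (ae_restrict_of_ae (AEEqFun.coeFn_add f g).symm)

lemma LocInt.smul {f : FaceFun} (hf : LocInt f) (r : ℝ) : LocInt (r • f) := fun b =>
  ((hf b).smul r).congr (ae_restrict_of_ae (AEEqFun.coeFn_smul r f).symm)

lemma LocInt.integral_add_mul {f g : FaceFun} (hf : LocInt f) (hg : LocInt g) {η : ℝ × ℝ → ℝ}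
    (hη : Continuous η) {b : ℝ} (hb : ∀ t θ, b ≤ t → η (t, θ) = 0) :
    ∫ z, (f + g : FaceFun) z * η z ∂stripMeasure =
      (∫ z, f z * η z ∂stripMeasure) + ∫ z, g z * η z ∂stripMeasure := by
  rw [← integral_add (hf.integrable_mul hη hb) (hg.integrable_mul hη hb)]
  refine integral_congr_ae ?_
  filter_upwards [AEEqFun.coeFn_add f g] with z hz
  rw [hz, Pi.add_apply, add_mul]

lemma integral_smul_mul {α : Type*} [MeasurableSpace α] {μ : Measure α} (f : α →ₘ[μ] ℝ) (r : ℝ)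
    (η : α → ℝ) : ∫ z, (r • f : α →ₘ[μ] ℝ) z * η z ∂μ = r * ∫ z, f z * η z ∂μ := by
  rw [← integral_const_mul]
  refine integral_congr_ae ?_
  filter_upwards [AEEqFun.coeFn_smul r f] with z hz
  rw [hz, Pi.smul_apply, smul_eq_mul, mul_assoc]

namespace HasWeakGradTrace

variable {φ ψ : Jet}

lemma add (hφ : HasWeakGradTrace φ) (hψ : HasWeakGradTrace ψ) : HasWeakGradTrace (φ + ψ) := by
  refine ⟨hφ.1.add hψ.1, hφ.2.1.add hψ.2.1, hφ.2.2.1.add hψ.2.2.1,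
    (hφ.2.2.2.1.add hψ.2.2.2.1).congr (AEEqFun.coeFn_add _ _).symm, fun η hη => ?_⟩
  obtain ⟨b, hb⟩ := hη.exists_vanish
  have t1 := hφ.2.2.2.2 η hη
  have t2 := hψ.2.2.2.2 η hη
  have hc := hη.1.continuous
  rw [show (φ + ψ).val = φ.val + ψ.val from rfl, show (φ + ψ).pt = φ.pt + ψ.pt from rfl,
    show (φ + ψ).pθ = φ.pθ + ψ.pθ from rfl, show (φ + ψ).trace = φ.trace + ψ.trace from rfl,
    hφ.1.integral_add_mul hψ.1 (hη.continuous_fderiv _) fun t θ ht => (hb t θ ht).2 _,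
    hφ.1.integral_add_mul hψ.1 (hη.continuous_fderiv _) fun t θ ht => (hb t θ ht).2 _,
    hφ.2.1.integral_add_mul hψ.2.1 hc fun t θ ht => (hb t θ ht).1,
    hφ.2.2.1.integral_add_mul hψ.2.2.1 hc fun t θ ht => (hb t θ ht).1]
  have e3 : ∫ θ, (φ.trace + ψ.trace : CircleFun) θ * η (0, θ) ∂circleMeasure =
      (∫ θ, φ.trace θ * η (0, θ) ∂circleMeasure) + ∫ θ, ψ.trace θ * η (0, θ) ∂circleMeasure := by
    rw [← integral_add (integrable_trace_mul hφ (hη.isAngular 0))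
      (integrable_trace_mul hψ (hη.isAngular 0))]
    refine integral_congr_ae ?_
    filter_upwards [AEEqFun.coeFn_add φ.trace ψ.trace] with z hz
    rw [hz, Pi.add_apply, add_mul]
  rw [e3]
  exact ⟨by rw [t1.1, t2.1]; ring, by rw [t1.2, t2.2]; ring⟩

lemma smul (hφ : HasWeakGradTrace φ) (r : ℝ) : HasWeakGradTrace (r • φ) := by
  refine ⟨hφ.1.smul r, hφ.2.1.smul r, hφ.2.2.1.smul r,
    (hφ.2.2.2.1.smul r).congr (AEEqFun.coeFn_smul _ _).symm, fun η hη => ?_⟩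
  have t1 := hφ.2.2.2.2 η hη
  rw [show (r • φ).val = r • φ.val from rfl, show (r • φ).pt = r • φ.pt from rfl,
    show (r • φ).pθ = r • φ.pθ from rfl, show (r • φ).trace = r • φ.trace from rfl,
    integral_smul_mul, integral_smul_mul, integral_smul_mul, integral_smul_mul, integral_smul_mul]
  exact ⟨by rw [t1.1]; ring, by rw [t1.2]; ring⟩

end HasWeakGradTrace

lemma integrable_weighted_add {α : Type*} [MeasurableSpace α] {μ : Measure α} {W : α → ℝ}
    {f g : α →ₘ[μ] ℝ} (mW : AEStronglyMeasurable W μ) (hW : ∀ᵐ z ∂μ, 0 ≤ W z)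
    (hf : Integrable (fun z => W z * f z ^ 2) μ) (hg : Integrable (fun z => W z * g z ^ 2) μ) :
    Integrable (fun z => W z * (f + g : α →ₘ[μ] ℝ) z ^ 2) μ := by
  refine ((hf.const_mul 2).add (hg.const_mul 2)).mono'
    (mW.mul ((f + g).aestronglyMeasurable.pow 2)) ?_
  filter_upwards [hW, AEEqFun.coeFn_add f g] with z h1 h2
  rw [h2, Pi.add_apply, norm_eq_abs, abs_of_nonneg (by positivity), Pi.add_apply]
  nlinarith [mul_nonneg h1 (sq_nonneg (f z - g z))]

lemma integrable_weighted_smul {α : Type*} [MeasurableSpace α] {μ : Measure α} {W : α → ℝ}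
    {f : α →ₘ[μ] ℝ} (r : ℝ) (hf : Integrable (fun z => W z * f z ^ 2) μ) :
    Integrable (fun z => W z * (r • f : α →ₘ[μ] ℝ) z ^ 2) μ := by
  refine (hf.const_mul (r ^ 2)).congr ?_
  filter_upwards [AEEqFun.coeFn_smul r f] with z h2
  rw [h2, Pi.smul_apply, smul_eq_mul]; ring

lemma integrable_weighted_mul {α : Type*} [MeasurableSpace α] {μ : Measure α} {W : α → ℝ}
    {f g : α →ₘ[μ] ℝ} (mW : AEStronglyMeasurable W μ) (hW : ∀ᵐ z ∂μ, 0 ≤ W z)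
    (hf : Integrable (fun z => W z * f z ^ 2) μ) (hg : Integrable (fun z => W z * g z ^ 2) μ) :
    Integrable (fun z => W z * (f z * g z)) μ := by
  refine (hf.add hg).mono' (mW.mul (f.aestronglyMeasurable.mul g.aestronglyMeasurable)) ?_
  filter_upwards [hW] with z h1
  rw [norm_mul, norm_mul, norm_eq_abs, norm_eq_abs, norm_eq_abs, abs_of_nonneg h1, Pi.add_apply,
    ← sq_abs (f z), ← sq_abs (g z)]
  nlinarith [mul_nonneg h1 (sq_nonneg (|f z| - |g z|)), mul_nonneg h1 (sq_nonneg |f z|),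
    mul_nonneg h1 (sq_nonneg |g z|)]

namespace IsFace

variable {X : ℝ × ℝ → E3} {w V σ ρ : ℝ → ℝ} {β : ℝ} {φ φ' ψ : Jet}

lemma meas_comp_fst {W : ℝ → ℝ} (h : ContinuousOn W (Ioi 0)) :
    AEStronglyMeasurable (fun z : ℝ × ℝ => W z.1) stripMeasure := by
  rw [stripMeasure_eq]
  exact (h.aestronglyMeasurable measurableSet_Ioi).comp_fst

lemma ae_w (hX : IsFace X w V σ ρ β) : ∀ᵐ z ∂stripMeasure, 0 ≤ w z.1 := by
  filter_upwards [ae_strip_pos] with z hz using (hX.w_pos hz.le).le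

lemma ae_w_inv (hX : IsFace X w V σ ρ β) : ∀ᵐ z ∂stripMeasure, 0 ≤ (w z.1)⁻¹ := by
  filter_upwards [ae_strip_pos] with z hz using (inv_pos.2 (hX.w_pos hz.le)).le

lemma memWStar_add (hX : IsFace X w V σ ρ β) (hφ : MemWStar X φ) (hψ : MemWStar X ψ) :
    MemWStar X (φ + ψ) := by
  refine ⟨(hX.finiteEnergy_iff _).2 ⟨(hX.weak hφ).add (hX.weak hψ),
    integrable_weighted_add (meas_comp_fst hX.cont_w') hX.ae_w (hX.int_pt hφ) (hX.int_pt hψ),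
    integrable_weighted_add (meas_comp_fst hX.cont_w_inv) hX.ae_w_inv (hX.int_pθ hφ)
      (hX.int_pθ hψ),
    ((hX.memLp_trace hφ).add (hX.memLp_trace hψ)).ae_eq (AEEqFun.coeFn_add _ _).symm⟩,
    (hX.memLp_star_iff _).2 (integrable_weighted_add (meas_comp_fst hX.cont_σ.continuousOn) ?_
      (hX.int_σ_val hφ) (hX.int_σ_val hψ))⟩
  filter_upwards [ae_strip_pos] with z hz using (hX.σ_pos _ hz.le).le

lemma finiteEnergy_smul (hX : IsFace X w V σ ρ β) (r : ℝ) (hφ : FiniteEnergy X φ) :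
    FiniteEnergy X (r • φ) := by
  rw [hX.finiteEnergy_iff] at hφ ⊢
  exact ⟨hφ.1.smul r, integrable_weighted_smul r hφ.2.1, integrable_weighted_smul r hφ.2.2.1,
    (hφ.2.2.2.const_smul r).ae_eq (AEEqFun.coeFn_smul _ _).symm⟩

lemma memWStar_smul (hX : IsFace X w V σ ρ β) (r : ℝ) (hφ : MemWStar X φ) :
    MemWStar X (r • φ) :=
  ⟨hX.finiteEnergy_smul r hφ.1,
    (hX.memLp_star_iff _).2 (integrable_weighted_smul r (hX.int_σ_val hφ))⟩

lemma memWc_smul (hX : IsFace X w V σ ρ β) (r : ℝ) (hφ : MemWc X φ) : MemWc X (r • φ) := by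
  refine ⟨hX.finiteEnergy_smul r hφ.1,
    (hX.memLp_area_iff _).2 (integrable_weighted_smul r ((hX.memLp_area_iff _).1 hφ.2.1)), ?_⟩
  obtain ⟨b, hb⟩ := hφ.2.2
  refine ⟨b, ?_⟩
  filter_upwards [hb, AEEqFun.coeFn_smul r φ.val] with z h1 h2 h3
  rw [show (r • φ).val = r • φ.val from rfl, h2, Pi.smul_apply, h1 h3, smul_zero]

lemma int_form (hX : IsFace X w V σ ρ β) (hφ : MemWStar X φ) (hψ : MemWStar X ψ) :
    Integrable (fun z => w z.1 * (φ.pt z * ψ.pt z)) stripMeasure ∧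
    Integrable (fun z => (w z.1)⁻¹ * (φ.pθ z * ψ.pθ z)) stripMeasure ∧
    Integrable (fun z => V z.1 * (φ.val z * ψ.val z)) stripMeasure ∧
    Integrable (fun θ => φ.trace θ * ψ.trace θ) circleMeasure :=
  ⟨integrable_weighted_mul (meas_comp_fst hX.cont_w') hX.ae_w (hX.int_pt hφ) (hX.int_pt hψ),
    integrable_weighted_mul (meas_comp_fst hX.cont_w_inv) hX.ae_w_inv (hX.int_pθ hφ)
      (hX.int_pθ hψ),
    integrable_weighted_mul (meas_comp_fst hX.cont_V.continuousOn)
      (ae_of_all _ fun z => hX.V_nonneg z.1) (hX.int_V_val hφ) (hX.int_V_val hψ),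
    (hX.memLp_trace hφ).integrable_mul (hX.memLp_trace hψ)⟩

lemma form_add_left (hX : IsFace X w V σ ρ β) (hφ : MemWStar X φ) (hφ' : MemWStar X φ')
    (hψ : MemWStar X ψ) :
    faceForm X (φ + φ') ψ - boundaryForm X (φ + φ') ψ =
      (faceForm X φ ψ - boundaryForm X φ ψ) + (faceForm X φ' ψ - boundaryForm X φ' ψ) := by
  obtain ⟨i1, i2, i3, i4⟩ := hX.int_form hφ hψ
  obtain ⟨j1, j2, j3, j4⟩ := hX.int_form hφ' hψ
  have e1 : faceForm X (φ + φ') ψ = faceForm X φ ψ + faceForm X φ' ψ := by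
    rw [hX.faceForm_eq, hX.faceForm_eq, hX.faceForm_eq,
      ← integral_add (by exact (i1.add i2).sub i3) (by exact (j1.add j2).sub j3)]
    refine integral_congr_ae ?_
    filter_upwards [AEEqFun.coeFn_add φ.val φ'.val, AEEqFun.coeFn_add φ.pt φ'.pt,
      AEEqFun.coeFn_add φ.pθ φ'.pθ] with z h1 h2 h3
    rw [show (φ + φ').val = φ.val + φ'.val from rfl, show (φ + φ').pt = φ.pt + φ'.pt from rfl,
      show (φ + φ').pθ = φ.pθ + φ'.pθ from rfl, h1, h2, h3]
    simp only [Pi.add_apply]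
    ring
  have e2 : boundaryForm X (φ + φ') ψ = boundaryForm X φ ψ + boundaryForm X φ' ψ := by
    rw [hX.boundaryForm_eq, hX.boundaryForm_eq, hX.boundaryForm_eq, ← mul_add, ← integral_add i4 j4]
    congr 1
    refine integral_congr_ae ?_
    filter_upwards [AEEqFun.coeFn_add φ.trace φ'.trace] with z h1
    rw [show (φ + φ').trace = φ.trace + φ'.trace from rfl, h1, Pi.add_apply, add_mul]
  rw [e1, e2]; ring

lemma form_smul_left (hX : IsFace X w V σ ρ β) (r : ℝ) (φ ψ : Jet) :
    faceForm X (r • φ) ψ - boundaryForm X (r • φ) ψ =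
      r * (faceForm X φ ψ - boundaryForm X φ ψ) := by
  have e1 : faceForm X (r • φ) ψ = r * faceForm X φ ψ := by
    rw [hX.faceForm_eq, hX.faceForm_eq, ← integral_const_mul]
    refine integral_congr_ae ?_
    filter_upwards [AEEqFun.coeFn_smul r φ.val, AEEqFun.coeFn_smul r φ.pt,
      AEEqFun.coeFn_smul r φ.pθ] with z h1 h2 h3
    rw [show (r • φ).val = r • φ.val from rfl, show (r • φ).pt = r • φ.pt from rfl,
      show (r • φ).pθ = r • φ.pθ from rfl, h1, h2, h3]
    simp only [Pi.smul_apply, smul_eq_mul]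
    ring
  have e2 : boundaryForm X (r • φ) ψ = r * boundaryForm X φ ψ := by
    have := integral_smul_mul φ.trace r ψ.trace
    rw [hX.boundaryForm_eq, hX.boundaryForm_eq, show (r • φ).trace = r • φ.trace from rfl, this]
    ring
  rw [e1, e2]; ring

lemma form_comm (hX : IsFace X w V σ ρ β) (φ ψ : Jet) :
    faceForm X φ ψ - boundaryForm X φ ψ = faceForm X ψ φ - boundaryForm X ψ φ := by
  rw [hX.faceForm_eq, hX.faceForm_eq, hX.boundaryForm_eq, hX.boundaryForm_eq]
  simp_rw [mul_comm (φ.pt _), mul_comm (φ.pθ _), mul_comm (φ.val _), mul_comm (φ.trace _)]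

lemma memWc_zero (hX : IsFace X w V σ ρ β) : MemWc X 0 := by
  have z1 : ∀ᵐ z ∂stripMeasure, (0 : FaceFun) z = 0 := AEEqFun.coeFn_zero
  have z2 : ∀ᵐ z ∂circleMeasure, (0 : CircleFun) z = 0 := AEEqFun.coeFn_zero
  have hl : LocInt 0 := fun b => (integrable_zero _ _ _).congr (ae_restrict_of_ae (by
    filter_upwards [z1] with z hz using hz.symm))
  have hi : ∀ W : ℝ × ℝ → ℝ, Integrable (fun z => W z * (0 : FaceFun) z ^ 2) stripMeasure :=
    fun W => (integrable_zero _ _ _).congr (by filter_upwards [z1] with z hz; simp [hz])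
  have i1 : ∀ η : ℝ × ℝ → ℝ, ∫ z, (0 : FaceFun) z * η z ∂stripMeasure = 0 := fun η =>
    integral_eq_zero_of_ae (by filter_upwards [z1] with z hz; simp [hz])
  refine ⟨(hX.finiteEnergy_iff 0).2 ⟨⟨hl, hl, hl, ?_, fun η _ => ?_⟩, hi _, hi _, ?_⟩,
    (hX.memLp_area_iff _).2 (hi _), 0, ?_⟩
  · exact (integrable_zero _ _ _).congr (by filter_upwards [z2] with z hz; exact hz.symm)
  · have i2 : ∫ θ, (0 : CircleFun) θ * η (0, θ) ∂circleMeasure = 0 :=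
      integral_eq_zero_of_ae (by filter_upwards [z2] with z hz; simp [hz])
    refine ⟨?_, ?_⟩
    · exact (i1 _).trans (by
        rw [show Jet.trace 0 = (0 : CircleFun) from rfl, show Jet.pt 0 = (0 : FaceFun) from rfl,
          i1, i2]
        simp)
    · exact (i1 _).trans (by rw [show Jet.pθ 0 = (0 : FaceFun) from rfl, i1]; simp)
  · exact (MemLp.zero (p := 2) (ε := ℝ)).ae_eq (by filter_upwards [z2] with z hz; exact hz.symm)
  · filter_upwards [z1] with z hz _ using hz

lemma form_zero_right (hX : IsFace X w V σ ρ β) (φ : Jet) :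
    faceForm X φ 0 - boundaryForm X φ 0 = 0 := by
  have := hX.form_smul_left 0 0 φ
  rw [zero_smul, zero_mul, hX.form_comm] at this
  exact this

end IsFace

/-! ## Separated functions -/

lemma aestronglyMeasurable_separated {a e : ℝ → ℝ}
    (ha : AEStronglyMeasurable a (volume.restrict (Ioi 0))) (he : Continuous e) :
    AEStronglyMeasurable (fun z : ℝ × ℝ => a z.1 * e z.2) stripMeasure := by
  rw [stripMeasure_eq]
  exact ha.comp_fst.mul (he.comp continuous_snd).aestronglyMeasurable

/-- The function `a (t) e (θ)`, with its weak derivatives and trace. -/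
def sepJet {a p e : ℝ → ℝ} (h : IsPrim a p) (he : IsAngular e) : Jet :=
  (AEEqFun.mk _ (aestronglyMeasurable_separated h.meas he.continuous),
    AEEqFun.mk _ (aestronglyMeasurable_separated h.meas_deriv he.continuous),
    AEEqFun.mk _ (aestronglyMeasurable_separated h.meas he.deriv.continuous),
    AEEqFun.mk (fun θ => a 0 * e θ) (continuous_const.mul he.continuous).aestronglyMeasurable)

section SepJet

variable {a p e : ℝ → ℝ} (h : IsPrim a p) (he : IsAngular e)

lemma sepJet_val : (sepJet h he).val =ᵐ[stripMeasure] fun z => a z.1 * e z.2 :=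
  AEEqFun.coeFn_mk _ _

lemma sepJet_pt : (sepJet h he).pt =ᵐ[stripMeasure] fun z => p z.1 * e z.2 :=
  AEEqFun.coeFn_mk _ _

lemma sepJet_pθ : (sepJet h he).pθ =ᵐ[stripMeasure] fun z => a z.1 * deriv e z.2 :=
  AEEqFun.coeFn_mk _ _

lemma sepJet_trace : (sepJet h he).trace =ᵐ[circleMeasure] fun θ => a 0 * e θ :=
  AEEqFun.coeFn_mk _ _

lemma integrable_circle_of_continuous {e : ℝ → ℝ} (he : Continuous e) :
    Integrable e circleMeasure := by
  unfold circleMeasure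
  exact loc_of_continuous he _

lemma integrableOn_separated {f e : ℝ → ℝ} (hf : ∀ b, IntegrableOn f (Ioc 0 b))
    (he : Continuous e) (b : ℝ) :
    IntegrableOn (fun z : ℝ × ℝ => f z.1 * e z.2) (Iio b ×ˢ univ) stripMeasure := by
  rw [IntegrableOn, stripMeasure_eq, ← Measure.prod_restrict, Measure.restrict_univ,
    Measure.restrict_restrict measurableSet_Iio]
  refine Integrable.mul_prod (IntegrableOn.mono_set (hf b) ?_) (integrable_circle_of_continuous he)
  exact fun x hx => ⟨hx.2, le_of_lt hx.1⟩

lemma integrable_separated {f e : ℝ → ℝ} (hf : IntegrableOn f (Ioi 0)) (he : Continuous e) :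
    Integrable (fun z : ℝ × ℝ => f z.1 * e z.2) stripMeasure := by
  rw [stripMeasure_eq]
  exact Integrable.mul_prod hf (integrable_circle_of_continuous he)

lemma integrableOn_integral_circle {g : ℝ × ℝ → ℝ} (h : Integrable g stripMeasure) :
    IntegrableOn (fun t => ∫ θ, g (t, θ) ∂circleMeasure) (Ioi 0) := by
  rw [stripMeasure_eq] at h
  exact h.integral_prod_left

lemma integral_strip_symm {g : ℝ × ℝ → ℝ} (h : Integrable g stripMeasure) :
    ∫ z, g z ∂stripMeasure = ∫ θ, (∫ t in Ioi 0, g (t, θ)) ∂circleMeasure := by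
  rw [stripMeasure_eq] at h ⊢
  exact integral_prod_symm _ h

/-- By Fubini, the `t`-identity is the product rule for `a · η(·, θ)` on each ray, and the
`θ`-identity is the vanishing integral of the derivative of a periodic function on each circle. -/
lemma hasWeakGradTrace_sepJet : HasWeakGradTrace (sepJet h he) := by
  have l1 : LocInt (sepJet h he).val := fun b =>
    (integrableOn_separated h.loc he.continuous b).congr (ae_restrict_of_ae (sepJet_val h he).symm)
  have l2 : LocInt (sepJet h he).pt := fun b =>
    (integrableOn_separated h.1 he.continuous b).congr (ae_restrict_of_ae (sepJet_pt h he).symm)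
  have l3 : LocInt (sepJet h he).pθ := fun b =>
    (integrableOn_separated h.loc he.deriv.continuous b).congr
      (ae_restrict_of_ae (sepJet_pθ h he).symm)
  refine ⟨l1, l2, l3, (integrable_circle_of_continuous (continuous_const.mul he.continuous)).congr
    (sepJet_trace h he).symm, fun η hη => ?_⟩
  obtain ⟨b, hb⟩ := hη.exists_vanish
  have i1 := l1.integrable_mul (hη.continuous_fderiv (1, 0)) fun t θ ht => (hb t θ ht).2 _
  have i2 := l2.integrable_mul hη.1.continuous fun t θ ht => (hb t θ ht).1
  have i3 := l1.integrable_mul (hη.continuous_fderiv (0, 1)) fun t θ ht => (hb t θ ht).2 _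
  have i4 := l3.integrable_mul hη.1.continuous fun t θ ht => (hb t θ ht).1
  constructor
  · have e3 : ∫ θ, (sepJet h he).trace θ * η (0, θ) ∂circleMeasure =
        ∫ θ, a 0 * e θ * η (0, θ) ∂circleMeasure := by
      refine integral_congr_ae ?_
      filter_upwards [sepJet_trace h he] with θ hθ using by rw [hθ]
    have key : ∫ z, ((sepJet h he).val z * fderiv ℝ η z (1, 0) + (sepJet h he).pt z * η z)
        ∂stripMeasure = -∫ θ, a 0 * e θ * η (0, θ) ∂circleMeasure := by
      have hae : (fun z => (sepJet h he).val z * fderiv ℝ η z (1, 0) + (sepJet h he).pt z * η z)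
          =ᵐ[stripMeasure] fun z => a z.1 * e z.2 * fderiv ℝ η z (1, 0) + p z.1 * e z.2 * η z := by
        filter_upwards [sepJet_val h he, sepJet_pt h he] with z h1 h2
        rw [h1, h2]
      rw [integral_congr_ae hae, integral_strip_symm ((i1.add i2).congr hae), ← integral_neg]
      congr 1
      funext θ
      have hχ := hη.isCutoff θ
      have j1 := hχ.integrableOn h.1
      have j2 := hχ.deriv.integrableOn h.loc
      have k1 := (h.mul hχ.isPrim).integral_Ioi_of_vanish (b := b)
        (fun t ht => by simp [(hb t θ ht).1]) (j1.add j2)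
      have k2 : ∫ t in Ioi 0, (a t * e θ * fderiv ℝ η (t, θ) (1, 0) + p t * e θ * η (t, θ)) =
          ∫ t in Ioi 0, e θ * (p t * η (t, θ) + a t * deriv (fun t => η (t, θ)) t) := by
        congr 1; funext t; rw [hη.deriv_fst]; ring
      simp only
      rw [k2, integral_const_mul, k1]
      ring
    rw [integral_add i1 i2] at key
    rw [e3]; linarith
  · have key : ∫ z, ((sepJet h he).val z * fderiv ℝ η z (0, 1) + (sepJet h he).pθ z * η z)
        ∂stripMeasure = 0 := by
      have hae : (fun z => (sepJet h he).val z * fderiv ℝ η z (0, 1) + (sepJet h he).pθ z * η z)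
          =ᵐ[stripMeasure] fun z => a z.1 * e z.2 * fderiv ℝ η z (0, 1) +
            a z.1 * deriv e z.2 * η z := by
        filter_upwards [sepJet_val h he, sepJet_pθ h he] with z h1 h2
        rw [h1, h2]
      rw [integral_congr_ae hae, integral_strip ((i3.add i4).congr hae)]
      refine integral_eq_zero_of_ae (ae_of_all _ fun t => ?_)
      have hang := he.mul (hη.isAngular t)
      have k2 : ∫ θ, (a t * e θ * fderiv ℝ η (t, θ) (0, 1) + a t * deriv e θ * η (t, θ))
          ∂circleMeasure = ∫ θ, a t * deriv (fun θ => e θ * η (t, θ)) θ ∂circleMeasure := by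
        congr 1; funext θ
        rw [((he.hasDerivAt θ).fun_mul ((hη.isAngular t).hasDerivAt θ)).deriv, hη.deriv_snd]
        ring
      simp only [Pi.zero_apply]
      rw [k2, integral_const_mul, hang.integral_deriv, mul_zero]
    rw [integral_add i3 i4] at key
    linarith

variable {X : ℝ × ℝ → E3} {w V σ ρ : ℝ → ℝ} {β : ℝ}

/-- The alternative is needed for radial functions such as `tnh` or constants, which have no angular
energy although `a² / w` is not integrable. -/
lemma IsFace.finiteEnergy_sepJet (hX : IsFace X w V σ ρ β)
    (h1 : IntegrableOn (fun t => w t * p t ^ 2) (Ioi 0))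
    (h2 : (∀ θ, deriv e θ = 0) ∨ IntegrableOn (fun t => (w t)⁻¹ * a t ^ 2) (Ioi 0)) :
    FiniteEnergy X (sepJet h he) := by
  refine (hX.finiteEnergy_iff _).2 ⟨hasWeakGradTrace_sepJet h he, ?_, ?_, ?_⟩
  · refine (integrable_separated (e := fun θ => e θ ^ 2) h1 (he.continuous.pow 2)).congr ?_
    filter_upwards [sepJet_pt h he] with z hz
    rw [hz]; ring
  · rcases h2 with h2 | h2
    · refine (integrable_zero _ _ _).congr ?_
      filter_upwards [sepJet_pθ h he] with z hz
      rw [hz, h2]; simp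
    · refine (integrable_separated (e := fun θ => deriv e θ ^ 2) h2
        (he.deriv.continuous.pow 2)).congr ?_
      filter_upwards [sepJet_pθ h he] with z hz
      rw [hz]; ring
  · rw [memLp_two_iff_integrable_sq (AEEqFun.aestronglyMeasurable _)]
    refine (integrable_circle_of_continuous (e := fun θ => (a 0 * e θ) ^ 2)
      ((continuous_const.mul he.continuous).pow 2)).congr ?_
    filter_upwards [sepJet_trace h he] with z hz
    rw [hz]

/-- Boundedness is enough because the logarithmic weight has finite total mass on the faces. -/
lemma IsFace.memWStar_sepJet (hX : IsFace X w V σ ρ β)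
    (h1 : IntegrableOn (fun t => w t * p t ^ 2) (Ioi 0))
    (h2 : (∀ θ, deriv e θ = 0) ∨ IntegrableOn (fun t => (w t)⁻¹ * a t ^ 2) (Ioi 0)) {C : ℝ}
    (h3 : ∀ t, 0 < t → |a t| ≤ C) : MemWStar X (sepJet h he) := by
  refine ⟨hX.finiteEnergy_sepJet h he h1 h2, (hX.memLp_star_iff _).2 ?_⟩
  have h4 : IntegrableOn (fun t => a t ^ 2 * σ t) (Ioi 0) :=
    integrableOn_bdd_mul (C := C ^ 2)
      ((h.continuousOn.mono Ioi_subset_Ici_self).pow 2) (fun t ht => by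
        rw [abs_pow]; exact pow_le_pow_left₀ (abs_nonneg _) (h3 t ht) 2) hX.int_σ
  refine (integrable_separated (e := fun θ => e θ ^ 2) h4 (he.continuous.pow 2)).congr ?_
  filter_upwards [sepJet_val h he] with z hz
  rw [hz]; ring

/-- The form of a separated function against an arbitrary function involves only one mode. -/
lemma IsFace.form_sepJet (hX : IsFace X w V σ ρ β) {m : ℝ}
    (hm : ∀ θ, deriv (deriv e) θ = -m * e θ) (hj : MemWStar X (sepJet h he)) {ψ : Jet}
    (hψ : MemWStar X ψ) :
    IntegrableOn (fun t => w t * p t * coef e ψ.pt t + (m * (w t)⁻¹ - V t) * a t * mode e ψ t)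
      (Ioi 0) ∧
    faceForm X (sepJet h he) ψ - boundaryForm X (sepJet h he) ψ =
      (∫ t in Ioi 0, (w t * p t * coef e ψ.pt t + (m * (w t)⁻¹ - V t) * a t * mode e ψ t)) -
        β * a 0 * mode e ψ 0 := by
  obtain ⟨i1, i2, i3, i4⟩ := hX.int_form hj hψ
  have hI := (i1.add i2).sub i3
  have hae : (fun z => w z.1 * ((sepJet h he).pt z * ψ.pt z) +
      (w z.1)⁻¹ * ((sepJet h he).pθ z * ψ.pθ z) - V z.1 * ((sepJet h he).val z * ψ.val z))
      =ᵐ[stripMeasure] fun z => w z.1 * p z.1 * (ψ.pt z * e z.2) +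
        (w z.1)⁻¹ * a z.1 * (ψ.pθ z * deriv e z.2) - V z.1 * a z.1 * (ψ.val z * e z.2) := by
    filter_upwards [sepJet_val h he, sepJet_pt h he, sepJet_pθ h he] with z h1 h2 h3
    rw [h1, h2, h3]; ring
  have eb : β * ∫ θ, (sepJet h he).trace θ * ψ.trace θ ∂circleMeasure = β * a 0 * mode e ψ 0 := by
    have : ∫ θ, (sepJet h he).trace θ * ψ.trace θ ∂circleMeasure =
        a 0 * ∫ θ, ψ.trace θ * e θ ∂circleMeasure := by
      rw [← integral_const_mul]
      refine integral_congr_ae ?_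
      filter_upwards [sepJet_trace h he] with θ hθ
      rw [hθ]; ring
    rw [this, mode_zero]; ring
  have hw := hX.weak hψ
  have slice : ∀ {f : ℝ → ℝ} {e : ℝ → ℝ}, MemLp f 2 circleMeasure → IsAngular e →
      Integrable (fun θ => f θ * e θ) circleMeasure := by
    intro f e hf he
    refine MemLp.integrable_mul (p := 2) (q := 2) hf ?_
    rw [memLp_two_iff_integrable_sq he.continuous.aestronglyMeasurable]
    exact integrable_circle_of_continuous (he.continuous.pow 2)
  have hsl : ∀ᵐ t ∂volume.restrict (Ioi 0), ∫ θ, (w t * p t * (ψ.pt (t, θ) * e θ) +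
      (w t)⁻¹ * a t * (ψ.pθ (t, θ) * deriv e θ) - V t * a t * (ψ.val (t, θ) * e θ)) ∂circleMeasure =
      w t * p t * coef e ψ.pt t + (m * (w t)⁻¹ - V t) * a t * mode e ψ t := by
    filter_upwards [hw.coef_val he, hw.coef_pθ he.deriv, hX.slice_pt hψ, hX.slice_pθ hψ,
      hX.slice_val hψ] with t h1 h2 s1 s2 s3
    have j1 := (slice s1 he).const_mul (w t * p t)
    have j2 := (slice s2 he.deriv).const_mul ((w t)⁻¹ * a t)
    have j3 := (slice s3 he).const_mul (V t * a t)
    rw [integral_sub (by exact j1.add j2) j3, integral_add j1 j2, integral_const_mul,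
      integral_const_mul, integral_const_mul]
    -- Moving the `θ`-derivative from `ψ` onto `e'` produces `-e'' = m e`, so the same mode
    -- reappears.
    have h3 : ∫ θ, ψ.pθ (t, θ) * deriv e θ ∂circleMeasure = m * mode e ψ t := by
      have : coef (deriv (deriv e)) ψ.val t = -m * coef e ψ.val t := by
        rw [coef, coef, ← integral_const_mul]
        congr 1; funext θ; rw [hm]; ring
      have hc : ∫ θ, ψ.pθ (t, θ) * deriv e θ ∂circleMeasure = coef (deriv e) ψ.pθ t := rfl
      rw [this] at h2
      rw [← h1, hc]
      linear_combination h2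
    have h4 : ∫ θ, ψ.val (t, θ) * e θ ∂circleMeasure = mode e ψ t := h1
    rw [h3, h4]
    simp only [coef]
    ring
  have hI' := hI.congr hae
  refine ⟨(integrableOn_integral_circle hI').congr hsl, ?_⟩
  rw [hX.faceForm_eq, hX.boundaryForm_eq, integral_congr_ae hae, integral_strip hI', eb,
    integral_congr_ae hsl]

end SepJet

/-! ## Lower bounds for the indices -/

variable {c : ℝ}

section SepJetModes

variable {a p e : ℝ → ℝ} (h : IsPrim a p) (he : IsAngular e)

lemma coef_congr_ae {f g : ℝ × ℝ → ℝ} (hfg : f =ᵐ[stripMeasure] g) (d : ℝ → ℝ) :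
    coef d f =ᵐ[volume.restrict (Ioi 0)] coef d g := by
  rw [stripMeasure_eq] at hfg
  filter_upwards [Measure.ae_ae_of_ae_prod hfg] with s hs
  refine integral_congr_ae ?_
  filter_upwards [hs] with θ hθ
  rw [hθ]

lemma coef_sepJet_pt (d : ℝ → ℝ) : ∀ᵐ t ∂volume.restrict (Ioi 0),
    coef d (sepJet h he).pt t = (∫ θ, e θ * d θ ∂circleMeasure) * p t := by
  filter_upwards [coef_congr_ae (sepJet_pt h he) d] with t ht
  rw [ht, coef, mul_comm, ← integral_const_mul]
  simp_rw [mul_assoc]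

lemma mode_sepJet {d : ℝ → ℝ} {t : ℝ} (ht : 0 ≤ t) :
    mode d (sepJet h he) t = (∫ θ, e θ * d θ ∂circleMeasure) * a t := by
  have h1 : ∫ θ, (sepJet h he).trace θ * d θ ∂circleMeasure =
      a 0 * ∫ θ, e θ * d θ ∂circleMeasure := by
    rw [← integral_const_mul]
    refine integral_congr_ae ?_
    filter_upwards [sepJet_trace h he] with θ hθ
    rw [hθ, mul_assoc]
  have h2 : ∫ s in (0)..t, coef d (sepJet h he).pt s =
      ∫ s in (0)..t, (∫ θ, e θ * d θ ∂circleMeasure) * p s := by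
    rw [intervalIntegral.integral_of_le ht, intervalIntegral.integral_of_le ht]
    refine integral_congr_ae (ae_restrict_of_ae_restrict_of_subset Ioc_subset_Ioi_self ?_)
    exact coef_sepJet_pt h he d
  rw [mode, h1, h2, intervalIntegral.integral_const_mul, h.2 t ht]
  ring

variable {X : ℝ × ℝ → E3} {w V σ ρ : ℝ → ℝ} {β : ℝ}

lemma IsFace.form_sepJet_self (hX : IsFace X w V σ ρ β) {m : ℝ}
    (hm : ∀ θ, deriv (deriv e) θ = -m * e θ) (hj : MemWStar X (sepJet h he)) :
    faceForm X (sepJet h he) (sepJet h he) - boundaryForm X (sepJet h he) (sepJet h he) =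
      (∫ θ, e θ * e θ ∂circleMeasure) * modeForm w V β m a p := by
  rw [(hX.form_sepJet h he hm hj hj).2, mode_sepJet h he le_rfl, modeForm, mul_sub,
    ← integral_const_mul]
  congr 1
  · refine integral_congr_ae ?_
    filter_upwards [coef_sepJet_pt h he e, ae_restrict_mem measurableSet_Ioi] with t h1 h2
    rw [h1, mode_sepJet h he (le_of_lt h2)]
    ring
  · ring

end SepJetModes

/-! ### The destabilizing tent function -/

/-- The derivative of a tent function with support in `[0, 14]`, equal to one on `[1, 4]`. -/
def tentSlope (t : ℝ) : ℝ :=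
  (Ioc 0 1).indicator 1 t - 1 / 10 * (Ioc 4 14).indicator 1 t

/-- A tent function with support in `[0, 14]`, equal to one on `[1, 4]`. -/
def tent (t : ℝ) : ℝ := ∫ s in (0)..t, tentSlope s

lemma integrable_indicator_one (x y : ℝ) :
    Integrable (fun t => (Ioc x y).indicator (1 : ℝ → ℝ) t) :=
  (integrable_indicator_iff measurableSet_Ioc).2 (by
    rw [show (1 : ℝ → ℝ) = fun _ => 1 from rfl]; exact integrableOn_const (by simp))

lemma integral_indicator_one {x y t : ℝ} (ht : 0 ≤ t) :
    ∫ s in (0)..t, (Ioc x y).indicator (1 : ℝ → ℝ) s = max (min t y - max 0 x) 0 := by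
  rw [intervalIntegral.integral_of_le ht, integral_indicator measurableSet_Ioc,
    Measure.restrict_restrict measurableSet_Ioc, Ioc_inter_Ioc]
  simp [Measure.real, ENNReal.toReal_ofReal', max_comm, min_comm]

lemma integrable_tentSlope : Integrable tentSlope :=
  (integrable_indicator_one 0 1).sub ((integrable_indicator_one 4 14).const_mul _)

lemma tent_eq {t : ℝ} (ht : 0 ≤ t) :
    tent t = max (min t 1 - max 0 0) 0 - 1 / 10 * max (min t 14 - max 0 4) 0 := by
  have h1 := fun x y : ℝ => (integrable_indicator_one x y).intervalIntegrable (a := 0) (b := t)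
  simp only [tent, tentSlope]
  rw [intervalIntegral.integral_sub (h1 0 1) ((h1 4 14).const_mul _),
    intervalIntegral.integral_const_mul, integral_indicator_one ht, integral_indicator_one ht]

lemma isPrim_tent : IsPrim tent tentSlope :=
  ⟨fun _ => integrable_tentSlope.integrableOn, fun t _ => by simp [tent]⟩

lemma tent_zero : tent 0 = 0 := by simp [tent]

lemma tent_eq_one {t : ℝ} (h1 : 1 ≤ t) (h2 : t ≤ 4) : tent t = 1 := by
  have h3 : min t 14 - max 0 4 ≤ 0 := by
    rw [min_eq_left (by linarith), max_eq_right (by norm_num)]; linarith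
  rw [tent_eq (by linarith), min_eq_right h1, max_eq_right h3]
  norm_num

lemma tent_eq_zero {t : ℝ} (h1 : 14 ≤ t) : tent t = 0 := by
  rw [tent_eq (by linarith), min_eq_right (by linarith), min_eq_right h1]
  norm_num

/-- The rising and falling intervals are disjoint, so there is no cross term. -/
lemma tentSlope_sq (t : ℝ) : tentSlope t ^ 2 =
    (Ioc 0 1).indicator 1 t + 1 / 100 * (Ioc 4 14).indicator (1 : ℝ → ℝ) t := by
  simp only [tentSlope, indicator_apply, mem_Ioc, Pi.one_apply]
  split_ifs with h1 h2 <;> first | (exfalso; linarith [h1.2, h2.1]) | norm_num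

lemma integrable_tentSlope_sq : Integrable fun t => tentSlope t ^ 2 := by
  simp_rw [tentSlope_sq]
  exact (integrable_indicator_one 0 1).add ((integrable_indicator_one 4 14).const_mul _)

lemma integral_tentSlope_sq : ∫ t in Ioi 0, tentSlope t ^ 2 = 11 / 10 := by
  simp_rw [tentSlope_sq]
  rw [integral_add (integrable_indicator_one 0 1).integrableOn
    ((integrable_indicator_one 4 14).const_mul _).integrableOn, integral_const_mul,
    setIntegral_indicator measurableSet_Ioc, setIntegral_indicator measurableSet_Ioc]
  have h1 : Ioi (0:ℝ) ∩ Ioc 0 1 = Ioc 0 1 := inter_eq_right.2 fun x hx => hx.1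
  have h2 : Ioi (0:ℝ) ∩ Ioc 4 14 = Ioc 4 14 :=
    inter_eq_right.2 fun x hx => lt_trans (by norm_num) hx.1
  rw [h1, h2]
  simp [Measure.real]
  norm_num

lemma tnh_eq_exp (t : ℝ) : tnh t = (rexp (2 * t) - 3) / (rexp (2 * t) + 3) := by
  have h3 : (√3 : ℝ) ^ 2 = 3 := Real.sq_sqrt (by norm_num)
  have h4 : 0 < √3 := by positivity
  have h5 := Real.exp_pos t
  rw [tnh, Real.tanh_eq_sinh_div_cosh, Real.sinh_eq, Real.cosh_eq, neg_sub, Real.exp_sub,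
    Real.exp_sub, exp_log_sqrt_three, show 2 * t = t + t by ring, Real.exp_add]
  field_simp
  rw [h3]
  ring

/-- The threshold is half the energy `11 / 10` of the tent; numerically the difference is about
`0.57`, so crude bounds on `e` suffice. -/
lemma tnh_sub_gt : 11 / 20 < tnh 4 - tnh 1 := by
  have e1 : rexp 1 < 2.7182818286 := Real.exp_one_lt_d9
  have e2 : 2.7182818283 < rexp 1 := Real.exp_one_gt_d9
  have e3 : rexp (2 * 1) = rexp 1 ^ 2 := by rw [← Real.exp_nat_mul]; norm_num
  have e4 : rexp (2 * 4) = rexp 1 ^ 8 := by rw [← Real.exp_nat_mul]; norm_num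
  rw [tnh_eq_exp, tnh_eq_exp, e3, e4]
  have h1 : rexp 1 ^ 2 ≤ 7.4 := by nlinarith
  have h2 : (2.7:ℝ) ^ 8 ≤ rexp 1 ^ 8 := pow_le_pow_left₀ (by norm_num) (by linarith) 8
  have h3 : (rexp 1 ^ 2 - 3) / (rexp 1 ^ 2 + 3) ≤ 0.44 := by
    rw [div_le_iff₀ (by positivity)]; linarith
  have h4 : 0.995 ≤ (rexp 1 ^ 8 - 3) / (rexp 1 ^ 8 + 3) := by
    rw [le_div_iff₀ (by positivity)]; norm_num at h2 ⊢; linarith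
  linarith

/-- The tent equals one on `[1, 4]`, where most of `∫ sch²` is concentrated, and falls slowly so
that its tail costs only `1 / 10`. The form is at most `11 / 10 - 2 (tnh 4 - tnh 1)`. -/
lemma modeForm_tent_neg :
    modeForm (fun _ => 1) (fun t => 2 * sch t ^ 2) (-1 / 2) 0 tent tentSlope < 0 := by
  have hc : ContinuousOn tent (Ici 0) := isPrim_tent.continuousOn
  obtain ⟨C, hC⟩ := (isCompact_Icc (a := (0:ℝ)) (b := 14)).exists_bound_of_continuousOn
    (hc.mono fun x hx => hx.1)
  have hb : ∀ t, 0 < t → |tent t ^ 2| ≤ C ^ 2 := fun t ht => by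
    rw [abs_pow]
    rcases le_total t 14 with h | h
    · exact pow_le_pow_left₀ (abs_nonneg _) (hC t ⟨ht.le, h⟩) 2
    · rw [tent_eq_zero h]; simp; positivity
  have i1 : IntegrableOn (fun t => tent t ^ 2 * sch t ^ 2) (Ioi 0) :=
    integrableOn_bdd_mul ((hc.mono Ioi_subset_Ici_self).pow 2) hb integrableOn_sch_sq
  have h1 : modeForm (fun _ => 1) (fun t => 2 * sch t ^ 2) (-1 / 2) 0 tent tentSlope =
      11 / 10 - 2 * ∫ t in Ioi 0, tent t ^ 2 * sch t ^ 2 := by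
    rw [modeForm, tent_zero, ← integral_tentSlope_sq, ← integral_const_mul,
      ← integral_sub integrable_tentSlope_sq.integrableOn (i1.const_mul 2)]
    simp only [one_mul, ne_eq, OfNat.ofNat_ne_zero, not_false_eq_true, zero_pow, mul_zero, sub_zero]
    congr 1; funext t; ring
  have h2 : tnh 4 - tnh 1 ≤ ∫ t in Ioi 0, tent t ^ 2 * sch t ^ 2 := by
    rw [← intervalIntegral.integral_eq_sub_of_hasDerivAt (fun x _ => hasDerivAt_tnh x)
      ((continuous_sch.pow 2).intervalIntegrable _ _),
      intervalIntegral.integral_of_le (by norm_num)]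
    calc ∫ t in Ioc 1 4, sch t ^ 2 = ∫ t in Ioc 1 4, tent t ^ 2 * sch t ^ 2 :=
          setIntegral_congr_fun measurableSet_Ioc fun t ht => by
            simp only [tent_eq_one ht.1.le ht.2]; ring
      _ ≤ _ := setIntegral_mono_set i1 (ae_of_all _ fun t => by
            simp only [Pi.zero_apply]; positivity)
          (LE.le.eventuallyLE fun t (ht : t ∈ Ioc 1 4) => lt_trans one_pos ht.1)
  have := tnh_sub_gt
  rw [h1]; linarith

/-- The tent function on a face. -/
def tentJet : Jet := sepJet isPrim_tent isAngular_one

lemma tentJet_trace : tentJet.trace = 0 := by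
  refine AEEqFun.ext ?_
  filter_upwards [sepJet_trace isPrim_tent isAngular_one,
    AEEqFun.coeFn_zero (α := ℝ) (β := ℝ) (μ := circleMeasure)] with θ h1 h2
  rw [h2, tentJet, h1, tent_zero, zero_mul]; rfl

section

variable {X : ℝ × ℝ → E3} {w V σ ρ : ℝ → ℝ} {β : ℝ}

lemma IsFace.memWc_tentJet (hX : IsFace X w V σ ρ β) : MemWc X tentJet := by
  have hs : ∀ t, 14 < t → tentSlope t = 0 := fun t ht => by
    rw [tentSlope, indicator_of_notMem, indicator_of_notMem]
    · simp
    · exact fun h => by linarith [h.2]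
    · exact fun h => by linarith [h.2]
  have cut : ∀ {f : ℝ → ℝ}, IntegrableOn f (Ioc 0 14) → (∀ t, 14 < t → f t = 0) →
      IntegrableOn f (Ioi 0) := fun hf h0 => hf.of_forall_sdiff_eq_zero measurableSet_Ioi
    fun t ht => h0 t (by by_contra hlt; exact ht.2 ⟨ht.1, not_lt.1 hlt⟩)
  have ic : Icc (0:ℝ) 14 ⊆ Ici 0 := fun x hx => hx.1
  refine ⟨hX.finiteEnergy_sepJet _ _ ?_ (Or.inl fun θ => by simp), ?_, 14, ?_⟩
  · refine cut ?_ fun t ht => by simp [hs t ht]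
    have h1 : IntegrableOn (fun t => tentSlope t ^ 2) (Icc 0 14) :=
      integrable_tentSlope_sq.integrableOn
    exact (h1.continuousOn_mul (hX.cont_w.mono ic) isCompact_Icc).mono_set Ioc_subset_Icc_self
  · rw [hX.memLp_area_iff]
    have h1 : IntegrableOn (fun t => ρ t * tent t ^ 2) (Ioi 0) := by
      refine cut ?_ fun t ht => by simp [tent_eq_zero ht.le]
      exact ((hX.cont_ρ.continuousOn.mul
        ((isPrim_tent.continuousOn.mono ic).pow 2)).integrableOn_Icc).mono_set Ioc_subset_Icc_self
    refine (integrable_separated (e := fun _ => 1) h1 continuous_const).congr ?_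
    filter_upwards [sepJet_val isPrim_tent isAngular_one] with z hz
    rw [tentJet, hz]; ring
  · filter_upwards [sepJet_val isPrim_tent isAngular_one] with z hz h14
    rw [tentJet, hz, tent_eq_zero h14.le, zero_mul]

end

lemma form_tentJet_neg {κ : ℝ} (hc : 0 < c) (hκ : κ ^ 2 = 1) :
    faceForm (catenoidFace c κ) tentJet tentJet -
      boundaryForm (catenoidFace c κ) tentJet tentJet < 0 := by
  have hX := isFace_catenoidFace hc hκ
  rw [tentJet, hX.form_sepJet_self (m := 0) _ _ (by simp)
    (hX.memWStar_of_memWc hX.memWc_tentJet)]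
  refine mul_neg_of_pos_of_neg ?_ modeForm_tent_neg
  simp [circleMeasure, Measure.real, ENNReal.toReal_ofReal pi_pos.le, pi_pos]

lemma tentJet_ne_zero : tentJet ≠ 0 := by
  intro h
  -- The tent function does not involve `c` or `κ`, so any values may be used; negative energy rules
  -- out zero.
  have h1 := form_tentJet_neg one_pos (κ := 1) (by norm_num)
  rw [h] at h1
  exact h1.ne ((isFace_catenoidFace one_pos (by norm_num)).form_zero_right 0)

/-- The Dirichlet index of a catenoidal face is one. -/
lemma hasIndex_dirichlet_catenoid {κ : ℝ} (hc : 0 < c) (hκ : κ ^ 2 = 1) :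
    HasIndex (WDirichlet (catenoidFace c κ)) (faceForm (catenoidFace c κ)) 1 := by
  have hX := isFace_catenoidFace hc hκ
  refine ⟨⟨Submodule.span ℝ {tentJet}, ?_, inferInstance, finrank_span_singleton tentJet_ne_zero,
    ?_⟩, ?_⟩
  · intro φ hφ
    obtain ⟨r, rfl⟩ := Submodule.mem_span_singleton.1 hφ
    refine ⟨hX.memWc_smul r hX.memWc_tentJet, ?_⟩
    rw [show (r • tentJet).trace = r • tentJet.trace from rfl, tentJet_trace, smul_zero]
  · intro φ hφ h0
    obtain ⟨r, rfl⟩ := Submodule.mem_span_singleton.1 hφ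
    have hr : r ≠ 0 := fun h => h0 (by rw [h, zero_smul])
    have ht : (r • tentJet).trace = 0 := by
      rw [show (r • tentJet).trace = r • tentJet.trace from rfl, tentJet_trace, smul_zero]
    have h1 := hX.form_smul_left r tentJet (r • tentJet)
    rw [boundaryForm_zero_of_trace hX ht, sub_zero, hX.form_comm tentJet, hX.form_smul_left] at h1
    rw [h1, ← mul_assoc]
    exact mul_neg_of_pos_of_neg (mul_self_pos.2 hr) (form_tentJet_neg hc hκ)
  · rintro k ⟨S, h1, h2, rfl, h3⟩
    exact finrank_le_one hc hκ h1 h3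

/-- The Dirichlet index of the planar face is zero. -/
lemma hasIndex_dirichlet_plane (hc : 0 < c) :
    HasIndex (WDirichlet (planeFace c)) (faceForm (planeFace c)) 0 := by
  refine ⟨⟨⊥, ?_, inferInstance, finrank_bot ℝ _, ?_⟩, ?_⟩
  · intro φ hφ
    rw [(Submodule.mem_bot ℝ).1 hφ]
    exact ⟨(isFace_planeFace hc).memWc_zero, rfl⟩
  · intro φ hφ h0
    exact absurd ((Submodule.mem_bot ℝ).1 hφ) h0
  · rintro k ⟨S, h1, h2, rfl, h3⟩
    have : S = ⊥ := by
      rw [Submodule.eq_bot_iff]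
      intro φ hφ
      by_contra h0
      exact absurd (h3 φ hφ h0) (not_lt.2 (faceForm_plane_nonneg hc φ))
    rw [this, finrank_bot]

/-- The variations `(x f, 0, y f)`, where `f` is the tent function. -/
def tentMap : (ℝ × ℝ) →ₗ[ℝ] JFun where
  toFun x := ![x.1 • tentJet, 0, x.2 • tentJet]
  map_add' x y := by
    ext1 i; fin_cases i <;> simp [add_smul]
  map_smul' r x := by
    ext1 i; fin_cases i <;> simp [mul_smul]

lemma tentMap_injective : Function.Injective tentMap := by
  rw [← LinearMap.ker_eq_bot, LinearMap.ker_eq_bot']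
  intro x hx
  have h0 : x.1 • tentJet = 0 := congrFun hx 0
  have h2 : x.2 • tentJet = 0 := congrFun hx 2
  exact Prod.ext ((smul_eq_zero.1 h0).resolve_right tentJet_ne_zero)
    ((smul_eq_zero.1 h2).resolve_right tentJet_ne_zero)

lemma tentMap_mem (hc : 0 < c) (x : ℝ × ℝ) : tentMap x ∈ WDeltaC (pseudoYCatenoid c) := by
  refine ⟨fun i => ?_, ?_⟩
  · fin_cases i
    · exact (isFace_zero hc).memWc_smul _ (isFace_zero hc).memWc_tentJet
    · exact (isFace_one hc).memWc_zero
    · exact (isFace_two hc).memWc_smul _ (isFace_two hc).memWc_tentJet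
  · change x.1 • tentJet.trace + 0 + x.2 • tentJet.trace = 0
    rw [tentJet_trace]; simp

lemma indexForm_tentMap_neg (hc : 0 < c) {x : ℝ × ℝ} (hx : x ≠ 0) :
    indexForm (pseudoYCatenoid c) (tentMap x) (tentMap x) < 0 := by
  have hf : ∀ {X : ℝ × ℝ → E3} {w V σ ρ : ℝ → ℝ} {β : ℝ}, IsFace X w V σ ρ β → ∀ r : ℝ,
      faceForm X (r • tentJet) (r • tentJet) - boundaryForm X (r • tentJet) (r • tentJet) =
        r ^ 2 * (faceForm X tentJet tentJet - boundaryForm X tentJet tentJet) := by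
    intro X w V σ ρ β hX r
    rw [hX.form_smul_left, hX.form_comm, hX.form_smul_left]; ring
  rw [indexForm, Fin.sum_univ_three]
  have e0 := hf (isFace_zero hc) x.1
  have e1 := (isFace_one hc).form_zero_right 0
  have e2 := hf (isFace_two hc) x.2
  have n0 : faceForm (pseudoYCatenoid c 0) tentJet tentJet -
    boundaryForm (pseudoYCatenoid c 0) tentJet tentJet < 0 := form_tentJet_neg hc (by norm_num)
  have n2 : faceForm (pseudoYCatenoid c 2) tentJet tentJet -
    boundaryForm (pseudoYCatenoid c 2) tentJet tentJet < 0 := form_tentJet_neg hc (by norm_num)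
  rw [show tentMap x 0 = x.1 • tentJet from rfl, show tentMap x 1 = 0 from rfl,
    show tentMap x 2 = x.2 • tentJet from rfl, e0, e1, e2, add_zero]
  by_cases h : x.1 = 0
  · have : x.2 ≠ 0 := fun h' => hx (Prod.ext h h')
    have := pow_pos (abs_pos.2 this) 2
    rw [sq_abs] at this
    nlinarith [sq_nonneg x.1]
  · have := pow_pos (abs_pos.2 h) 2
    rw [sq_abs] at this
    nlinarith [sq_nonneg x.2]

lemma wDeltaC_subset_wDeltaStar (hc : 0 < c) :
    WDeltaC (pseudoYCatenoid c) ⊆ WDeltaStar (pseudoYCatenoid c) := fun φ hφ => by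
  refine ⟨fun i => ?_, hφ.2⟩
  have := hφ.1 i
  fin_cases i
  · exact (isFace_zero hc).memWStar_of_memWc this
  · exact (isFace_one hc).memWStar_of_memWc this
  · exact (isFace_two hc).memWStar_of_memWc this

/-- The negative subspace already lies in the compactly supported space and the upper bound holds in
the larger weighted space, so both indices are found at once. -/
lemma hasIndex_two (hc : 0 < c) {D : Set JFun} (h1 : WDeltaC (pseudoYCatenoid c) ⊆ D)
    (h2 : D ⊆ WDeltaStar (pseudoYCatenoid c)) : HasIndex D (indexForm (pseudoYCatenoid c)) 2 := by
  refine ⟨⟨LinearMap.range tentMap, ?_, inferInstance, ?_, ?_⟩, ?_⟩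
  · rintro _ ⟨x, rfl⟩
    exact h1 (tentMap_mem hc x)
  · rw [LinearMap.finrank_range_of_inj tentMap_injective]; simp
  · rintro _ ⟨x, rfl⟩ h0
    exact indexForm_tentMap_neg hc fun h => h0 (by rw [h, map_zero])
  · rintro k ⟨S, h3, h4, rfl, h5⟩
    exact finrank_le_two hc (h3.trans h2) h5

/-! ## The null space as a submodule -/

lemma exists_isFace (hc : 0 < c) (i : Fin 3) :
    ∃ w V σ ρ β, IsFace (pseudoYCatenoid c i) w V σ ρ β := by
  fin_cases i
  · exact ⟨_, _, _, _, _, isFace_zero hc⟩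
  · exact ⟨_, _, _, _, _, isFace_one hc⟩
  · exact ⟨_, _, _, _, _, isFace_two hc⟩

lemma wDeltaStar_add (hc : 0 < c) {φ ψ : JFun} (hφ : φ ∈ WDeltaStar (pseudoYCatenoid c))
    (hψ : ψ ∈ WDeltaStar (pseudoYCatenoid c)) : φ + ψ ∈ WDeltaStar (pseudoYCatenoid c) := by
  refine ⟨fun i => ?_, ?_⟩
  · obtain ⟨w, V, σ, ρ, β, hX⟩ := exists_isFace hc i
    exact hX.memWStar_add (hφ.1 i) (hψ.1 i)
  · have h1 : (φ 0).trace + (φ 1).trace + (φ 2).trace = 0 := hφ.2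
    have h2 : (ψ 0).trace + (ψ 1).trace + (ψ 2).trace = 0 := hψ.2
    change ((φ 0).trace + (ψ 0).trace) + ((φ 1).trace + (ψ 1).trace) +
      ((φ 2).trace + (ψ 2).trace) = 0
    rw [← add_zero (0 : CircleFun)]
    nth_rewrite 1 [← h1]
    rw [← h2]
    abel

lemma wDeltaStar_smul (hc : 0 < c) (r : ℝ) {φ : JFun} (hφ : φ ∈ WDeltaStar (pseudoYCatenoid c)) :
    r • φ ∈ WDeltaStar (pseudoYCatenoid c) := by
  refine ⟨fun i => ?_, ?_⟩
  · obtain ⟨w, V, σ, ρ, β, hX⟩ := exists_isFace hc i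
    exact hX.memWStar_smul r (hφ.1 i)
  · have h1 : (φ 0).trace + (φ 1).trace + (φ 2).trace = 0 := hφ.2
    change r • (φ 0).trace + r • (φ 1).trace + r • (φ 2).trace = 0
    rw [← smul_add, ← smul_add, h1, smul_zero]

lemma wDeltaStar_zero (hc : 0 < c) : (0 : JFun) ∈ WDeltaStar (pseudoYCatenoid c) := by
  refine ⟨fun i => ?_, ?_⟩
  · obtain ⟨w, V, σ, ρ, β, hX⟩ := exists_isFace hc i
    exact hX.memWStar_of_memWc hX.memWc_zero
  · change (0 : CircleFun) + 0 + 0 = 0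
    simp

lemma indexForm_add_left (hc : 0 < c) {φ φ' ψ : JFun}
    (hφ : φ ∈ WDeltaStar (pseudoYCatenoid c)) (hφ' : φ' ∈ WDeltaStar (pseudoYCatenoid c))
    (hψ : ψ ∈ WDeltaStar (pseudoYCatenoid c)) :
    indexForm (pseudoYCatenoid c) (φ + φ') ψ =
      indexForm (pseudoYCatenoid c) φ ψ + indexForm (pseudoYCatenoid c) φ' ψ := by
  rw [indexForm, indexForm, indexForm, ← Finset.sum_add_distrib]
  refine Finset.sum_congr rfl fun i _ => ?_
  obtain ⟨w, V, σ, ρ, β, hX⟩ := exists_isFace hc i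
  exact hX.form_add_left (hφ.1 i) (hφ'.1 i) (hψ.1 i)

lemma indexForm_smul_left (hc : 0 < c) (r : ℝ) (φ ψ : JFun) :
    indexForm (pseudoYCatenoid c) (r • φ) ψ = r * indexForm (pseudoYCatenoid c) φ ψ := by
  rw [indexForm, indexForm, Finset.mul_sum]
  refine Finset.sum_congr rfl fun i _ => ?_
  obtain ⟨w, V, σ, ρ, β, hX⟩ := exists_isFace hc i
  exact hX.form_smul_left r (φ i) (ψ i)

/-- The null space of the pseudo Y-catenoid. -/
def nullSubmodule (hc : 0 < c) : Submodule ℝ JFun where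
  carrier := nullSet (WDeltaStar (pseudoYCatenoid c)) (indexForm (pseudoYCatenoid c))
  add_mem' := fun h1 h2 => ⟨wDeltaStar_add hc h1.1 h2.1, fun ψ hψ => by
    rw [indexForm_add_left hc h1.1 h2.1 hψ, h1.2 ψ hψ, h2.2 ψ hψ, add_zero]⟩
  zero_mem' := ⟨wDeltaStar_zero hc, fun ψ _ => by
    rw [← zero_smul ℝ (0 : JFun), indexForm_smul_left hc, zero_mul]⟩
  smul_mem' := fun r φ h => ⟨wDeltaStar_smul hc r h.1, fun ψ hψ => by
    rw [indexForm_smul_left hc, h.2 ψ hψ, mul_zero]⟩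

/-! ## Jacobi functions on the faces -/

/-- Differentiability is asked on the half line only, for the sake of `1 / rad`, which is singular
at a negative `t`. -/
lemma IsPrim.of_hasDerivAt_Ici {f f' : ℝ → ℝ} (h : ∀ t, 0 ≤ t → HasDerivAt f (f' t) t)
    (hc : ContinuousOn f' (Ici 0)) : IsPrim f f' := by
  refine ⟨fun b => ((hc.mono fun x hx => hx.1).integrableOn_Icc (b := b)).mono_set
    Ioc_subset_Icc_self, fun t ht => ?_⟩
  have hs : uIcc 0 t ⊆ Ici 0 := by rw [uIcc_of_le ht]; exact fun x hx => hx.1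
  rw [intervalIntegral.integral_eq_sub_of_hasDerivAt (fun x hx => h x (hs hx))
    (hc.mono hs).intervalIntegrable]
  ring

lemma isPrim_one : IsPrim (fun _ => 1) (fun _ => 0) :=
  .of_hasDerivAt (fun t => hasDerivAt_const t 1) continuous_const

lemma isPrim_sch : IsPrim sch (fun t => -(sch t * tnh t)) :=
  .of_hasDerivAt hasDerivAt_sch (by fun_prop)

lemma continuousOn_rad_inv_pow (n : ℕ) : ContinuousOn (fun t => (rad t ^ n)⁻¹) (Ici 0) :=
  ContinuousOn.inv₀ (by unfold rad; fun_prop) fun _ ht => (pow_pos (rad_pos ht) n).ne'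

lemma isPrim_neg_rad_inv : IsPrim (fun t => -(rad t)⁻¹) (fun t => (rad t ^ 2)⁻¹) := by
  refine .of_hasDerivAt_Ici (fun t ht => ?_) (continuousOn_rad_inv_pow 2)
  convert! ((hasDerivAt_rad t).inv (rad_pos ht).ne').neg using 1
  have := (rad_pos ht).ne'
  field_simp

lemma integrableOn_rad_inv_pow {n : ℕ} (hn : 2 ≤ n) :
    IntegrableOn (fun t => (rad t ^ n)⁻¹) (Ioi 0) := by
  have h := integrableOn_add_rpow_Ioi_of_lt (a := -(n:ℝ)) (c := 0) (m := 2 / √3)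
    (by have : (2:ℝ) ≤ n := by exact_mod_cast hn
        linarith) (neg_lt_zero.2 (by positivity))
  refine h.congr_fun (fun t ht => ?_) measurableSet_Ioi
  simp only
  rw [show t + 2 / √3 = rad t from rfl, Real.rpow_neg (rad_pos (le_of_lt ht)).le, Real.rpow_natCast]

section

variable {X : ℝ × ℝ → E3} {w V σ ρ : ℝ → ℝ} {β : ℝ} {a p e : ℝ → ℝ}

/-- The form of a separated Jacobi function reduces to a boundary term. -/
lemma IsFace.form_sepJet_jacobi (hX : IsFace X w V σ ρ β) (h : IsPrim a p) (he : IsAngular e)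
    {m : ℝ} (hm : ∀ θ, deriv (deriv e) θ = -m * e θ) (hj : MemWStar X (sepJet h he)) {ψ : Jet}
    (hψ : MemWStar X ψ)
    (hF : IsPrim (fun t => w t * p t) (fun t => (m * (w t)⁻¹ - V t) * a t))
    (hi : IntegrableOn (fun t => w t * p t * mode e ψ t / (t + 2 / √3)) (Ioi 0)) :
    faceForm X (sepJet h he) ψ - boundaryForm X (sepJet h he) ψ =
      -(w 0 * p 0 + β * a 0) * mode e ψ 0 := by
  obtain ⟨h1, h2⟩ := hX.form_sepJet h he hm hj hψ
  -- The hypothesis `hF` is the equation `(w a')' = (m / w - V) a`. It makes the integrand of the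
  -- form the derivative of `w a'` times the mode of `ψ`; `hi` makes that product vanish at
  -- infinity.
  have h3 := hF.mul ((hX.weak hψ).isPrim_mode he)
  have h4 : IntegrableOn (fun t => (m * (w t)⁻¹ - V t) * a t * mode e ψ t +
      w t * p t * coef e ψ.pt t) (Ioi 0) := h1.congr (ae_of_all _ fun t => add_comm _ _)
  have h5 := h3.integral_Ioi_of_tendsto h4 (h3.tendsto_zero h4 (by positivity) hi)
  simp_rw [add_comm (w _ * p _ * coef _ _ _)] at h2
  rw [h2, h5]
  ring

/-- `cos (k θ)` and `sin (k θ)`. -/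
def IsMode (k : ℤ) (e : ℝ → ℝ) : Prop := e = cosMode k ∨ e = sinMode k

namespace IsMode

variable {k : ℤ}

lemma isAngular (h : IsMode k e) : IsAngular e := by
  rcases h with rfl | rfl
  exacts [isAngular_cosMode k, isAngular_sinMode k]

lemma deriv_deriv (h : IsMode k e) (θ : ℝ) : deriv (deriv e) θ = -(k:ℝ) ^ 2 * e θ := by
  rcases h with rfl | rfl
  · rw [deriv_cosMode, deriv_const_mul _ ((isAngular_sinMode k).hasDerivAt θ).differentiableAt,
      deriv_sinMode]; ring
  · rw [deriv_sinMode, deriv_const_mul _ ((isAngular_cosMode k).hasDerivAt θ).differentiableAt,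
      deriv_cosMode]; ring

end IsMode

namespace IsFace

variable {ψ : Jet} {k : ℤ}

lemma int_mode_val' (hX : IsFace X w V σ ρ β) (hψ : MemWStar X ψ) (he : IsMode k e) :
    IntegrableOn (fun t => V t * mode e ψ t ^ 2) (Ioi 0) := by
  rcases he with rfl | rfl
  exacts [(hX.int_mode_val hψ k).1, (hX.int_mode_val hψ k).2]

lemma int_mode_inv (hX : IsFace X w V σ ρ β) (hψ : MemWStar X ψ) (he : IsMode k e) (hk : k ≠ 0) :
    IntegrableOn (fun t => (w t)⁻¹ * mode e ψ t ^ 2) (Ioi 0) := by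
  rcases he with rfl | rfl
  exacts [(hX.int_mode_pθ' hψ hk).1, (hX.int_mode_pθ' hψ hk).2]

end IsFace

end

lemma integrableOn_div_add {f : ℝ → ℝ} {r : ℝ} (hr : 0 < r) (hf : IntegrableOn f (Ioi 0)) :
    IntegrableOn (fun t => f t / (t + r)) (Ioi 0) := by
  refine (integrableOn_bdd_mul (g := fun t => (t + r)⁻¹) (C := r⁻¹) ?_ (fun t ht => ?_) hf).congr
    (ae_of_all _ fun t => by simp only [div_eq_mul_inv, mul_comm])
  · exact ContinuousOn.inv₀ (by fun_prop) fun t ht => by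
      have : 0 < t := ht
      positivity
  · rw [abs_of_pos (by positivity)]
    exact inv_anti₀ hr (by linarith)

/-! ### Jacobi functions on a catenoidal face -/

section Catenoid

variable {κ : ℝ}

lemma memWStar_tnh (hc : 0 < c) (hκ : κ ^ 2 = 1) :
    MemWStar (catenoidFace c κ) (sepJet isPrim_tnh (isAngular_cosMode 0)) := by
  refine (isFace_catenoidFace hc hκ).memWStar_sepJet _ _ ?_ (Or.inl fun θ => ?_)
    (fun t _ => abs_tnh_le_one t)
  · refine (integrableOn_bdd_mul (g := fun t => sch t ^ 2) (by fun_prop)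
      (fun t _ => abs_sch_sq_le_one t) integrableOn_sch_sq).congr (ae_of_all _ fun t => ?_)
    simp only; ring
  · rw [deriv_cosMode]; simp

/-- At the boundary `w p + β a = sch(0)² - tnh(0) / 2 = 3/4 + 1/4 = 1`. -/
lemma form_tnh (hc : 0 < c) (hκ : κ ^ 2 = 1) {ψ : Jet} (hψ : MemWStar (catenoidFace c κ) ψ) :
    faceForm (catenoidFace c κ) (sepJet isPrim_tnh (isAngular_cosMode 0)) ψ -
      boundaryForm (catenoidFace c κ) (sepJet isPrim_tnh (isAngular_cosMode 0)) ψ =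
      -mode (cosMode 0) ψ 0 := by
  have hX := isFace_catenoidFace hc hκ
  have he : IsMode 0 (cosMode 0) := Or.inl rfl
  have hm := (hX.weak hψ).isPrim_mode (isAngular_cosMode 0)
  have h1 := Integrable.mul_of_sq (continuous_sch.aestronglyMeasurable)
    (continuous_sch.aestronglyMeasurable.mul hm.meas) integrableOn_sch_sq
    (((hX.int_mode_val' hψ he).const_mul (1 / 2)).congr (ae_of_all _ fun t => by
      simp only [Pi.mul_apply]; ring))
  rw [hX.form_sepJet_jacobi isPrim_tnh _ he.deriv_deriv (memWStar_tnh hc hκ) hψ, sch_zero_sq,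
    tnh_zero]
  · ring
  · convert! IsPrim.of_hasDerivAt hasDerivAt_sch_sq (by fun_prop) using 2
    · ring
    · simp
  · refine integrableOn_div_add (by positivity) (h1.congr (ae_of_all _ fun t => ?_))
    simp only [Pi.mul_apply]; ring

variable {e : ℝ → ℝ}

lemma memWStar_sch (hc : 0 < c) (hκ : κ ^ 2 = 1) (he : IsAngular e) :
    MemWStar (catenoidFace c κ) (sepJet isPrim_sch he) := by
  refine (isFace_catenoidFace hc hκ).memWStar_sepJet _ _ ?_ (Or.inr ?_) (C := 1)
    (fun t _ => by rw [abs_of_pos (sch_pos t)]; exact sch_le_one t)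
  · refine (integrableOn_bdd_mul (g := fun t => tnh t ^ 2) (C := 1) (by fun_prop)
      (fun t _ => by rw [abs_pow]; exact pow_le_one₀ (abs_nonneg _) (abs_tnh_le_one t))
      integrableOn_sch_sq).congr (ae_of_all _ fun t => ?_)
    simp only; ring
  · refine integrableOn_sch_sq.congr (ae_of_all _ fun t => ?_)
    simp

/-- The boundary term is zero: `-sch(0) tnh(0) - sch(0) / 2 = 0` since `tnh(0) = -1/2`. So `sch`
satisfies the natural boundary condition on its own. -/
lemma form_sch (hc : 0 < c) (hκ : κ ^ 2 = 1) (he : IsMode 1 e) {ψ : Jet}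
    (hψ : MemWStar (catenoidFace c κ) ψ) :
    faceForm (catenoidFace c κ) (sepJet isPrim_sch he.isAngular) ψ -
      boundaryForm (catenoidFace c κ) (sepJet isPrim_sch he.isAngular) ψ = 0 := by
  have hX := isFace_catenoidFace hc hκ
  have hm := (hX.weak hψ).isPrim_mode he.isAngular
  have h0 : IntegrableOn (fun t => (sch t * tnh t) ^ 2) (Ioi 0) := by
    refine (integrableOn_bdd_mul (g := fun t => tnh t ^ 2) (C := 1) (by fun_prop)
      (fun t _ => by rw [abs_pow]; exact pow_le_one₀ (abs_nonneg _) (abs_tnh_le_one t))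
      integrableOn_sch_sq).congr (ae_of_all _ fun t => ?_)
    simp only; ring
  have h1 := Integrable.mul_of_sq (continuous_sch.mul continuous_tnh).aestronglyMeasurable hm.meas
    h0 ((hX.int_mode_inv hψ he one_ne_zero).congr (ae_of_all _ fun t => by simp))
  rw [hX.form_sepJet_jacobi isPrim_sch _ he.deriv_deriv (memWStar_sch hc hκ _) hψ, sch_zero,
    tnh_zero]
  · ring
  · have hd : ∀ t, HasDerivAt (fun t => -(sch t * tnh t)) ((1 - 2 * sch t ^ 2) * sch t) t := by
      intro t
      convert! ((hasDerivAt_sch t).mul (hasDerivAt_tnh t)).neg using 1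
      linear_combination -(sch t) * tnh_sq t
    convert! IsPrim.of_hasDerivAt hd (by fun_prop) using 2
    · ring
    · simp
  · refine integrableOn_div_add (by positivity) (h1.neg.congr (ae_of_all _ fun t => ?_))
    simp only [Pi.neg_apply, Pi.mul_apply]; ring

end Catenoid

/-! ### Jacobi functions on the planar face -/

section Plane

variable {e : ℝ → ℝ}

lemma memWStar_one (hc : 0 < c) :
    MemWStar (planeFace c) (sepJet isPrim_one (isAngular_cosMode 0)) := by
  refine (isFace_planeFace hc).memWStar_sepJet _ _ ?_ (Or.inl fun θ => ?_) (C := 1)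
    (fun t _ => by simp)
  · simp
  · rw [deriv_cosMode]; simp

/-- A constant on the flat face has no interior contribution, so only `β = 1` remains. -/
lemma form_one (hc : 0 < c) {ψ : Jet} (hψ : MemWStar (planeFace c) ψ) :
    faceForm (planeFace c) (sepJet isPrim_one (isAngular_cosMode 0)) ψ -
      boundaryForm (planeFace c) (sepJet isPrim_one (isAngular_cosMode 0)) ψ =
      -mode (cosMode 0) ψ 0 := by
  have he : IsMode 0 (cosMode 0) := Or.inl rfl
  rw [((isFace_planeFace hc).form_sepJet isPrim_one _ he.deriv_deriv (memWStar_one hc) hψ).2]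
  simp

lemma memWStar_neg_rad_inv (hc : 0 < c) (he : IsAngular e) :
    MemWStar (planeFace c) (sepJet isPrim_neg_rad_inv he) := by
  refine (isFace_planeFace hc).memWStar_sepJet _ _ ?_ (Or.inr ?_) (C := 1) fun t ht => ?_
  · refine (integrableOn_rad_inv_pow (n := 3) (by norm_num)).congr_fun (fun t ht => ?_)
      measurableSet_Ioi
    have := (rad_pos (le_of_lt ht)).ne'
    simp only; field_simp
  · refine (integrableOn_rad_inv_pow (n := 3) (by norm_num)).congr_fun (fun t ht => ?_)
      measurableSet_Ioi
    have := (rad_pos (le_of_lt ht)).ne'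
    simp only; field_simp
  · rw [abs_neg, abs_of_pos (inv_pos.2 (rad_pos ht.le))]
    exact inv_le_one_of_one_le₀ (one_le_rad ht.le)

/-- For `a = -1 / rad` the flux `rad · a'` equals `1 / rad`, which cancels `β a` at the boundary. -/
lemma form_neg_rad_inv (hc : 0 < c) (he : IsMode 1 e) {ψ : Jet} (hψ : MemWStar (planeFace c) ψ) :
    faceForm (planeFace c) (sepJet isPrim_neg_rad_inv he.isAngular) ψ -
      boundaryForm (planeFace c) (sepJet isPrim_neg_rad_inv he.isAngular) ψ = 0 := by
  have hX := isFace_planeFace hc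
  have hm := (hX.weak hψ).isPrim_mode he.isAngular
  have mr : ∀ n, AEStronglyMeasurable (fun t => (rad t ^ n)⁻¹) (volume.restrict (Ioi 0)) :=
    fun n => ((continuousOn_rad_inv_pow n).mono Ioi_subset_Ici_self).aestronglyMeasurable
      measurableSet_Ioi
  have h1 : IntegrableOn (fun t => (rad t ^ 2)⁻¹ * mode e ψ t) (Ioi 0) :=
    Integrable.mul_of_weighted_sq (v := rad) (w := fun t => (rad t)⁻¹) (mr 2) hm.meas
    (by
      filter_upwards [ae_restrict_mem measurableSet_Ioi] with t ht
      have := rad_pos (le_of_lt ht)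
      exact ⟨(mul_inv_cancel₀ this.ne').ge, this.le⟩)
    ((integrableOn_rad_inv_pow (n := 3) (by norm_num)).congr_fun (fun t ht => by
      have := (rad_pos (le_of_lt ht)).ne'
      simp only; field_simp) measurableSet_Ioi)
    (hX.int_mode_inv hψ he one_ne_zero)
  rw [hX.form_sepJet_jacobi isPrim_neg_rad_inv _ he.deriv_deriv (memWStar_neg_rad_inv hc _) hψ,
    rad_zero]
  · field_simp
    ring
  · refine .of_hasDerivAt_Ici (fun t ht => ?_) ?_
    · have hne := (rad_pos ht).ne'
      convert! (hasDerivAt_rad t).mul (((hasDerivAt_rad t).pow 2).inv (pow_ne_zero 2 hne)) using 1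
      simp
      field_simp
      ring
    · refine (continuousOn_rad_inv_pow 2).neg.congr fun t ht => ?_
      have hne := (rad_pos ht).ne'
      simp
      field_simp
  · refine h1.congr_fun (fun t ht => ?_) measurableSet_Ioi
    have hne := (rad_pos (le_of_lt ht)).ne'
    have e : t + 2 / √3 = rad t := rfl
    simp only
    rw [e]
    field_simp

end Plane

/-! ## Uniqueness of null functions -/

section

variable {X : ℝ × ℝ → E3} {w V σ ρ : ℝ → ℝ} {β : ℝ} {ψ : Jet}

/-- A function on a face all of whose modes vanish is zero. -/
lemma IsFace.eq_zero_of_modes (hX : IsFace X w V σ ρ β) (hψ : MemWStar X ψ)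
    (h : ∀ k e, IsMode k e → ∀ t, 0 ≤ t → mode e ψ t = 0) : ψ = 0 := by
  have hw := hX.weak hψ
  have h0 : ∀ k e, IsMode k e → ∀ᵐ t ∂volume.restrict (Ioi 0), mode e ψ t = 0 := fun k e he => by
    filter_upwards [ae_restrict_mem measurableSet_Ioi] with t ht using h k e he t (le_of_lt ht)
  have hv : ∀ k e, IsMode k e → coef e ψ.val =ᵐ[volume.restrict (Ioi 0)] 0 := fun k e he => by
    filter_upwards [hw.coef_val he.isAngular, h0 k e he] with t h1 h2
    rw [h1, h2]; rfl
  have ht : ∀ k e, IsMode k e → coef e ψ.pt =ᵐ[volume.restrict (Ioi 0)] 0 := fun k e he =>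
    (hw.isPrim_mode he.isAngular).ae_eq_zero (h k e he)
  have z1 : ψ.val =ᵐ[stripMeasure] 0 :=
    ae_eq_zero_of_coef ψ.val.aestronglyMeasurable (fun t ht => hX.σ_pos t (le_of_lt ht))
      hX.cont_σ.continuousOn (hX.int_σ_val hψ) (fun k => hv k _ (Or.inl rfl))
      fun k => hv k _ (Or.inr rfl)
  have z2 : ψ.pt =ᵐ[stripMeasure] 0 :=
    ae_eq_zero_of_coef ψ.pt.aestronglyMeasurable (fun t ht => hX.w_pos (le_of_lt ht))
      hX.cont_w' (hX.int_pt hψ) (fun k => ht k _ (Or.inl rfl)) fun k => ht k _ (Or.inr rfl)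
  have z3 : ψ.pθ =ᵐ[stripMeasure] 0 := by
    -- The Fourier coefficients of `u_θ` are, up to sign, `k` times the modes of `u` with `cos` and
    -- `sin` exchanged.
    refine ae_eq_zero_of_coef (W := fun t => (w t)⁻¹) ψ.pθ.aestronglyMeasurable
      (fun t ht => inv_pos.2 (hX.w_pos (le_of_lt ht)))
      hX.cont_w_inv (hX.int_pθ hψ) (fun k => ?_) fun k => ?_
    · filter_upwards [hw.coef_cos_pθ k, h0 k _ (Or.inr rfl)] with t h1 h2
      rw [h1, h2, mul_zero]; rfl
    · filter_upwards [hw.coef_sin_pθ k, h0 k _ (Or.inl rfl)] with t h1 h2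
      rw [h1, h2, mul_zero]; rfl
  have z4 : ψ.trace =ᵐ[circleMeasure] 0 := by
    have h1 := hasSum_sq_circle (hX.memLp_trace hψ)
    have h2 : ∀ k e, IsMode k e → ∫ θ, ψ.trace θ * e θ ∂circleMeasure = 0 := fun k e he => by
      rw [← mode_zero]; exact h k e he 0 le_rfl
    have h3 : ∀ k : ℤ, (∫ θ, ψ.trace θ * cosMode k θ ∂circleMeasure) ^ 2 +
        (∫ θ, ψ.trace θ * sinMode k θ ∂circleMeasure) ^ 2 = 0 := fun k => by
      rw [h2 k _ (Or.inl rfl), h2 k _ (Or.inr rfl)]; norm_num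
    simp_rw [h3] at h1
    have h4 : ∫ θ, ψ.trace θ ^ 2 ∂circleMeasure = 0 :=
      (mul_eq_zero.1 (h1.unique hasSum_zero)).resolve_left (by positivity)
    have h5 := (integral_eq_zero_iff_of_nonneg (fun θ => sq_nonneg _)
      (hX.memLp_trace hψ).integrable_sq).1 h4
    filter_upwards [h5] with θ hθ
    exact pow_eq_zero_iff (two_ne_zero) |>.1 hθ
  have e : ∀ {α : Type} [MeasurableSpace α] {μ : Measure α} {f : α →ₘ[μ] ℝ}, f =ᵐ[μ] 0 → f = 0 :=
    fun hf => AEEqFun.ext (hf.trans AEEqFun.coeFn_zero.symm)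
  exact Prod.ext (e z1) (Prod.ext (e z2) (Prod.ext (e z3) (e z4)))

/-- If a function on a face is orthogonal to all functions with vanishing trace, then the Wronskian
of its radial mode with a radial Jacobi function is constant. -/
lemma IsFace.wronskian_const (hX : IsFace X w V σ ρ β) {h h' : ℝ → ℝ}
    (hh : ∀ t, HasDerivAt h (h' t) t) (ch : Continuous h')
    (hF : IsPrim (fun t => w t * h' t) (fun t => -V t * h t)) (hψ : MemWStar X ψ)
    (hn : ∀ φ, MemWStar X φ → φ.trace = 0 → faceForm X φ ψ - boundaryForm X φ ψ = 0) :
    ∃ C : ℝ, ∀ᵐ t ∂volume.restrict (Ioi 0),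
      w t * h t * coef (cosMode 0) ψ.pt t - w t * h' t * mode (cosMode 0) ψ t = C := by
  have he : IsMode 0 (cosMode 0) := Or.inl rfl
  have hb := (hX.weak hψ).isPrim_mode he.isAngular
  have chh : Continuous h := continuous_iff_continuousAt.2 fun t => (hh t).continuousAt
  have ic : ∀ b : ℝ, Icc (0:ℝ) b ⊆ Ici 0 := fun b x hx => hx.1
  have lwh : ∀ b, IntegrableOn (fun t => w t * h t * coef (cosMode 0) ψ.pt t) (Ioc 0 b) :=
    fun b => by
      have h2 : IntegrableOn (coef (cosMode 0) ψ.pt) (Icc 0 b) :=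
        (integrableOn_Icc_iff_integrableOn_Ioc (by simp)).2 (hb.1 b)
      exact (h2.continuousOn_mul ((hX.cont_w.mono (ic b)).mul chh.continuousOn)
        isCompact_Icc).mono_set Ioc_subset_Icc_self
  have lFb : ∀ b, IntegrableOn (fun t => w t * h' t * mode (cosMode 0) ψ t) (Ioc 0 b) :=
    fun b => (hF.mul hb).loc b
  -- The test functions are `h χ` with `χ(0) = 0`. Since `h` solves the Jacobi equation, integrating
  -- `(w h' χ) · mode` by parts leaves only the Wronskian against `χ'`.
  refine exists_ae_eq_const (fun b => (lwh b).sub (lFb b)) fun χ hχ h0 => ?_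
  obtain ⟨B, hB⟩ := hχ.2
  obtain ⟨B', hB'⟩ := hχ.deriv.2
  have ha := (IsPrim.of_hasDerivAt hh ch).mul hχ.isPrim
  have cut : ∀ {f : ℝ → ℝ} {b : ℝ}, ContinuousOn f (Ici 0) → (∀ t, b ≤ t → f t = 0) →
      IntegrableOn f (Ioi 0) := fun {f b} hf h0 =>
    (((hf.mono (ic b)).integrableOn_Icc).mono_set Ioc_subset_Icc_self).of_forall_sdiff_eq_zero
      measurableSet_Ioi fun t ht => h0 t (by
        by_contra hlt; exact ht.2 ⟨ht.1, (not_le.1 hlt).le⟩)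
  have cχ := hχ.1.continuous
  have cχ' := hχ.continuous_deriv
  have hj : MemWStar X (sepJet ha he.isAngular) := by
    obtain ⟨C, hC⟩ := (isCompact_Icc (a := (0:ℝ)) (b := B)).exists_bound_of_continuousOn
      (chh.mul cχ).continuousOn
    refine hX.memWStar_sepJet _ _ (cut (b := max B B') ?_ fun t ht => ?_)
      (Or.inl fun θ => by rw [deriv_cosMode]; simp) (C := max C 0) fun t ht => ?_
    · exact hX.cont_w.mul (by fun_prop)
    · simp [hB t (le_of_max_le_left ht), hB' t (le_of_max_le_right ht)]
    · rcases le_total t B with hle | hle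
      · exact (hC t ⟨ht.le, hle⟩).trans (le_max_left _ _)
      · simp [hB t hle]
  have htr : (sepJet ha he.isAngular).trace = 0 := by
    refine AEEqFun.ext ?_
    filter_upwards [sepJet_trace ha he.isAngular,
      AEEqFun.coeFn_zero (α := ℝ) (β := ℝ) (μ := circleMeasure)] with θ h1 h2
    rw [h2, h1, h0, mul_zero, zero_mul]; rfl
  have key := hn _ hj htr
  obtain ⟨i1, e1⟩ := hX.form_sepJet ha he.isAngular he.deriv_deriv hj hψ
  rw [e1, h0] at key
  simp only [mul_zero, zero_mul, sub_zero] at key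
  have hG := (hF.mul hχ.isPrim).mul hb
  have i2 : IntegrableOn (fun t => (w t * h t * coef (cosMode 0) ψ.pt t -
      w t * h' t * mode (cosMode 0) ψ t) * deriv χ t) (Ioi 0) :=
    hχ.deriv.integrableOn fun b => (lwh b).sub (lFb b)
  have i3 := (i1.sub i2).congr (ae_of_all _ fun t => show _ =
    (-V t * h t * χ t + w t * h' t * deriv χ t) * mode (cosMode 0) ψ t +
      w t * h' t * χ t * coef (cosMode 0) ψ.pt t by
    simp only [Pi.sub_apply, Int.cast_zero]; ring)
  have e3 := hG.integral_Ioi_of_vanish (b := B) (fun t ht => by simp [hB t ht]) i3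
  have e4 : ∀ t, (w t * h t * coef (cosMode 0) ψ.pt t - w t * h' t * mode (cosMode 0) ψ t) *
      deriv χ t = (w t * (h' t * χ t + h t * deriv χ t) * coef (cosMode 0) ψ.pt t +
        (((0:ℤ):ℝ) ^ 2 * (w t)⁻¹ - V t) * (h t * χ t) * mode (cosMode 0) ψ t) -
      ((-V t * h t * χ t + w t * h' t * deriv χ t) * mode (cosMode 0) ψ t +
        w t * h' t * χ t * coef (cosMode 0) ψ.pt t) := fun t => by
    rw [Int.cast_zero]; ring
  simp_rw [e4]
  rw [integral_sub i1 i3, key, e3, h0]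
  simp

end

/-- A null function is orthogonal, on each face, to all functions with vanishing trace. -/
lemma face_orthogonal_of_null (hc : 0 < c) {d : JFun} (hd : d ∈ nullSubmodule hc) (i : Fin 3)
    {φ : Jet} (hφ : MemWStar (pseudoYCatenoid c i) φ) (h0 : φ.trace = 0) :
    faceForm (pseudoYCatenoid c i) φ (d i) - boundaryForm (pseudoYCatenoid c i) φ (d i) = 0 := by
  -- Zero trace allows a variation of one face alone to be compatible.
  have hm : (Pi.single i φ : JFun) ∈ WDeltaStar (pseudoYCatenoid c) := by
    have hs : ∀ j, ((Pi.single i φ : JFun) j).trace = 0 := fun j => by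
      by_cases hj : j = i
      · subst hj; rw [Pi.single_eq_same, h0]
      · rw [Pi.single_eq_of_ne hj]; rfl
    refine ⟨fun j => ?_, ?_⟩
    · by_cases hj : j = i
      · subst hj; rwa [Pi.single_eq_same]
      · rw [Pi.single_eq_of_ne hj]
        obtain ⟨w, V, σ, ρ, β, hX⟩ := exists_isFace hc j
        exact hX.memWStar_of_memWc hX.memWc_zero
    · rw [Compatible, hs, hs, hs, add_zero, add_zero]
  have h1 := hd.2 _ hm
  rw [indexForm, Finset.sum_eq_single i, Pi.single_eq_same] at h1
  · obtain ⟨w, V, σ, ρ, β, hX⟩ := exists_isFace hc i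
    rw [hX.form_comm, h1]
  · intro j _ hj
    obtain ⟨w, V, σ, ρ, β, hX⟩ := exists_isFace hc j
    rw [Pi.single_eq_of_ne hj, hX.form_zero_right]
  · simp

/-- Two Wronskians, against both radial Jacobi functions, replace a regularity argument: they
determine the mode and its derivative algebraically. -/
lemma radial_catenoid {κ : ℝ} (hc : 0 < c) (hκ : κ ^ 2 = 1) {ψ : Jet}
    (hψ : MemWStar (catenoidFace c κ) ψ)
    (hn : ∀ φ, MemWStar (catenoidFace c κ) φ → φ.trace = 0 →
      faceForm (catenoidFace c κ) φ ψ - boundaryForm (catenoidFace c κ) φ ψ = 0) :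
    ∃ r : ℝ, (∀ t, 0 ≤ t → mode (cosMode 0) ψ t = r * tnh t) ∧
      radialForm (fun _ => 1) (fun t => 2 * sch t ^ 2) (-1 / 2) ψ = r ^ 2 / 2 := by
  have hX := isFace_catenoidFace hc hκ
  have h1 : IsPrim (fun t => 1 * sch t ^ 2) (fun t => -(2 * sch t ^ 2) * tnh t) := by
    simpa only [one_mul] using IsPrim.of_hasDerivAt hasDerivAt_sch_sq (by fun_prop)
  have c2 : Continuous tnhSecond' := by unfold tnhSecond'; fun_prop
  have c1 : Continuous tnhSecond := by unfold tnhSecond; fun_prop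
  have h2 : IsPrim (fun t => 1 * tnhSecond' t) (fun t => -(2 * sch t ^ 2) * tnhSecond t) := by
    simpa only [one_mul] using IsPrim.of_hasDerivAt hasDerivAt_tnhSecond' (by fun_prop)
  obtain ⟨C₁, hC₁⟩ := hX.wronskian_const hasDerivAt_tnh (by fun_prop) h1 hψ hn
  obtain ⟨C₂, hC₂⟩ := hX.wronskian_const hasDerivAt_tnhSecond c2 h2 hψ hn
  simp only [one_mul] at hC₁ hC₂
  obtain ⟨r, hr, hr'⟩ := catenoid_radial_solution
    ((hX.weak hψ).isPrim_mode (isAngular_cosMode 0))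
    (by simpa only [one_mul] using (hX.int_mode_pt hψ 0).1) hC₁ hC₂
  exact ⟨r, hr, modeForm_tnh hr hr'⟩

/-- The Wronskian with the constant solution is the flux, and finite energy forces it to vanish; a
second solution is not needed. -/
lemma radial_plane (hc : 0 < c) {ψ : Jet} (hψ : MemWStar (planeFace c) ψ)
    (hn : ∀ φ, MemWStar (planeFace c) φ → φ.trace = 0 →
      faceForm (planeFace c) φ ψ - boundaryForm (planeFace c) φ ψ = 0) :
    (∀ t, 0 ≤ t → mode (cosMode 0) ψ t = mode (cosMode 0) ψ 0) ∧
      radialForm rad (fun _ => 0) 1 ψ = -mode (cosMode 0) ψ 0 ^ 2 := by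
  have hX := isFace_planeFace hc
  have h1 : IsPrim (fun t => rad t * 0) (fun _ => -0 * 1) := by
    simpa using IsPrim.of_hasDerivAt (fun t => hasDerivAt_const t (0:ℝ)) continuous_const
  obtain ⟨C, hC⟩ := hX.wronskian_const (fun t => hasDerivAt_const t 1) continuous_const h1 hψ hn
  simp only [mul_one, mul_zero, zero_mul, sub_zero] at hC
  have hp := (hX.weak hψ).isPrim_mode (isAngular_cosMode 0)
  have h0 := plane_radial_solution (hX.int_mode_pt hψ 0).1 hC
  refine ⟨fun t ht => hp.eq_const h0 ht, ?_⟩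
  have : ∫ t in Ioi 0, (rad t * coef (cosMode 0) ψ.pt t ^ 2 +
      (0 * (rad t)⁻¹ - 0) * mode (cosMode 0) ψ t ^ 2) = 0 := by
    refine integral_eq_zero_of_ae ?_
    filter_upwards [h0] with t ht
    simp [ht]
  rw [radialForm, modeForm, this]; ring

/-- Boundary data are needed only for `k = ±1`; for every other `k ≠ 0` one has `k² > 1` and the
form is strictly positive. -/
lemma IsFace.mode_eq_zero {X : ℝ × ℝ → E3} {w V σ ρ : ℝ → ℝ} {β : ℝ} (hX : IsFace X w V σ ρ β)
    (hs : ModeStable w V β) {ψ : Jet} (hψ : MemWStar X ψ) {k : ℤ} (hk : k ≠ 0) {e : ℝ → ℝ}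
    (he : IsMode k e) (h0 : modeForm w V β ((k:ℝ) ^ 2) (mode e ψ) (coef e ψ.pt) = 0)
    (h1 : k = 1 ∨ k = -1 → mode e ψ 0 = 0) {t : ℝ} (ht : 0 ≤ t) : mode e ψ t = 0 := by
  have hk1 : (1:ℝ) ≤ (k:ℝ) ^ 2 := by
    have : (1:ℤ) ≤ k ^ 2 := by have := sq_pos_of_ne_zero hk; omega
    exact_mod_cast this
  refine hs.eq_zero hk1 ((hX.weak hψ).isPrim_mode he.isAngular) ?_ (hX.int_mode_inv hψ he hk) h0 ?_
    t ht
  · rcases he with rfl | rfl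
    exacts [(hX.int_mode_pt hψ k).1, (hX.int_mode_pt hψ k).2]
  · by_cases hk2 : k = 1 ∨ k = -1
    · exact Or.inl (h1 hk2)
    · right
      have : (1:ℤ) < k ^ 2 := by
        rcases not_or.1 hk2 with ⟨h2, h3⟩
        rcases lt_or_gt_of_ne hk with h4 | h4
        · nlinarith [show k ≤ -2 by omega]
        · nlinarith [show 2 ≤ k by omega]
      exact_mod_cast this

/-- A null function vanishes if its radial mode vanishes on the boundary of a catenoidal face, and
its first modes vanish on the boundary of both catenoidal faces. -/
lemma eq_zero_of_null (hc : 0 < c) {d : JFun} (hd : d ∈ nullSubmodule hc)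
    (h0 : mode (cosMode 0) (d 0) 0 = 0)
    (h1 : ∀ e, IsMode 1 e → mode e (d 0) 0 = 0 ∧ mode e (d 2) 0 = 0) : d = 0 := by
  have X0 := isFace_zero hc
  have X1 := isFace_one hc
  have X2 := isFace_two hc
  have m := hd.1.1
  have hcomp := fun {e : ℝ → ℝ} (he : IsAngular e) =>
    mode_compatible (fun i => (m i).1.1) hd.1.2 he
  obtain ⟨r₀, a0, b0⟩ := radial_catenoid hc (by norm_num) (m 0)
    fun φ => face_orthogonal_of_null hc hd 0
  obtain ⟨a1, b1⟩ := radial_plane hc (m 1) fun φ => face_orthogonal_of_null hc hd 1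
  obtain ⟨r₂, a2, b2⟩ := radial_catenoid hc (by norm_num) (m 2)
    fun φ => face_orthogonal_of_null hc hd 2
  have hr₀ : r₀ = 0 := by
    rw [a0 0 le_rfl, tnh_zero] at h0; linarith
  have hc0 := hcomp (isAngular_cosMode 0)
  rw [a0 0 le_rfl, a2 0 le_rfl, tnh_zero, hr₀] at hc0
  -- The radial boundary values are `0`, `mode` and `r₂ tnh(0) = -r₂ / 2`, and compatibility makes
  -- them add up to zero.
  have hm : mode (cosMode 0) (d 1) 0 = r₂ / 2 := by linarith
  have hsum := ((X0.hasSum_modeForm (m 0)).add (X1.hasSum_modeForm (m 1))).add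
    (X2.hasSum_modeForm (m 2))
  have hQ := hd.2 d hd.1
  rw [indexForm, Fin.sum_univ_three] at hQ
  rw [← mul_add, ← mul_add, hQ, mul_zero] at hsum
  have n0 := fun {k : ℤ} (hk : k ≠ 0) => X0.modes_nonneg modeStable_catenoid (m 0) hk
  have n1 := fun {k : ℤ} (hk : k ≠ 0) => X1.modes_nonneg modeStable_plane (m 1) hk
  have n2 := fun {k : ℤ} (hk : k ≠ 0) => X2.modes_nonneg modeStable_catenoid (m 2) hk
  have hz : ∀ {w V : ℝ → ℝ} {β : ℝ} {ψ : Jet},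
      modeForm w V β (((0:ℤ):ℝ) ^ 2) (mode (cosMode 0) ψ) (coef (cosMode 0) ψ.pt) +
        modeForm w V β (((0:ℤ):ℝ) ^ 2) (mode (sinMode 0) ψ) (coef (sinMode 0) ψ.pt) =
      radialForm w V β ψ := fun {w V β ψ} => by
    rw [mode_sinMode_zero, coef_sinMode_zero, modeForm_zero_right, add_zero, radialForm]
    simp
  -- The radial term is `r₂² / 2 - (r₂ / 2)² = r₂² / 4` and the other terms are nonnegative by mode
  -- stability. Their sum is `2π Q(d, d) = 0`, so each term vanishes.
  have hall := (hasSum_zero_iff_of_nonneg (fun k => by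
    by_cases hk : k = 0
    · subst hk
      rw [hz, hz, hz, b0, b1, b2, hr₀, hm]
      nlinarith [sq_nonneg r₂]
    · exact add_nonneg (add_nonneg (add_nonneg (n0 hk).1 (n0 hk).2)
        (add_nonneg (n1 hk).1 (n1 hk).2)) (add_nonneg (n2 hk).1 (n2 hk).2))).1 hsum
  have hk0 := congrFun hall 0
  simp only [Pi.zero_apply] at hk0
  rw [hz, hz, hz, b0, b1, b2, hr₀, hm] at hk0
  have hr₂ : r₂ = 0 := by
    have : r₂ ^ 2 = 0 := by linarith
    exact pow_eq_zero_iff two_ne_zero |>.1 this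
  have hm1 : mode (cosMode 0) (d 1) 0 = 0 := by rw [hm, hr₂, zero_div]
  -- The planar boundary value follows from the catenoidal ones by compatibility, and `k = -1`
  -- repeats `k = 1` up to sign.
  have tr : ∀ {k : ℤ} {e : ℝ → ℝ}, IsMode k e → (k = 1 ∨ k = -1) →
      mode e (d 0) 0 = 0 ∧ mode e (d 1) 0 = 0 ∧ mode e (d 2) 0 = 0 := by
    have t1 : ∀ {e : ℝ → ℝ}, IsMode 1 e →
        mode e (d 0) 0 = 0 ∧ mode e (d 1) 0 = 0 ∧ mode e (d 2) 0 = 0 := fun {e} he => by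
      have := hcomp he.isAngular
      obtain ⟨h2, h3⟩ := h1 e he
      exact ⟨h2, by linarith, h3⟩
    intro k e he hk
    rcases hk with rfl | rfl
    · exact t1 he
    · rcases he with rfl | rfl
      · have : cosMode (-1) = cosMode 1 := by funext θ; simp [cosMode]
        rw [this]; exact t1 (Or.inl rfl)
      · have : ∀ ψ, mode (sinMode (-1)) ψ 0 = -mode (sinMode 1) ψ 0 := fun ψ => by
          rw [mode_zero, mode_zero, ← integral_neg]
          congr 1; funext θ; simp [sinMode]
        obtain ⟨h2, h3, h4⟩ := t1 (Or.inr rfl : IsMode 1 (sinMode 1))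
        rw [this, this, this, h2, h3, h4]
        norm_num
  have forms : ∀ {k : ℤ} {e : ℝ → ℝ}, k ≠ 0 → IsMode k e →
      modeForm (fun _ => 1) (fun t => 2 * sch t ^ 2) (-1 / 2) ((k:ℝ) ^ 2) (mode e (d 0))
        (coef e (d 0).pt) = 0 ∧
      modeForm rad (fun _ => 0) 1 ((k:ℝ) ^ 2) (mode e (d 1)) (coef e (d 1).pt) = 0 ∧
      modeForm (fun _ => 1) (fun t => 2 * sch t ^ 2) (-1 / 2) ((k:ℝ) ^ 2) (mode e (d 2))
        (coef e (d 2).pt) = 0 := by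
    intro k e hk he
    have hk' := congrFun hall k
    simp only [Pi.zero_apply] at hk'
    obtain ⟨p0, q0⟩ := n0 hk
    obtain ⟨p1, q1⟩ := n1 hk
    obtain ⟨p2, q2⟩ := n2 hk
    rcases he with rfl | rfl
    · exact ⟨by linarith, by linarith, by linarith⟩
    · exact ⟨by linarith, by linarith, by linarith⟩
  have zero_mode : ∀ {e : ℝ → ℝ}, IsMode 0 e → ∀ t, 0 ≤ t → ∀ i, mode e (d i) t = 0 := by
    intro e he t ht i
    rcases he with rfl | rfl
    · fin_cases i
      · exact (a0 t ht).trans (by rw [hr₀, zero_mul])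
      · exact (a1 t ht).trans hm1
      · exact (a2 t ht).trans (by rw [hr₂, zero_mul])
    · rw [mode_sinMode_zero]; rfl
  funext i
  fin_cases i
  · refine X0.eq_zero_of_modes (m 0) fun k e he t ht => ?_
    by_cases hk : k = 0
    · subst hk; exact zero_mode he t ht 0
    · exact X0.mode_eq_zero modeStable_catenoid (m 0) hk he (forms hk he).1
        (fun h => (tr he h).1) ht
  · refine X1.eq_zero_of_modes (m 1) fun k e he t ht => ?_
    by_cases hk : k = 0
    · subst hk; exact zero_mode he t ht 1
    · exact X1.mode_eq_zero modeStable_plane (m 1) hk he (forms hk he).2.1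
        (fun h => (tr he h).2.1) ht
  · refine X2.eq_zero_of_modes (m 2) fun k e he t ht => ?_
    by_cases hk : k = 0
    · subst hk; exact zero_mode he t ht 2
    · exact X2.mode_eq_zero modeStable_catenoid (m 2) hk he (forms hk he).2.2
        (fun h => (tr he h).2.2) ht

/-! ## The null functions -/

/-- The radial null function: `tanh` on the catenoidal faces, constant on the plane. -/
def radialNull : JFun :=
  ![sepJet isPrim_tnh (isAngular_cosMode 0), sepJet isPrim_one (isAngular_cosMode 0),
    sepJet isPrim_tnh (isAngular_cosMode 0)]

/-- The null function `(e / cosh, -e / r, 0)`. -/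
def upperNull {e : ℝ → ℝ} (he : IsAngular e) : JFun :=
  ![sepJet isPrim_sch he, sepJet isPrim_neg_rad_inv he, 0]

/-- The null function `(0, -e / r, e / cosh)`. -/
def lowerNull {e : ℝ → ℝ} (he : IsAngular e) : JFun :=
  ![0, sepJet isPrim_neg_rad_inv he, sepJet isPrim_sch he]

/-- The traces are `-1/2`, `1`, `-1/2`. The form of each component against `ψ` is minus the radial
boundary value of `ψ` on that face, and these add up to zero by compatibility. -/
lemma radialNull_mem (hc : 0 < c) : radialNull ∈ nullSubmodule hc := by
  refine ⟨⟨fun i => ?_, ?_⟩, fun ψ hψ => ?_⟩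
  · fin_cases i
    · exact memWStar_tnh hc (by norm_num)
    · exact memWStar_one hc
    · exact memWStar_tnh hc (by norm_num)
  · refine AEEqFun.ext ?_
    have h1 := sepJet_trace isPrim_tnh (isAngular_cosMode 0)
    have h2 := sepJet_trace isPrim_one (isAngular_cosMode 0)
    filter_upwards [AEEqFun.coeFn_zero (α := ℝ) (β := ℝ) (μ := circleMeasure), h1, h2,
      AEEqFun.coeFn_add ((radialNull 0).trace + (radialNull 1).trace) (radialNull 2).trace,
      AEEqFun.coeFn_add (radialNull 0).trace (radialNull 1).trace] with θ e0 e1 e2 e3 e4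
    rw [e0, e3, Pi.add_apply, e4, Pi.add_apply]
    simp only [radialNull, Matrix.cons_val]
    rw [e1, e2, tnh_zero, Pi.zero_apply]; ring
  · have h0 := form_tnh hc (by norm_num) (hψ.1 0)
    have h1 := form_one hc (hψ.1 1)
    have h2 := form_tnh hc (by norm_num) (hψ.1 2)
    have h3 := mode_compatible (fun i => (hψ.1 i).1.1) hψ.2 (isAngular_cosMode 0)
    rw [indexForm, Fin.sum_univ_three]
    calc _ = -mode (cosMode 0) (ψ 0) 0 + -mode (cosMode 0) (ψ 1) 0 + -mode (cosMode 0) (ψ 2) 0 :=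
          congrArg₂ _ (congrArg₂ _ h0 h1) h2
      _ = 0 := by linarith

/-- The radii agree at the junction: `sch(0) = √3 / 2 = 1 / rad(0)`. -/
lemma sch_trace_add {e : ℝ → ℝ} (he : IsAngular e) :
    (sepJet isPrim_sch he).trace + (sepJet isPrim_neg_rad_inv he).trace = 0 := by
  refine AEEqFun.ext ?_
  filter_upwards [AEEqFun.coeFn_zero (α := ℝ) (β := ℝ) (μ := circleMeasure),
    sepJet_trace isPrim_sch he, sepJet_trace isPrim_neg_rad_inv he,
    AEEqFun.coeFn_add (sepJet isPrim_sch he).trace (sepJet isPrim_neg_rad_inv he).trace]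
    with θ e0 e1 e2 e3
  rw [e0, e3, Pi.add_apply, e1, e2, sch_zero, rad_zero, inv_div, Pi.zero_apply]; ring

/-- Each component annihilates the form on its own face, so compatibility is needed only for
membership in the space and not for the test function. -/
lemma upperNull_mem (hc : 0 < c) {e : ℝ → ℝ} (he : IsMode 1 e) :
    upperNull he.isAngular ∈ nullSubmodule hc := by
  refine ⟨⟨fun i => ?_, ?_⟩, fun ψ hψ => ?_⟩
  · fin_cases i
    · exact memWStar_sch hc (by norm_num) he.isAngular
    · exact memWStar_neg_rad_inv hc he.isAngular
    · exact (isFace_two hc).memWStar_of_memWc (isFace_two hc).memWc_zero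
  · change (sepJet isPrim_sch he.isAngular).trace +
      (sepJet isPrim_neg_rad_inv he.isAngular).trace + 0 = 0
    rw [sch_trace_add, add_zero]
  · have h0 := form_sch hc (by norm_num) he (hψ.1 0)
    have h1 := form_neg_rad_inv hc he (hψ.1 1)
    have h2 := (isFace_two hc).form_zero_right (ψ 2)
    rw [(isFace_two hc).form_comm] at h2
    rw [indexForm, Fin.sum_univ_three]
    calc _ = (0 : ℝ) + 0 + 0 := congrArg₂ _ (congrArg₂ _ h0 h1) h2
      _ = 0 := by norm_num

lemma lowerNull_mem (hc : 0 < c) {e : ℝ → ℝ} (he : IsMode 1 e) :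
    lowerNull he.isAngular ∈ nullSubmodule hc := by
  refine ⟨⟨fun i => ?_, ?_⟩, fun ψ hψ => ?_⟩
  · fin_cases i
    · exact (isFace_zero hc).memWStar_of_memWc (isFace_zero hc).memWc_zero
    · exact memWStar_neg_rad_inv hc he.isAngular
    · exact memWStar_sch hc (by norm_num) he.isAngular
  · change 0 + (sepJet isPrim_neg_rad_inv he.isAngular).trace +
      (sepJet isPrim_sch he.isAngular).trace = 0
    rw [zero_add, add_comm, sch_trace_add]
  · have h0 := (isFace_zero hc).form_zero_right (ψ 0)
    have h1 := form_neg_rad_inv hc he (hψ.1 1)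
    have h2 := form_sch hc (by norm_num) he (hψ.1 2)
    rw [(isFace_zero hc).form_comm] at h0
    rw [indexForm, Fin.sum_univ_three]
    calc _ = (0 : ℝ) + 0 + 0 := congrArg₂ _ (congrArg₂ _ h0 h1) h2
      _ = 0 := by norm_num

lemma isMode_cos : IsMode 1 (cosMode 1) := Or.inl rfl

lemma isMode_sin : IsMode 1 (sinMode 1) := Or.inr rfl

/-! ### A basis of the null space and dual coordinates -/

/-- A basis of the null space. -/
def nullBasis : Fin 5 → JFun :=
  ![radialNull, upperNull isMode_cos.isAngular, lowerNull isMode_cos.isAngular,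
    upperNull isMode_sin.isAngular, lowerNull isMode_sin.isAngular]

lemma nullBasis_mem (hc : 0 < c) (j : Fin 5) : nullBasis j ∈ nullSubmodule hc := by
  fin_cases j
  exacts [radialNull_mem hc, upperNull_mem hc isMode_cos, lowerNull_mem hc isMode_cos,
    upperNull_mem hc isMode_sin, lowerNull_mem hc isMode_sin]

/-- The angular functions of the coordinates on the null space. -/
def coordMode : Fin 5 → ℝ → ℝ := ![cosMode 0, cosMode 1, cosMode 1, sinMode 1, sinMode 1]

/-- The faces of the coordinates on the null space. -/
def coordFace : Fin 5 → Fin 3 := ![0, 0, 2, 0, 2]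

lemma isAngular_coordMode (j : Fin 5) : IsAngular (coordMode j) := by
  fin_cases j
  exacts [isAngular_cosMode 0, isAngular_cosMode 1, isAngular_cosMode 1, isAngular_sinMode 1,
    isAngular_sinMode 1]

/-- Coordinates on the null space: boundary values of modes. -/
def nullCoord (hc : 0 < c) : nullSubmodule hc →ₗ[ℝ] (Fin 5 → ℝ) where
  toFun φ j := mode (coordMode j) (φ.1 (coordFace j)) 0
  map_add' φ ψ := by
    funext j
    exact mode_add (φ.2.1.1 _).1.1 (ψ.2.1.1 _).1.1 ((φ + ψ).2.1.1 _).1.1 (isAngular_coordMode j)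
      le_rfl
  map_smul' r φ := by
    funext j
    exact mode_smul (φ.2.1.1 _).1.1 r ((r • φ).2.1.1 _).1.1 (isAngular_coordMode j) le_rfl

/-- The coordinates are exactly the boundary values required by `eq_zero_of_null`: one radial value
on the first catenoid, and the first modes on both catenoids. -/
lemma nullCoord_injective (hc : 0 < c) : Function.Injective (nullCoord hc) := by
  rw [← LinearMap.ker_eq_bot, LinearMap.ker_eq_bot']
  intro φ hφ
  refine Subtype.ext (eq_zero_of_null hc φ.2 (congrFun hφ 0) fun e he => ?_)
  rcases he with rfl | rfl
  exacts [⟨congrFun hφ 1, congrFun hφ 2⟩, ⟨congrFun hφ 3, congrFun hφ 4⟩]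

lemma integral_cosMode_zero_sq : ∫ θ, cosMode 0 θ * cosMode 0 θ ∂circleMeasure = 2 * π := by
  simp [cosMode, circleMeasure, Measure.real, ENNReal.toReal_ofReal pi_pos.le]

lemma integral_cosMode_one_sq : ∫ θ, cosMode 1 θ * cosMode 1 θ ∂circleMeasure = π := by
  rw [circleMeasure, ← intervalIntegral.integral_of_le (by positivity)]
  simp only [cosMode, Int.cast_one, one_mul, ← sq]
  rw [integral_cos_sq]; simp

lemma integral_sinMode_one_sq : ∫ θ, sinMode 1 θ * sinMode 1 θ ∂circleMeasure = π := by
  rw [circleMeasure, ← intervalIntegral.integral_of_le (by positivity)]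
  simp only [sinMode, Int.cast_one, one_mul, ← sq]
  rw [integral_sin_sq]; simp

lemma integral_cosMode_mul_sinMode :
    ∫ θ, cosMode 1 θ * sinMode 1 θ ∂circleMeasure = 0 := by
  rw [circleMeasure, ← intervalIntegral.integral_of_le (by positivity)]
  simp only [cosMode, sinMode, Int.cast_one, one_mul]
  simp_rw [mul_comm (cos _)]
  rw [integral_sin_mul_cos₁]; simp

lemma integral_sinMode_mul_cosMode :
    ∫ θ, sinMode 1 θ * cosMode 1 θ ∂circleMeasure = 0 := by
  simp_rw [mul_comm (sinMode _ _)]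
  exact integral_cosMode_mul_sinMode

lemma integral_cosMode_one_mul : ∫ θ, cosMode 1 θ * cosMode 0 θ ∂circleMeasure = 0 := by
  have := (isAngular_sinMode 1).integral_deriv
  rw [deriv_sinMode] at this
  simpa [cosMode] using this

lemma integral_sinMode_one_mul : ∫ θ, sinMode 1 θ * cosMode 0 θ ∂circleMeasure = 0 := by
  have := (isAngular_cosMode 1).integral_deriv
  rw [deriv_cosMode] at this
  simp only [neg_mul, integral_neg, neg_eq_zero, Int.cast_one, one_mul] at this
  simpa [cosMode] using this

lemma integral_mul_cosMode_one : ∫ θ, cosMode 0 θ * cosMode 1 θ ∂circleMeasure = 0 := by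
  simp_rw [mul_comm (cosMode 0 _)]
  exact integral_cosMode_one_mul

lemma integral_mul_sinMode_one : ∫ θ, cosMode 0 θ * sinMode 1 θ ∂circleMeasure = 0 := by
  simp_rw [mul_comm (cosMode 0 _)]
  exact integral_sinMode_one_mul

lemma mode_zero_jet (e : ℝ → ℝ) : mode e 0 0 = 0 := mode_zero_of_trace rfl

/-- The planar components are invisible to the coordinates, so orthogonality of the modes makes the
matrix diagonal. The entries are `2π tnh(0) = -π` and `π sch(0)`. -/
lemma nullCoord_nullBasis (hc : 0 < c) (i j : Fin 5) :
    nullCoord hc ⟨nullBasis j, nullBasis_mem hc j⟩ i =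
      if i = j then (![-π, π * (√3 / 2), π * (√3 / 2), π * (√3 / 2), π * (√3 / 2)] : Fin 5 → ℝ) j
      else 0 := by
  fin_cases i <;> fin_cases j <;>
  simp [nullCoord, coordMode, coordFace, nullBasis, radialNull, upperNull, lowerNull, mode_sepJet,
    mode_zero_jet, tnh_zero, sch_zero, integral_cosMode_zero_sq, integral_cosMode_one_sq,
    integral_sinMode_one_sq, integral_cosMode_mul_sinMode, integral_sinMode_mul_cosMode,
    integral_cosMode_one_mul, integral_sinMode_one_mul, integral_mul_cosMode_one,
    integral_mul_sinMode_one]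
  ring

lemma linearIndependent_nullBasis : LinearIndependent ℝ nullBasis := by
  -- The basis functions do not depend on `c`, so independence may be tested with the coordinates
  -- for `c = 1`.
  have hc : (0:ℝ) < 1 := one_pos
  have h : LinearIndependent ℝ fun j => (⟨nullBasis j, nullBasis_mem hc j⟩ : nullSubmodule hc) := by
    rw [Fintype.linearIndependent_iff]
    intro g hg i
    have h1 := congrFun (congrArg (nullCoord hc) hg) i
    rw [map_sum, map_zero, Finset.sum_apply, Finset.sum_eq_single i] at h1
    · rw [map_smul, Pi.smul_apply, nullCoord_nullBasis, if_pos rfl, smul_eq_mul] at h1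
      refine (mul_eq_zero.1 h1).resolve_right ?_
      have := pi_pos
      fin_cases i <;> simp [pi_ne_zero]
    · intro j _ hj
      rw [map_smul, Pi.smul_apply, nullCoord_nullBasis, if_neg hj.symm, smul_zero]
    · simp
  exact h.map' (nullSubmodule hc).subtype (Submodule.ker_subtype _)

lemma finrank_nullSubmodule (hc : 0 < c) :
    FiniteDimensional ℝ (nullSubmodule hc) ∧ Module.finrank ℝ (nullSubmodule hc) ≤ 5 := by
  refine ⟨FiniteDimensional.of_injective _ (nullCoord_injective hc), ?_⟩
  simpa using LinearMap.finrank_le_finrank_of_injective (nullCoord_injective hc)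

/-- Five independent vectors in a space of dimension at most five. -/
lemma nullSubmodule_eq_span (hc : 0 < c) :
    Submodule.span ℝ (range nullBasis) = nullSubmodule hc := by
  obtain ⟨h1, h2⟩ := finrank_nullSubmodule hc
  refine Submodule.eq_of_le_of_finrank_le (Submodule.span_le.2 ?_) ?_
  · rintro _ ⟨j, rfl⟩
    exact nullBasis_mem hc j
  · rw [finrank_span_eq_card linearIndependent_nullBasis]
    simpa using h2

/-! ### The shape of the null functions -/

lemma isRadial_radialNull : IsRadial radialNull := by
  refine ⟨![tnh, fun _ => 1, tnh], fun i => ?_⟩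
  fin_cases i
  · filter_upwards [sepJet_val isPrim_tnh (isAngular_cosMode 0)] with z hz
    exact hz.trans (by simp [cosMode])
  · filter_upwards [sepJet_val isPrim_one (isAngular_cosMode 0)] with z hz
    exact hz.trans (by simp [cosMode])
  · filter_upwards [sepJet_val isPrim_tnh (isAngular_cosMode 0)] with z hz
    exact hz.trans (by simp [cosMode])

lemma IsRadial.smul {φ : JFun} (h : IsRadial φ) (r : ℝ) : IsRadial (r • φ) := by
  obtain ⟨f, hf⟩ := h
  refine ⟨fun i t => r * f i t, fun i => ?_⟩
  filter_upwards [hf i, AEEqFun.coeFn_smul r (φ i).val] with z h1 h2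
  exact h2.trans (by rw [Pi.smul_apply, h1, smul_eq_mul])

namespace IsFirstMode

lemma zero : IsFirstMode 0 := by
  refine ⟨fun _ _ => 0, fun _ _ => 0, fun i => ?_⟩
  filter_upwards [AEEqFun.coeFn_zero (α := ℝ × ℝ) (β := ℝ) (μ := stripMeasure)] with z hz
  exact hz.trans (by simp)

lemma add {φ ψ : JFun} (h : IsFirstMode φ) (h' : IsFirstMode ψ) : IsFirstMode (φ + ψ) := by
  obtain ⟨f, g, hf⟩ := h
  obtain ⟨f', g', hf'⟩ := h'
  refine ⟨fun i t => f i t + f' i t, fun i t => g i t + g' i t, fun i => ?_⟩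
  filter_upwards [hf i, hf' i, AEEqFun.coeFn_add (φ i).val (ψ i).val] with z h1 h2 h3
  exact h3.trans (by rw [Pi.add_apply, h1, h2]; ring)

lemma smul {φ : JFun} (h : IsFirstMode φ) (r : ℝ) : IsFirstMode (r • φ) := by
  obtain ⟨f, g, hf⟩ := h
  refine ⟨fun i t => r * f i t, fun i t => r * g i t, fun i => ?_⟩
  filter_upwards [hf i, AEEqFun.coeFn_smul r (φ i).val] with z h1 h2
  exact h2.trans (by rw [Pi.smul_apply, h1, smul_eq_mul]; ring)

/-- A function that on each face is a separated function, or zero, with angular part `cos θ` or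
`sin θ`, is a first mode. -/
lemma of_val {φ : JFun} {a : Fin 3 → ℝ → ℝ} {e : ℝ → ℝ} (he : IsMode 1 e)
    (h : ∀ i, ∀ᵐ z ∂stripMeasure, (φ i).val z = a i z.1 * e z.2) : IsFirstMode φ := by
  rcases he with rfl | rfl
  · refine ⟨a, fun _ _ => 0, fun i => ?_⟩
    filter_upwards [h i] with z hz
    rw [hz]; simp [cosMode]
  · refine ⟨fun _ _ => 0, a, fun i => ?_⟩
    filter_upwards [h i] with z hz
    rw [hz]; simp [sinMode]

end IsFirstMode

lemma isFirstMode_upperNull {e : ℝ → ℝ} (he : IsMode 1 e) :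
    IsFirstMode (upperNull he.isAngular) := by
  refine .of_val (a := ![sch, fun t => -(rad t)⁻¹, 0]) he fun i => ?_
  fin_cases i
  · exact sepJet_val isPrim_sch he.isAngular
  · exact sepJet_val isPrim_neg_rad_inv he.isAngular
  · filter_upwards [AEEqFun.coeFn_zero (α := ℝ × ℝ) (β := ℝ) (μ := stripMeasure)] with z hz
    exact hz.trans (by simp)

lemma isFirstMode_lowerNull {e : ℝ → ℝ} (he : IsMode 1 e) :
    IsFirstMode (lowerNull he.isAngular) := by
  refine .of_val (a := ![0, fun t => -(rad t)⁻¹, sch]) he fun i => ?_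
  fin_cases i
  · filter_upwards [AEEqFun.coeFn_zero (α := ℝ × ℝ) (β := ℝ) (μ := stripMeasure)] with z hz
    exact hz.trans (by simp)
  · exact sepJet_val isPrim_neg_rad_inv he.isAngular
  · exact sepJet_val isPrim_sch he.isAngular

lemma isFirstMode_nullBasis_succ (j : Fin 4) : IsFirstMode (nullBasis j.succ) := by
  fin_cases j
  exacts [isFirstMode_upperNull isMode_cos, isFirstMode_lowerNull isMode_cos,
    isFirstMode_upperNull isMode_sin, isFirstMode_lowerNull isMode_sin]

/-- The null space is five-dimensional; it splits into radial functions and first modes. -/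
lemma nullSpace_decomposition (hc : 0 < c) : ∃ N N₀ N₁ : Submodule ℝ JFun,
    (N : Set JFun) = nullSet (WDeltaStar (pseudoYCatenoid c)) (indexForm (pseudoYCatenoid c)) ∧
    Module.finrank ℝ N = 5 ∧ N = N₀ ⊔ N₁ ∧ Disjoint N₀ N₁ ∧
    Module.finrank ℝ N₀ = 1 ∧ (∀ φ ∈ N₀, IsRadial φ) ∧
    Module.finrank ℝ N₁ = 4 ∧ (∀ φ ∈ N₁, IsFirstMode φ) := by
  have hli := linearIndependent_nullBasis
  have hr : nullBasis '' {0} = {radialNull} := image_singleton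
  refine ⟨nullSubmodule hc, Submodule.span ℝ {radialNull},
    Submodule.span ℝ (range (nullBasis ∘ Fin.succ)), rfl, ?_, ?_, ?_,
    finrank_span_singleton (hli.ne_zero 0), ?_, ?_, ?_⟩
  · rw [← nullSubmodule_eq_span, finrank_span_eq_card hli, Fintype.card_fin]
  · rw [← nullSubmodule_eq_span, ← Submodule.span_union, ← hr, range_comp, ← image_union,
      ← image_univ]
    congr 2
    ext j
    refine Fin.cases ?_ (fun j => ?_) j <;> simp
  · rw [← hr, range_comp]
    -- Spans of disjoint parts of an independent family meet only in zero.
    refine hli.disjoint_span_image (disjoint_singleton_left.2 ?_)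
    rintro ⟨j, hj⟩
    exact Fin.succ_ne_zero j hj
  · intro φ hφ
    obtain ⟨r, rfl⟩ := Submodule.mem_span_singleton.1 hφ
    exact isRadial_radialNull.smul r
  · rw [finrank_span_eq_card (hli.comp _ (Fin.succ_injective 4)), Fintype.card_fin]
  · intro φ hφ
    induction hφ using Submodule.span_induction with
    | mem x hx =>
      obtain ⟨j, rfl⟩ := hx
      exact isFirstMode_nullBasis_succ j
    | zero => exact .zero
    | add x y _ _ hx hy => exact hx.add hy
    | smul r x _ hx => exact hx.smul r

end TripleJunction

end

open TripleJunction

theorem theorem4p4 (c : ℝ) (hc : 0 < c) :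
    HasIndex (WDeltaC (pseudoYCatenoid c)) (indexForm (pseudoYCatenoid c)) 2 ∧
    HasIndex (WDeltaStar (pseudoYCatenoid c)) (indexForm (pseudoYCatenoid c)) 2 ∧
    HasIndex (WDirichlet (pseudoYCatenoid c 0)) (faceForm (pseudoYCatenoid c 0)) 1 ∧
    HasIndex (WDirichlet (pseudoYCatenoid c 1)) (faceForm (pseudoYCatenoid c 1)) 0 ∧
    HasIndex (WDirichlet (pseudoYCatenoid c 2)) (faceForm (pseudoYCatenoid c 2)) 1 ∧
    ∃ N N₀ N₁ : Submodule ℝ JFun,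
      (N : Set JFun) = nullSet (WDeltaStar (pseudoYCatenoid c)) (indexForm (pseudoYCatenoid c)) ∧
      Module.finrank ℝ N = 5 ∧
      N = N₀ ⊔ N₁ ∧ Disjoint N₀ N₁ ∧
      Module.finrank ℝ N₀ = 1 ∧ (∀ φ ∈ N₀, IsRadial φ) ∧
      Module.finrank ℝ N₁ = 4 ∧ (∀ φ ∈ N₁, IsFirstMode φ) := by
  exact ⟨hasIndex_two hc subset_rfl (wDeltaC_subset_wDeltaStar hc),
    hasIndex_two hc (wDeltaC_subset_wDeltaStar hc) subset_rfl,
    hasIndex_dirichlet_catenoid hc (by norm_num), hasIndex_dirichlet_plane hc,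
    hasIndex_dirichlet_catenoid hc (by norm_num), nullSpace_decomposition hc⟩
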